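/- **Setting.** Let $\mathfrak g=\mathfrak{gl}(3)$ over $\mathbb C$, with matrix units $E_{ij}$, and let $\alpha\in\mathbb C$. Let $S^\alpha(V)$ be the span of the formal monomials $x_1^{k_1}x_2^{k_2}x_3^{k_3}$ with $k_1+k_2+k_3=\alpha$, $k_2,k_3\in\mathbb Z_{\ge0}$ (and $k_1\in\mathbb Z_{\ge 0}$ if $\alpha\in\mathbb Z_{\ge0}$), on which $E_{ij}$ acts by $x_i\partial/\partial x_j$. Let $J^\alpha\subset U(\mathfrak g)$ be its annihilator and $\mathfrak A^\alpha=U(\mathfrak g)/J^\alpha$. Let $\omega$ be the antiinvolution with $\omega(E_{ij})=E_{ji}$. Let $\langle a,b\rangle_\alpha=L(a\,\omega(b))$, where $L$ is the linear functional on $\mathfrak A^\alpha$ that vanishes on commutators and whose value at the image of a central $z\in U(\mathfrak g)$ is the scalar by which $z$ acts on the highest weight vector $x_1^\alpha$. (There is exactly one such $L$; this is part of the claim. Equivalently $\langle a,b\rangle_\alpha=\varphi((a\,\omega(b))^\sharp)(\alpha,0,0)$, with $\sharp$ the projection of $U(\mathfrak g)=Z\oplus[U(\mathfrak g),U(\mathfrak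 g)]$ to the centre $Z$ and $\varphi$ the Harish-Chandra homomorphism.) Let $R=\mathbb C[E_{11},E_{22},E_{33}]/(E_{11}+E_{22}+E_{33}-\alpha)$, acting on $\mathfrak A^\alpha$ by left multiplication. Let $Q=\{\nu=\sum\nu_i\varepsilon_i:\nu_i\in\mathbb Z,\ \sum\nu_i=0\}$, $\nu(E_{ii})=\nu_i$, and let $(\mathfrak A^\alpha)_\nu$ be the $\nu$-weight space for the adjoint action of $\mathrm{span}(E_{11},E_{22},E_{33})$. Let $Q^+$ be the set of $\nu\in Q$ for which some nonzero $a\in(\mathfrak A^\alpha)_\nu$ satisfies $[E_{12},a]=0$. For $\nu\in Q$ put $u_\nu=r_1^{\nu_1}r_2^{\nu_2}r_3^{\nu_3}$, where $r_i^{n}$ is $x_i^n$ for $n\ge0$ and $(\partial/\partial x_i)^{-n}$ for $n\le0$; this operator is the action of the product of the $E_{ij}^{\min(\max(\nu_i,0),\,\max(-\nu_j,0))}$, $i\ne j$, and so $u_\nu\in\mathfrak A^\alpha$. For $f,g\in R$ put $\langle f,g\rangle_\nu=\langle fu_\nu,gu_\nu\rangle_\alpha$. Finally let $z_{21}=E_{21}$,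 $z_{31}=(E_{11}-E_{22}+2)E_{31}+E_{21}E_{32}$, $z_{23}=(E_{11}-E_{22}+2)E_{23}-E_{21}E_{13}$, and let $\mathrm{ad}$ be the adjoint action of $U(\mathfrak g)$ on $\mathfrak A^\alpha$. An orthogonal basis of $R$ for $\langle\cdot,\cdot\rangle_\nu$ means a vector space basis of $R$ with pairwise orthogonal members. **Theorem 2.5.** Let $\alpha\in\mathbb C$. 0) For every $\nu\in Q$, $(\mathfrak A^\alpha)_\nu=R\,u_\nu$. If $\alpha\notin\mathbb Z_{\ge0}$, then $f\mapsto fu_\nu$ is injective on $R$, and every $a\in\mathfrak A^\alpha$ with $(\mathfrak A^\alpha)_\nu=Ra$ is a nonzero constant multiple of $u_\nu$. 1) $\langle(\mathfrak A^\alpha)_\mu,(\mathfrak A^\alpha)_\nu\rangle_\alpha=0$ for $\mu\ne\nu$ in $Q$. 2) Let $\nu\in Q^+$. There are $f^\nu_{l,k}\in R$ ($l,k\ge0$) that form an orthogonal basis of $R$ for $\langle\cdot,\cdot\rangle_\nu$ and satisfy, for all $l,k$, $$f^\nu_{l,k}u_\nu=(\mathrm{ad}\,z_{21})^l(\mathrm{ad}\,z_{31})^k\,u_{\nu+k(\varepsilon_1-\varepsilon_3)+l(\varepsilon_1-\varepsilon_2)}\quad\text{if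 }\nu(E_{33})\le0,$$ $$f^\nu_{l,k}u_\nu=(\mathrm{ad}\,z_{21})^l(\mathrm{ad}\,z_{23})^k\,u_{\nu+k(\varepsilon_3-\varepsilon_2)+l(\varepsilon_1-\varepsilon_2)}\quad\text{if }\nu(E_{33})\ge0$$ (for $\nu(E_{33})=0$ there is such a family for each of the two formulas). By 0), the $f^\nu_{l,k}$ are determined by these equations if $\alpha\notin\mathbb Z_{\ge0}$. 3) Let the Weyl group $S_3$ act on $R$ and $Q$ by permuting the $E_{ii}$ and the $\varepsilon_i$. If $\nu\in Q$ and $(f_i)$ is an orthogonal basis of $R$ for $\langle\cdot,\cdot\rangle_\nu$, then $(w(f_i))$ is an orthogonal basis of $R$ for $\langle\cdot,\cdot\rangle_{w(\nu)}$, for every $w\in S_3$. 4) Identify $R$ with $\mathbb C[H_1,H_2]$, $H_1=E_{11}-E_{22}$, $H_2=E_{33}$. If $\nu=a\varepsilon_1+b\varepsilon_2+c\varepsilon_3\in Q^+$ and $c=\nu(E_{33})\le0$, then the family in 2) for the formula with $z_{31}$ can be chosen (for $\alpha\notin\mathbb Z_{\ge0}$: is) such that each $f=f^\nu_{l,k}$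 satisfies $$\begin{aligned}&[f(H_1+2,H_2)-f(H_1,H_2)]\cdot\tfrac14(H_1-H_2+\alpha+2)(H_1+H_2-\alpha)\\&-[f(H_1,H_2)-f(H_1-2,H_2)]\cdot\tfrac14(H_1-H_2+\alpha-2a)(H_1+H_2-\alpha-2+2b)\\&=[l^2+l(a-b+1)]\,f(H_1,H_2),\end{aligned}$$ $$\begin{aligned}&[\alpha-c(\alpha+2+c)+H_2(2\alpha+1+2c)-2H_2^2]\,f(H_1,H_2)\\&-\tfrac12(H_2+1-c)(H_1-H_2+\alpha-2a)\,f(H_1-1,H_2+1)\\&-\tfrac12H_2(H_1-H_2+\alpha+2)\,f(H_1+1,H_2-1)\\&-\tfrac12(H_2+1-c)(\alpha-H_1-H_2)\,f(H_1+1,H_2+1)\\&-\tfrac12H_2(\alpha-H_1-H_2+2-2b)\,f(H_1-1,H_2-1)\\&=[k^2+2kl+2k(1+a)+l(1+a+b)+3a+2b-b(a+b)]\,f(H_1,H_2).\end{aligned}$$ -/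

import Mathlib

noncomputable section

namespace GL3

attribute [local instance 100] LieRing.ofAssociativeRing

/-- The Lie algebra `gl(3)` over `ℂ`. -/
abbrev gl3 : Type := Matrix (Fin 3) (Fin 3) ℂ

/-- The enveloping algebra `U(gl(3))`. -/
abbrev U : Type := UniversalEnvelopingAlgebra ℂ gl3

/-- The matrix unit `E_{ij}` as an element of `U(gl(3))` (indices `0, 1, 2`). -/
def E (i j : Fin 3) : U := UniversalEnvelopingAlgebra.ι ℂ (Matrix.single i j (1 : ℂ))

/-! ### The modules `S^α(V)` and the algebras `A^α` -/

/-- Formal linear combinations of formal monomials `x₁^{k₁} x₂^{k₂} x₃^{k₃}`, `k ∈ ℂ³`. -/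
def Mono : Type := (Fin 3 → ℂ) →₀ ℂ

instance : AddCommGroup Mono := inferInstanceAs (AddCommGroup ((Fin 3 → ℂ) →₀ ℂ))

instance : Module ℂ Mono := inferInstanceAs (Module ℂ ((Fin 3 → ℂ) →₀ ℂ))

/-- The basis `x^k`, `k ∈ ℂ³`, of the space of formal monomials. -/
def mono : Module.Basis (Fin 3 → ℂ) ℂ Mono := ⟨LinearEquiv.refl ℂ Mono⟩

/-- Multiplication by `x_i`. -/
def mulX (i : Fin 3) : Module.End ℂ Mono := mono.constr ℂ fun k => mono (k + Pi.single i 1)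

/-- The derivation `∂/∂x_j`, with `∂ x^k / ∂ x_j = k_j x^{k - e_j}`. -/
def der (j : Fin 3) : Module.End ℂ Mono := mono.constr ℂ fun k => k j • mono (k - Pi.single j 1)

theorem mulX_mono (i : Fin 3) (k : Fin 3 → ℂ) : mulX i (mono k) = mono (k + Pi.single i 1) :=
  mono.constr_basis ℂ _ k

theorem der_mono (j : Fin 3) (k : Fin 3 → ℂ) : der j (mono k) = k j • mono (k - Pi.single j 1) :=
  mono.constr_basis ℂ _ k

theorem mulX_comm (i j : Fin 3) : mulX i * mulX j = mulX j * mulX i := by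
  refine mono.ext fun k => ?_
  simp only [Module.End.mul_apply, mulX_mono]
  rw [add_right_comm]

theorem der_comm (i j : Fin 3) : der i * der j = der j * der i := by
  refine mono.ext fun k => ?_
  simp only [Module.End.mul_apply, der_mono, map_smul, smul_smul]
  rw [sub_right_comm]
  congr 1
  by_cases h : i = j
  · subst h; rfl
  · simp [h, Ne.symm h]; ring

theorem der_mulX (i j : Fin 3) :
    der j * mulX i = mulX i * der j + (if j = i then 1 else 0) := by
  refine mono.ext fun k => ?_
  by_cases h : j = i
  · subst h
    rw [if_pos rfl, LinearMap.add_apply, Module.End.mul_apply, Module.End.mul_apply,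
      der_mono, mulX_mono, map_smul, mulX_mono, der_mono, Module.End.one_apply,
      add_sub_cancel_right, sub_add_cancel]
    simp [add_smul]
  · rw [if_neg h, add_zero, Module.End.mul_apply, Module.End.mul_apply,
      der_mono, mulX_mono, map_smul, mulX_mono, der_mono, sub_add_eq_add_sub]
    simp [h]

theorem unit_mono (i j : Fin 3) (k : Fin 3 → ℂ) :
    (mulX i * der j) (mono k) = k j • mono (k - Pi.single j 1 + Pi.single i 1) := by
  rw [Module.End.mul_apply, der_mono, map_smul, mulX_mono]

/-- The action of a matrix on formal monomials: `E_{ij} ↦ x_i ∂/∂x_j`. -/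
def actLin : gl3 →ₗ[ℂ] Module.End ℂ Mono where
  toFun M := ∑ i, ∑ j, M i j • (mulX i * der j)
  map_add' M N := by simp [add_smul, Finset.sum_add_distrib]
  map_smul' c M := by simp [mul_smul, Finset.smul_sum]

theorem actLin_apply (M : gl3) : actLin M = ∑ i, ∑ j, M i j • (mulX i * der j) := rfl

theorem actLin_single (i j : Fin 3) : actLin (Matrix.single i j 1) = mulX i * der j := by
  rw [actLin_apply, Finset.sum_eq_single i, Finset.sum_eq_single j]
  · simp
  · intro b _ hb; simp [Ne.symm hb]
  · simp
  · intro b _ hb; simp [Ne.symm hb]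
  · simp

theorem single_lie (i j k l : Fin 3) :
    ⁅(Matrix.single i j 1 : gl3), (Matrix.single k l 1 : gl3)⁆
      = (if j = k then Matrix.single i l 1 else 0) - (if l = i then Matrix.single k j 1 else 0) := by
  rw [LieRing.of_associative_ring_bracket]
  congr 1
  · by_cases h : j = k
    · subst h; simp
    · simp [h]
  · by_cases h : l = i
    · subst h; simp
    · simp [h]

theorem actLin_lie_single (i j k l : Fin 3) :
    actLin ⁅(Matrix.single i j 1 : gl3), (Matrix.single k l 1 : gl3)⁆
      = ⁅actLin (Matrix.single i j 1), actLin (Matrix.single k l 1)⁆ := by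
  rw [single_lie, map_sub, actLin_single, actLin_single]
  change _ = mulX i * der j * (mulX k * der l) - mulX k * der l * (mulX i * der j)
  have e1 : mulX i * der j * (mulX k * der l)
      = mulX i * mulX k * (der j * der l) + (if j = k then mulX i * der l else 0) := by
    calc _ = mulX i * (der j * mulX k) * der l := by noncomm_ring
      _ = _ := by
        rw [der_mulX]
        by_cases h : j = k
        · simp only [h, if_true]; noncomm_ring
        · simp only [h, if_false, add_zero]; noncomm_ring
  have e2 : mulX k * der l * (mulX i * der j)
      = mulX i * mulX k * (der j * der l) + (if l = i then mulX k * der j else 0) := by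
    rw [mulX_comm i k, der_comm j l]
    calc _ = mulX k * (der l * mulX i) * der j := by noncomm_ring
      _ = _ := by
        rw [der_mulX]
        by_cases h : l = i
        · simp only [h, if_true]; noncomm_ring
        · simp only [h, if_false, add_zero]; noncomm_ring
  rw [e1, e2, add_sub_add_left_eq_sub]
  congr 1
  · split_ifs <;> simp [actLin_single]
  · split_ifs <;> simp [actLin_single]

theorem matrix_eq_sum (M : gl3) : M = ∑ i, ∑ j, M i j • (Matrix.single i j 1 : gl3) := by
  conv_lhs => rw [Matrix.matrix_eq_sum_single M]
  simp

theorem actLin_lie (M N : gl3) : actLin ⁅M, N⁆ = ⁅actLin M, actLin N⁆ := by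
  rw [matrix_eq_sum M, matrix_eq_sum N]
  simp only [sum_lie, lie_sum, smul_lie, lie_smul, map_sum, map_smul, actLin_lie_single]

/-- The representation of the Lie algebra `gl(3)` on formal monomials. -/
def act : gl3 →ₗ⁅ℂ⁆ Module.End ℂ Mono :=
  { actLin with map_lie' := fun {M N} => actLin_lie M N }

/-- The action of `U(gl(3))` on formal monomials. -/
def actU : U →ₐ[ℂ] Module.End ℂ Mono := UniversalEnvelopingAlgebra.lift ℂ act

theorem actU_E (i j : Fin 3) : actU (E i j) = mulX i * der j := by
  rw [actU, E, UniversalEnvelopingAlgebra.lift_ι_apply]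
  exact actLin_single i j

/-- The exponents of the monomials spanning `S^α(V)`: those `k` with `k₁ + k₂ + k₃ = α` and
`k₂, k₃` nonnegative integers and, if `α` is a nonnegative integer, also `k₁` a nonnegative
integer. -/
def expo (α : ℂ) : Set (Fin 3 → ℂ) :=
  {k | k 0 + k 1 + k 2 = α ∧ (∃ b : ℕ, k 1 = b) ∧ (∃ c : ℕ, k 2 = c) ∧
    ((∃ n : ℕ, α = n) → ∃ a : ℕ, k 0 = a)}

/-- The module `S^α(V)`, with the action `E_{ij} ↦ x_i ∂/∂x_j`. -/
def S (α : ℂ) : Submodule ℂ Mono := Submodule.span ℂ (mono '' expo α)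

theorem nat_pred {z : ℂ} (h : ∃ n : ℕ, z = n) (h0 : z ≠ 0) : ∃ n : ℕ, z - 1 = n := by
  obtain ⟨n, rfl⟩ := h
  cases n with
  | zero => simp at h0
  | succ m => exact ⟨m, by push_cast; ring⟩

theorem nat_succ {z : ℂ} (h : ∃ n : ℕ, z = n) : ∃ n : ℕ, z + 1 = n := by
  obtain ⟨n, rfl⟩ := h
  exact ⟨n + 1, by push_cast; ring⟩

theorem expo_move (α : ℂ) (i j : Fin 3) (k : Fin 3 → ℂ) (hk : k ∈ expo α) (h0 : k j ≠ 0) :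
    k - Pi.single j 1 + Pi.single i 1 ∈ expo α := by
  by_cases hij : i = j
  · subst hij; rwa [sub_add_cancel]
  obtain ⟨h1, h2, h3, h4⟩ := hk
  refine ⟨?_, ?_, ?_, fun hα => ?_⟩
  · rw [← h1]
    fin_cases i <;> fin_cases j <;> simp at hij ⊢ <;> ring
  · fin_cases i <;> fin_cases j <;> simp at hij h0 ⊢ <;>
      first | exact h2 | exact nat_succ h2 | exact nat_pred h2 h0
  · fin_cases i <;> fin_cases j <;> simp at hij h0 ⊢ <;>
      first | exact h3 | exact nat_succ h3 | exact nat_pred h3 h0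
  · have h5 := h4 hα
    fin_cases i <;> fin_cases j <;> simp at hij h0 ⊢ <;>
      first | exact h5 | exact nat_succ h5 | exact nat_pred h5 h0

theorem unit_stable (α : ℂ) (i j : Fin 3) (v : Mono) (hv : v ∈ S α) :
    (mulX i * der j) v ∈ S α := by
  refine Submodule.span_induction (p := fun v _ => (mulX i * der j) v ∈ S α) ?_ ?_ ?_ ?_ hv
  · rintro _ ⟨k, hk, rfl⟩
    rw [unit_mono]
    by_cases h0 : k j = 0
    · rw [h0, zero_smul]; exact Submodule.zero_mem _
    · refine Submodule.smul_mem _ _ (Submodule.subset_span ⟨_, expo_move α i j k hk h0, rfl⟩)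
  · rw [map_zero]; exact Submodule.zero_mem _
  · intro x y _ _ hx hy
    rw [map_add]; exact Submodule.add_mem _ hx hy
  · intro c x _ hx
    rw [map_smul]; exact Submodule.smul_mem _ _ hx

theorem act_stable (α : ℂ) (M : gl3) (v : Mono) (hv : v ∈ S α) : act M v ∈ S α := by
  change (∑ i, ∑ j, M i j • (mulX i * der j)) v ∈ S α
  simp only [LinearMap.sum_apply, LinearMap.smul_apply]
  exact Submodule.sum_mem _ fun i _ => Submodule.sum_mem _ fun j _ =>
    Submodule.smul_mem _ _ (unit_stable α i j v hv)

/-- The representation of `gl(3)` on `S^α(V)`. -/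
def repLie (α : ℂ) : gl3 →ₗ⁅ℂ⁆ Module.End ℂ (S α) where
  toFun M := (act M).restrict (act_stable α M)
  map_add' M N := by ext v : 1; apply Subtype.ext; simp
  map_smul' c M := by ext v : 1; apply Subtype.ext; simp
  map_lie' := by
    intro M N
    refine LinearMap.ext fun v => Subtype.ext ?_
    have h := LinearMap.congr_fun (act.map_lie M N) (v : Mono)
    exact h

/-- The representation of `U(gl(3))` on `S^α(V)`. -/
def rep (α : ℂ) : U →ₐ[ℂ] Module.End ℂ (S α) := UniversalEnvelopingAlgebra.lift ℂ (repLie α)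

theorem rep_ι (α : ℂ) (M : gl3) (v : S α) :
    (rep α (UniversalEnvelopingAlgebra.ι ℂ M) v : Mono) = actLin M v := by
  rw [rep, UniversalEnvelopingAlgebra.lift_ι_apply]
  rfl

theorem rep_E (α : ℂ) (i j : Fin 3) (v : S α) :
    (rep α (E i j) v : Mono) = (mulX i * der j) v := by
  rw [E, rep_ι, actLin_single]

/-- The kernel `J^α` of the representation `S^α(V)`. -/
abbrev J (α : ℂ) : Ideal U := RingHom.ker (rep α)

/-- The algebra `A^α = U(gl(3)) / J^α`. -/
abbrev A (α : ℂ) : Type := U ⧸ J α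

/-- The canonical map `U(gl(3)) → A^α`. -/
def toA (α : ℂ) : U →ₐ[ℂ] A α := Ideal.Quotient.mkₐ ℂ (J α)

theorem toA_eq_zero {α : ℂ} {u : U} : toA α u = 0 ↔ rep α u = 0 := by
  rw [← RingHom.mem_ker]
  exact Ideal.Quotient.eq_zero_iff_mem

/-- The adjoint action of `U(gl(3))` on `A^α`, extending `(ad x)(a) = x a - a x`, `x ∈ gl(3)`. -/
def ad (α : ℂ) : U →ₐ[ℂ] Module.End ℂ (A α) :=
  UniversalEnvelopingAlgebra.lift ℂ
    ((LieAlgebra.ad ℂ (A α)).comp ((toA α).toLieHom.comp (UniversalEnvelopingAlgebra.ι ℂ)))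

theorem ad_E (α : ℂ) (i j : Fin 3) (a : A α) :
    ad α (E i j) a = toA α (E i j) * a - a * toA α (E i j) := by
  rw [ad, E, UniversalEnvelopingAlgebra.lift_ι_apply]
  rfl

/-! ### The algebra `R` -/

/-- The relation defining `R`. -/
def relIdeal (α : ℂ) : Ideal (MvPolynomial (Fin 3) ℂ) :=
  Ideal.span {MvPolynomial.X 0 + MvPolynomial.X 1 + MvPolynomial.X 2 - MvPolynomial.C α}

/-- `R = ℂ[E₁₁, E₂₂, E₃₃] / (E₁₁ + E₂₂ + E₃₃ - α)`. -/
abbrev R (α : ℂ) : Type := MvPolynomial (Fin 3) ℂ ⧸ relIdeal α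

/-- The generator `E_{ii}` of `R`. -/
def h (α : ℂ) (i : Fin 3) : R α := Ideal.Quotient.mk (relIdeal α) (MvPolynomial.X i)

theorem h_sum (α : ℂ) : h α 0 + h α 1 + h α 2 = algebraMap ℂ (R α) α := by
  have : (MvPolynomial.X 0 + MvPolynomial.X 1 + MvPolynomial.X 2 - MvPolynomial.C α :
      MvPolynomial (Fin 3) ℂ) ∈ relIdeal α := Ideal.subset_span rfl
  have h2 := Ideal.Quotient.eq_zero_iff_mem.mpr this
  rw [map_sub, map_add, map_add, sub_eq_zero] at h2
  exact h2

theorem lift_aux {α : ℂ} {B : Type*} [Ring B] [Algebra ℂ B] (F : MvPolynomial (Fin 3) ℂ →ₐ[ℂ] B)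
    (hF : F (MvPolynomial.X 0) + F (MvPolynomial.X 1) + F (MvPolynomial.X 2)
      = algebraMap ℂ B α) :
    ∀ a ∈ relIdeal α, F a = 0 := by
  intro a ha
  obtain ⟨c, rfl⟩ := Ideal.mem_span_singleton'.mp ha
  rw [map_mul, map_sub, map_add, map_add, hF, ← MvPolynomial.algebraMap_eq, AlgHom.commutes,
    sub_self, mul_zero]

/-- The endomorphism of `R` with `E_{ii} ↦ E_{ii} + 1`, `E_{jj} ↦ E_{jj} - 1` (for `i ≠ j`), the
third generator being fixed. -/
def shift (α : ℂ) (i j : Fin 3) : R α →ₐ[ℂ] R α :=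
  Ideal.Quotient.liftₐ (relIdeal α)
    (MvPolynomial.aeval fun m => h α m + (if m = i then 1 else 0) - (if m = j then 1 else 0))
    (lift_aux _ (by
      simp only [MvPolynomial.aeval_X]
      rw [← h_sum]
      fin_cases i <;> fin_cases j <;> simp <;> ring))

/-- The action of the Weyl group (the permutations of the three indices) on `R`:
`w(E_{ii}) = E_{w(i)w(i)}`. -/
def weyl (α : ℂ) (w : Equiv.Perm (Fin 3)) : R α →ₐ[ℂ] R α :=
  Ideal.Quotient.liftₐ (relIdeal α) (MvPolynomial.aeval fun m => h α (w m))
    (lift_aux _ (by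
      simp only [MvPolynomial.aeval_X]
      rw [← h_sum, ← Fin.sum_univ_three (fun i => h α (w i)), ← Fin.sum_univ_three (h α)]
      exact Equiv.sum_comp w (h α)))

theorem E_diag_comm (i j : Fin 3) : E i i * E j j = E j j * E i i := by
  have h1 : ⁅E i i, E j j⁆ = 0 := by
    rw [E, E, ← LieHom.map_lie, single_lie]
    by_cases hij : i = j
    · subst hij; simp
    · simp [hij, Ne.symm hij]
  rwa [LieRing.of_associative_ring_bracket, sub_eq_zero] at h1

/-- The inclusion `ℂ[E₁₁, E₂₂, E₃₃] → U(gl(3))`. -/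
def polyU : MvPolynomial (Fin 3) ℂ →ₐ[ℂ] U :=
  AddMonoidAlgebra.lift ℂ U (Fin 3 →₀ ℕ)
    { toFun := fun m => E 0 0 ^ (m.toAdd 0) * E 1 1 ^ (m.toAdd 1) * E 2 2 ^ (m.toAdd 2)
      map_one' := by simp
      map_mul' := by
        intro m n
        have c01 : Commute (E 0 0) (E 1 1) := E_diag_comm 0 1
        have c02 : Commute (E 0 0) (E 2 2) := E_diag_comm 0 2
        have c12 : Commute (E 1 1) (E 2 2) := E_diag_comm 1 2
        simp only [toAdd_mul, Finsupp.add_apply, pow_add]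
        generalize m.toAdd 0 = a
        generalize m.toAdd 1 = b
        generalize m.toAdd 2 = c
        generalize n.toAdd 0 = a'
        generalize n.toAdd 1 = b'
        generalize n.toAdd 2 = c'
        have e1 : E 1 1 ^ b * E 0 0 ^ a' = E 0 0 ^ a' * E 1 1 ^ b := (c01.pow_pow a' b).symm.eq
        have e2 : E 2 2 ^ c * E 0 0 ^ a' = E 0 0 ^ a' * E 2 2 ^ c := (c02.pow_pow a' c).symm.eq
        have e3 : E 2 2 ^ c * E 1 1 ^ b' = E 1 1 ^ b' * E 2 2 ^ c := (c12.pow_pow b' c).symm.eq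
        calc _ = E 0 0 ^ a * (E 0 0 ^ a' * E 1 1 ^ b) * E 1 1 ^ b' * E 2 2 ^ c * E 2 2 ^ c' := by
              simp only [mul_assoc]
          _ = E 0 0 ^ a * E 1 1 ^ b * E 0 0 ^ a' * (E 1 1 ^ b' * E 2 2 ^ c) * E 2 2 ^ c' := by
              rw [← e1]; simp only [mul_assoc]
          _ = E 0 0 ^ a * E 1 1 ^ b * (E 0 0 ^ a' * E 2 2 ^ c) * E 1 1 ^ b' * E 2 2 ^ c' := by
              rw [← e3]; simp only [mul_assoc]
          _ = _ := by rw [← e2]; simp only [mul_assoc] }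

theorem polyU_X (i : Fin 3) : polyU (MvPolynomial.X i) = E i i := by
  have : polyU (MvPolynomial.X i) = E 0 0 ^ (Finsupp.single i 1 0) * E 1 1 ^ (Finsupp.single i 1 1)
      * E 2 2 ^ (Finsupp.single i 1 2) := by
    unfold polyU MvPolynomial.X
    erw [AddMonoidAlgebra.lift_single]
    simp
  rw [this]
  fin_cases i <;> simp

theorem E_diag_sum (α : ℂ) : toA α (E 0 0) + toA α (E 1 1) + toA α (E 2 2) = algebraMap ℂ _ α := by
  rw [← map_add, ← map_add, ← AlgHom.commutes (toA α), ← sub_eq_zero, ← map_sub, toA_eq_zero,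
    map_sub, map_add, map_add, AlgHom.commutes]
  refine LinearMap.ext fun v => Subtype.ext ?_
  obtain ⟨v, hv⟩ := v
  simp only [LinearMap.sub_apply, LinearMap.add_apply, Submodule.coe_sub, Submodule.coe_add,
    rep_E, Module.algebraMap_end_apply, Submodule.coe_smul, LinearMap.zero_apply,
    Submodule.coe_zero]
  refine Submodule.span_induction (p := fun v _ => (mulX 0 * der 0) v + (mulX 1 * der 1) v
    + (mulX 2 * der 2) v - α • v = 0) ?_ ?_ ?_ ?_ hv
  · rintro _ ⟨k, hk, rfl⟩
    simp only [unit_mono, sub_add_cancel]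
    rw [← add_smul, ← add_smul, ← sub_smul, hk.1, sub_self, zero_smul]
  · simp
  · intro x y _ _ hx hy
    rw [← add_zero (0 : Mono)]
    nth_rewrite 1 [← hx]
    rw [← hy]
    simp only [map_add, smul_add]
    abel
  · intro c x _ hx
    have := congrArg (fun z => c • z) hx
    simp only [smul_add, smul_sub, smul_zero] at this
    simp only [map_smul]
    rw [smul_comm α c]
    exact this

/-- The map `R → A^α` sending `E_{ii}` to the class of the matrix unit `E_{ii}`. -/
def cartan (α : ℂ) : R α →ₐ[ℂ] A α :=
  Ideal.Quotient.liftₐ (relIdeal α) ((toA α).comp polyU)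
    (lift_aux _ (by
      simp only [AlgHom.comp_apply, polyU_X]
      exact E_diag_sum α))

theorem cartan_h (α : ℂ) (i : Fin 3) : cartan α (h α i) = toA α (E i i) := by
  rw [← polyU_X]
  rfl

/-! ### The antiautomorphism `ω` -/

/-- The Chevalley antiinvolution `ω` of `U(gl(3))`, `ω(E_{ij}) = E_{ji}`, as a homomorphism to the
opposite algebra. -/
def omegaU : U →ₐ[ℂ] Uᵐᵒᵖ :=
  UniversalEnvelopingAlgebra.lift ℂ
    { toFun := fun M => MulOpposite.op (UniversalEnvelopingAlgebra.ι ℂ (Matrix.transpose M))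
      map_add' := fun M N => by simp [Matrix.transpose_add]
      map_smul' := fun c M => by simp [Matrix.transpose_smul]
      map_lie' := fun {M N} => by
        have : Matrix.transpose ⁅M, N⁆ = ⁅Matrix.transpose N, Matrix.transpose M⁆ := by
          simp [LieRing.of_associative_ring_bracket, Matrix.transpose_sub, Matrix.transpose_mul]
        change MulOpposite.op (UniversalEnvelopingAlgebra.ι ℂ (Matrix.transpose ⁅M, N⁆)) = _
        rw [this, LieHom.map_lie, LieRing.of_associative_ring_bracket,
          LieRing.of_associative_ring_bracket]
        simp }

theorem omegaU_ι (M : gl3) : omegaU (UniversalEnvelopingAlgebra.ι ℂ M)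
    = MulOpposite.op (UniversalEnvelopingAlgebra.ι ℂ (Matrix.transpose M)) := by
  rw [omegaU, UniversalEnvelopingAlgebra.lift_ι_apply]
  rfl

/-- The squared length of `x^k` for a contravariant form on `S^α(V)`; only used to see that `ω`
preserves `J^α`. -/
def wt (α : ℂ) (k : Fin 3 → ℂ) : ℂ :=
  (Nat.factorial ⌊(k 1).re⌋₊ : ℂ) * (Nat.factorial ⌊(k 2).re⌋₊ : ℂ) /
    ∏ r ∈ Finset.range (⌊(k 1).re⌋₊ + ⌊(k 2).re⌋₊), (α - r)

/-- A contravariant form on `S^α(V)`. -/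
def contra (α : ℂ) : Mono →ₗ[ℂ] Mono →ₗ[ℂ] ℂ := mono.constr ℂ fun k => wt α k • mono.coord k

theorem contra_mono (α : ℂ) (k k' : Fin 3 → ℂ) :
    contra α (mono k) (mono k') = if k = k' then wt α k else 0 := by
  rw [contra, Module.Basis.constr_basis, LinearMap.smul_apply, Module.Basis.coord_apply,
    Module.Basis.repr_self, Finsupp.single_apply]
  by_cases h : k = k'
  · simp [h]
  · simp [h, Ne.symm h]

theorem expo_param {α : ℂ} {k : Fin 3 → ℂ} (hk : k ∈ expo α) :
    ∃ b c : ℕ, k 0 = α - b - c ∧ k 1 = b ∧ k 2 = c ∧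
      (∏ r ∈ Finset.range (b + c), (α - r)) ≠ 0 ∧
      wt α k = (Nat.factorial b : ℂ) * (Nat.factorial c : ℂ) /
        ∏ r ∈ Finset.range (b + c), (α - r) := by
  obtain ⟨h1, ⟨b, hb⟩, ⟨c, hc⟩, h4⟩ := hk
  refine ⟨b, c, by rw [← h1, hb, hc]; ring, hb, hc, ?_, ?_⟩
  · rw [Finset.prod_ne_zero_iff]
    intro r hr h0
    have hα : α = r := sub_eq_zero.mp h0
    obtain ⟨a, ha⟩ := h4 ⟨r, hα⟩
    rw [ha, hb, hc, hα] at h1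
    have : a + b + c = r := by exact_mod_cast h1
    have := Finset.mem_range.mp hr
    omega
  · simp [wt, hb, hc]

theorem wt_adj {α : ℂ} {k k' : Fin 3 → ℂ} (hk : k ∈ expo α) (hk' : k' ∈ expo α) {i j : Fin 3}
    (h : k' = k - Pi.single j 1 + Pi.single i 1) : k j * wt α k' = k' i * wt α k := by
  by_cases hij : i = j
  · subst hij
    rw [sub_add_cancel] at h
    rw [h]
  obtain ⟨b, c, h0, h1, h2, hP, hw⟩ := expo_param hk
  obtain ⟨b', c', h0', h1', h2', hP', hw'⟩ := expo_param hk'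
  have e1 := congrFun h 1
  have e2 := congrFun h 2
  rw [hw, hw']
  fin_cases i <;> fin_cases j <;> simp at hij e1 e2 ⊢ <;>
    simp only [h0, h1, h2, h0', h1', h2'] at e1 e2 ⊢
  · obtain rfl : b = b' + 1 := by exact_mod_cast (sub_eq_iff_eq_add.mp e1.symm)
    obtain rfl : c' = c := by exact_mod_cast e2
    rw [Nat.add_right_comm, Finset.prod_range_succ] at hP ⊢
    obtain ⟨hP1, hP2⟩ := mul_ne_zero_iff.mp hP
    rw [Nat.factorial_succ]
    push_cast at hP2 ⊢
    field_simp
    ring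
  · obtain rfl : c = c' + 1 := by exact_mod_cast (sub_eq_iff_eq_add.mp e2.symm)
    obtain rfl : b' = b := by exact_mod_cast e1
    rw [← Nat.add_assoc, Finset.prod_range_succ] at hP ⊢
    obtain ⟨hP1, hP2⟩ := mul_ne_zero_iff.mp hP
    rw [Nat.factorial_succ]
    push_cast at hP2 ⊢
    field_simp
    ring
  · obtain rfl : b' = b + 1 := by exact_mod_cast e1
    obtain rfl : c' = c := by exact_mod_cast e2
    rw [Nat.add_right_comm, Finset.prod_range_succ] at hP' ⊢
    obtain ⟨hP1, hP2⟩ := mul_ne_zero_iff.mp hP'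
    rw [Nat.factorial_succ]
    push_cast at hP2 ⊢
    field_simp
    ring
  · obtain rfl : b' = b + 1 := by exact_mod_cast e1
    obtain rfl : c = c' + 1 := by exact_mod_cast (sub_eq_iff_eq_add.mp e2.symm)
    rw [Nat.add_right_comm, ← Nat.add_assoc, Nat.factorial_succ, Nat.factorial_succ]
    push_cast
    ring
  · obtain rfl : c' = c + 1 := by exact_mod_cast e2
    obtain rfl : b' = b := by exact_mod_cast e1
    rw [← Nat.add_assoc, Finset.prod_range_succ] at hP' ⊢
    obtain ⟨hP1, hP2⟩ := mul_ne_zero_iff.mp hP'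
    rw [Nat.factorial_succ]
    push_cast at hP2 ⊢
    field_simp
    ring
  · obtain rfl : c' = c + 1 := by exact_mod_cast e2
    obtain rfl : b = b' + 1 := by exact_mod_cast (sub_eq_iff_eq_add.mp e1.symm)
    rw [Nat.add_right_comm, ← Nat.add_assoc, Nat.factorial_succ, Nat.factorial_succ]
    push_cast
    ring

theorem contra_mono_adj (α : ℂ) (i j : Fin 3) {k k' : Fin 3 → ℂ} (hk : k ∈ expo α)
    (hk' : k' ∈ expo α) : contra α ((mulX i * der j) (mono k)) (mono k')
      = contra α (mono k) ((mulX j * der i) (mono k')) := by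
  rw [unit_mono, unit_mono, map_smul, map_smul, LinearMap.smul_apply, contra_mono, contra_mono]
  by_cases h : k - Pi.single j 1 + Pi.single i 1 = k'
  · have h2 : k = k' - Pi.single i 1 + Pi.single j 1 := by rw [← h]; abel
    rw [if_pos h, if_pos h2, smul_eq_mul, smul_eq_mul, h, wt_adj hk hk' h.symm]
  · have h2 : ¬ k = k' - Pi.single i 1 + Pi.single j 1 := by
      intro h3; apply h; rw [h3]; abel
    rw [if_neg h, if_neg h2, smul_zero, smul_zero]

theorem contra_E (α : ℂ) (i j : Fin 3) (v w : S α) :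
    contra α ((mulX i * der j) v) w = contra α v ((mulX j * der i) w) := by
  obtain ⟨v, hv⟩ := v
  obtain ⟨w, hw⟩ := w
  refine Submodule.span_induction (p := fun v _ => contra α ((mulX i * der j) v) w
    = contra α v ((mulX j * der i) w)) ?_ ?_ ?_ ?_ hv
  · rintro _ ⟨k, hk, rfl⟩
    refine Submodule.span_induction (p := fun w _ => contra α ((mulX i * der j) (mono k)) w
      = contra α (mono k) ((mulX j * der i) w)) ?_ ?_ ?_ ?_ hw
    · rintro _ ⟨k', hk', rfl⟩
      exact contra_mono_adj α i j hk hk'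
    · simp
    · intro x y _ _ hx hy
      simp only [map_add, hx, hy]
    · intro c x _ hx
      simp only [map_smul, hx]
  · simp
  · intro x y _ _ hx hy
    simp only [map_add, LinearMap.add_apply, hx, hy]
  · intro c x _ hx
    simp only [map_smul, LinearMap.smul_apply, hx]

theorem contra_ι (α : ℂ) (M : gl3) (v w : S α) :
    contra α (actLin M v) w = contra α v (actLin (Matrix.transpose M) w) := by
  simp only [actLin_apply, LinearMap.sum_apply, LinearMap.smul_apply, map_sum, map_smul,
    contra_E, Matrix.transpose_apply]
  rw [Finset.sum_comm]

/-- The elements of `U(gl(3))` whose adjoint for the contravariant form is given by `ω`. -/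
def adjointable (α : ℂ) : Subalgebra ℂ U where
  carrier := {u | ∀ v w : S α, contra α (rep α u v : Mono) w
    = contra α v (rep α (omegaU u).unop w : Mono)}
  mul_mem' := by
    intro a b ha hb v w
    rw [map_mul, map_mul, Module.End.mul_apply, ha, hb, MulOpposite.unop_mul, map_mul,
      Module.End.mul_apply]
  add_mem' := by
    intro a b ha hb v w
    simp only [map_add, LinearMap.add_apply, Submodule.coe_add, MulOpposite.unop_add, ha v w,
      hb v w]
  algebraMap_mem' := by
    intro c v w
    rw [AlgHom.commutes, AlgHom.commutes, MulOpposite.algebraMap_apply, MulOpposite.unop_op,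
      AlgHom.commutes]
    simp [Module.algebraMap_end_apply]

theorem adjointable_eq_top (α : ℂ) (u : U) : u ∈ adjointable α := by
  have hι : ∀ M : gl3, UniversalEnvelopingAlgebra.ι ℂ M ∈ adjointable α := by
    intro M v w
    rw [omegaU_ι, rep_ι, MulOpposite.unop_op, rep_ι, contra_ι]
  let g : gl3 →ₗ⁅ℂ⁆ adjointable α :=
    { toFun := fun M => ⟨UniversalEnvelopingAlgebra.ι ℂ M, hι M⟩
      map_add' := fun M N => Subtype.ext (map_add _ M N)
      map_smul' := fun c M => Subtype.ext (map_smul _ c M)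
      map_lie' := fun {M N} => Subtype.ext (LieHom.map_lie _ M N) }
  have h : (adjointable α).val.comp (UniversalEnvelopingAlgebra.lift ℂ g) = AlgHom.id ℂ U := by
    apply UniversalEnvelopingAlgebra.hom_ext
    ext M
    change ((UniversalEnvelopingAlgebra.lift ℂ g (UniversalEnvelopingAlgebra.ι ℂ M) :
      adjointable α) : U) = UniversalEnvelopingAlgebra.ι ℂ M
    rw [UniversalEnvelopingAlgebra.lift_ι_apply]
    rfl
  have h2 := AlgHom.congr_fun h u
  change ((UniversalEnvelopingAlgebra.lift ℂ g u : adjointable α) : U) = u at h2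
  rw [← h2]
  exact Subtype.property _

theorem contra_nondeg {α : ℂ} {y : Mono} (hy : y ∈ S α)
    (h : ∀ v ∈ S α, contra α v y = 0) : y = 0 := by
  refine (Module.Basis.forall_coord_eq_zero_iff mono).mp fun k => ?_
  by_cases hk : k ∈ expo α
  · have h1 := h _ (Submodule.subset_span ⟨k, hk, rfl⟩)
    rw [contra, Module.Basis.constr_basis, LinearMap.smul_apply, smul_eq_mul] at h1
    refine (mul_eq_zero.mp h1).resolve_left ?_
    obtain ⟨b, c, -, -, -, hP, hw⟩ := expo_param hk
    rw [hw]
    exact div_ne_zero (mul_ne_zero (Nat.cast_ne_zero.mpr (Nat.factorial_ne_zero b))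
      (Nat.cast_ne_zero.mpr (Nat.factorial_ne_zero c))) hP
  · rw [S, Module.Basis.mem_span_image] at hy
    rw [Module.Basis.coord_apply]
    by_contra h0
    exact hk (hy (Finsupp.mem_support_iff.mpr h0))

theorem omega_ker (α : ℂ) (u : U) (hu : rep α u = 0) : rep α (omegaU u).unop = 0 := by
  refine LinearMap.ext fun w => Subtype.ext ?_
  set y : S α := rep α (omegaU u).unop w with hy
  have h1 : ∀ v : S α, contra α v y = 0 := by
    intro v
    rw [hy, ← adjointable_eq_top α u v w, hu]
    simp
  exact contra_nondeg y.2 fun v hv => h1 ⟨v, hv⟩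

/-- The antiinvolution of `A^α` induced by `ω`. -/
def omegaOp (α : ℂ) : A α →ₐ[ℂ] (A α)ᵐᵒᵖ :=
  Ideal.Quotient.liftₐ (J α) ((AlgHom.op (toA α)).comp omegaU) (by
    intro u hu
    have := omega_ker α u (RingHom.mem_ker.mp hu)
    rw [AlgHom.comp_apply, AlgHom.op_apply_apply, toA_eq_zero.mpr this, MulOpposite.op_zero])

/-- The antiinvolution `ω` of `A^α`. -/
def omega (α : ℂ) (a : A α) : A α := (omegaOp α a).unop

theorem omega_E (α : ℂ) (i j : Fin 3) : omega α (toA α (E i j)) = toA α (E j i) := by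
  have : omega α (toA α (E i j)) = toA α (omegaU (E i j)).unop := rfl
  rw [this, E, omegaU_ι, MulOpposite.unop_op, Matrix.transpose_single, ← E]

/-! ### The trace functional and the form on `A^α` -/

/-- The value at `(α, 0, 0)` of the Harish-Chandra projection of `u`: the coefficient of the highest
weight vector `x₁^α` in `u · x₁^α`. -/
def hcValue (α : ℂ) (u : U) : ℂ := mono.coord ![α, 0, 0] (actU u (mono ![α, 0, 0]))

/-- `L` is the invariant functional `u ↦ φ(u^♯)(α, 0, 0)` on `A^α`: it vanishes on commutators and
on the centre `Z` of `U(gl(3))` it is the Harish-Chandra homomorphism `φ` evaluated at `(α, 0, 0)`.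
Here `u ↦ u^♯` is the projection of `U = Z ⊕ [U, U]` onto `Z`. -/
def IsTraceFunctional (α : ℂ) (L : A α →ₗ[ℂ] ℂ) : Prop :=
  (∀ a b : A α, L (a * b) = L (b * a)) ∧
    ∀ z ∈ Subalgebra.center ℂ U, L (toA α z) = hcValue α z

/-- The functional `u ↦ φ(u^♯)(α, 0, 0)` on `A^α` (there is exactly one functional as in
`IsTraceFunctional`). -/
def traceFunctional (α : ℂ) : A α →ₗ[ℂ] ℂ := Classical.epsilon (IsTraceFunctional α)

/-- The form `⟨a, b⟩_α = φ((a ω(b))^♯)(α, 0, 0)` on `A^α`. -/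
def form (α : ℂ) (a b : A α) : ℂ := traceFunctional α (a * omega α b)

/-! ### Weights -/

/-- The root lattice `Q`, a weight `ν = ∑ ν_i ε_i` being given by its coordinates `ν_i = ν(E_{ii})`. -/
def Q : Set (Fin 3 → ℤ) := {ν | ν 0 + ν 1 + ν 2 = 0}

/-- The weight `ε_i`. -/
def eps (i : Fin 3) : Fin 3 → ℤ := Pi.single i 1

/-- The weight space `(A^α)_ν`. -/
def weightSpace (α : ℂ) (ν : Fin 3 → ℤ) : Set (A α) :=
  {a | ∀ i, toA α (E i i) * a - a * toA α (E i i) = (ν i : ℂ) • a}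

/-- The set `Q⁺` of those `ν ∈ Q` for which `(A^α)_ν` contains a nonzero `gl(2)`-highest vector. -/
def Qplus (α : ℂ) : Set (Fin 3 → ℤ) :=
  {ν | ν ∈ Q ∧ ∃ a ∈ weightSpace α ν, a ≠ 0 ∧ toA α (E 0 1) * a - a * toA α (E 0 1) = 0}

/-- The exponent of `E_{ij}` in `u_ν`. -/
def uExp (ν : Fin 3 → ℤ) (i j : Fin 3) : ℕ := min (ν i).toNat (-ν j).toNat

/-- The product of root vectors representing `u_ν`. For `ν ∈ Q` at most two factors differ from `1`,
and they commute. -/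
def uU (ν : Fin 3 → ℤ) : U :=
  E 0 1 ^ uExp ν 0 1 * E 0 2 ^ uExp ν 0 2 * E 1 0 ^ uExp ν 1 0 *
    E 1 2 ^ uExp ν 1 2 * E 2 0 ^ uExp ν 2 0 * E 2 1 ^ uExp ν 2 1

/-- The element `u_ν` of `A^α`. -/
def u (α : ℂ) (ν : Fin 3 → ℤ) : A α := toA α (uU ν)

/-- The operator `x_i^n` if `n ≥ 0` and `(∂/∂x_i)^{-n}` if `n ≤ 0`. -/
def rOp (i : Fin 3) (n : ℤ) : Module.End ℂ Mono :=
  if 0 ≤ n then mulX i ^ n.toNat else der i ^ (-n).toNat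

theorem comm_mulX_der {i j : Fin 3} (h : i ≠ j) (m n : ℕ) :
    der j ^ m * mulX i ^ n = mulX i ^ n * der j ^ m := by
  have : Commute (der j) (mulX i) := by
    have := der_mulX i j
    rwa [if_neg (Ne.symm h), add_zero] at this
  exact (this.pow_pow m n).eq

theorem comm_der (i j : Fin 3) (m n : ℕ) : der i ^ m * der j ^ n = der j ^ n * der i ^ m :=
  (Commute.pow_pow (show Commute (der i) (der j) from der_comm i j) m n).eq

theorem comm_mulX (i j : Fin 3) (m n : ℕ) : mulX i ^ m * mulX j ^ n = mulX j ^ n * mulX i ^ m :=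
  (Commute.pow_pow (show Commute (mulX i) (mulX j) from mulX_comm i j) m n).eq

theorem actU_E_pow {i j : Fin 3} (h : i ≠ j) (n : ℕ) :
    actU (E i j ^ n) = mulX i ^ n * der j ^ n := by
  have : Commute (mulX i) (der j) := by
    have := der_mulX i j
    rw [if_neg (Ne.symm h), add_zero] at this
    exact this.symm
  rw [map_pow, actU_E, this.mul_pow]

/-- On monomials `u_ν` acts as `r₁^{ν₁} r₂^{ν₂} r₃^{ν₃}`. -/
theorem actU_uU {ν : Fin 3 → ℤ} (hν : ν ∈ Q) :
    actU (uU ν) = rOp 0 (ν 0) * rOp 1 (ν 1) * rOp 2 (ν 2) := by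
  have hs : ν 0 + ν 1 + ν 2 = 0 := hν
  unfold uU
  simp only [map_mul]
  rw [actU_E_pow (by decide), actU_E_pow (by decide), actU_E_pow (by decide),
    actU_E_pow (by decide), actU_E_pow (by decide), actU_E_pow (by decide)]
  unfold rOp uExp
  generalize ν 0 = a at *
  generalize ν 1 = b at *
  generalize ν 2 = c at *
  have key : ∀ m n p q r t m' n' p' q' r' t' : ℕ, m = m' → n = n' → p = p' → q = q' → r = r' →
      t = t' → mulX 0 ^ m * der 1 ^ m * (mulX 0 ^ n * der 2 ^ n) * (mulX 1 ^ p * der 0 ^ p) *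
        (mulX 1 ^ q * der 2 ^ q) * (mulX 2 ^ r * der 0 ^ r) * (mulX 2 ^ t * der 1 ^ t) =
      mulX 0 ^ m' * der 1 ^ m' * (mulX 0 ^ n' * der 2 ^ n') * (mulX 1 ^ p' * der 0 ^ p') *
        (mulX 1 ^ q' * der 2 ^ q') * (mulX 2 ^ r' * der 0 ^ r') *
        (mulX 2 ^ t' * der 1 ^ t') := by
    rintro m n p q r t _ _ _ _ _ _ rfl rfl rfl rfl rfl rfl
    rfl
  by_cases ha : 0 ≤ a <;> by_cases hb : 0 ≤ b <;> by_cases hc : 0 ≤ c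
  · obtain ⟨rfl, rfl, rfl⟩ : a = 0 ∧ b = 0 ∧ c = 0 := by omega
    simp
  · rw [key _ _ _ _ _ _ 0 a.toNat 0 b.toNat 0 0 (by omega) (by omega) (by omega) (by omega)
      (by omega) (by omega), if_pos ha, if_pos hb, if_neg hc,
      show (-c).toNat = a.toNat + b.toNat by omega, pow_add]
    simp only [pow_zero, one_mul, mul_one]
    rw [mul_assoc, ← mul_assoc (der 2 ^ _), comm_mulX_der (by decide)]
    simp only [mul_assoc]
  · rw [key _ _ _ _ _ _ a.toNat 0 0 0 0 c.toNat (by omega) (by omega) (by omega) (by omega)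
      (by omega) (by omega), if_pos ha, if_neg hb, if_pos hc,
      show (-b).toNat = a.toNat + c.toNat by omega, pow_add]
    simp only [pow_zero, mul_one]
    simp only [mul_assoc]
    rw [comm_mulX_der (by decide) c.toNat c.toNat]
  · rw [key _ _ _ _ _ _ (-b).toNat (-c).toNat 0 0 0 0 (by omega) (by omega) (by omega) (by omega)
      (by omega) (by omega), if_pos ha, if_neg hb, if_neg hc,
      show a.toNat = (-b).toNat + (-c).toNat by omega, pow_add]
    simp only [pow_zero, mul_one]
    rw [mul_assoc, ← mul_assoc (der 1 ^ _), comm_mulX_der (by decide)]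
    simp only [mul_assoc]
  · rw [key _ _ _ _ _ _ 0 0 b.toNat 0 c.toNat 0 (by omega) (by omega) (by omega) (by omega)
      (by omega) (by omega), if_neg ha, if_pos hb, if_pos hc,
      show (-a).toNat = b.toNat + c.toNat by omega, pow_add]
    simp only [pow_zero, one_mul, mul_one]
    rw [← comm_mulX_der (by decide) b.toNat b.toNat, ← comm_mulX_der (by decide) c.toNat c.toNat]
    rw [mul_assoc, ← mul_assoc (mulX 1 ^ _), ← comm_mulX_der (by decide) c.toNat b.toNat]
    simp only [mul_assoc]
  · rw [key _ _ _ _ _ _ 0 0 (-a).toNat (-c).toNat 0 0 (by omega) (by omega) (by omega) (by omega)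
      (by omega) (by omega), if_neg ha, if_pos hb, if_neg hc,
      show b.toNat = (-a).toNat + (-c).toNat by omega, pow_add]
    simp only [pow_zero, one_mul, mul_one]
    rw [← comm_mulX_der (by decide) (-a).toNat (-a).toNat]
    simp only [mul_assoc]
  · rw [key _ _ _ _ _ _ 0 0 0 0 (-a).toNat (-b).toNat (by omega) (by omega) (by omega) (by omega)
      (by omega) (by omega), if_neg ha, if_neg hb, if_pos hc,
      show c.toNat = (-a).toNat + (-b).toNat by omega, pow_add]
    simp only [pow_zero, one_mul]
    rw [← comm_mulX_der (by decide) (-a).toNat (-a).toNat, mul_assoc,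
      ← mul_assoc (mulX 2 ^ (-a).toNat), ← pow_add, ← comm_mulX_der (by decide) (-b).toNat _,
      pow_add]
    simp only [mul_assoc]
  · omega

/-! ### The polynomials `f_{l,k}^ν` -/

/-- `z₂₁ = E₂₁`. -/
def z21 : U := E 1 0

/-- `z₃₁ = (E₁₁ - E₂₂ + 2) E₃₁ + E₂₁ E₃₂`. -/
def z31 : U := (E 0 0 - E 1 1 + 2) * E 2 0 + E 1 0 * E 2 1

/-- `z₂₃ = (E₁₁ - E₂₂ + 2) E₂₃ - E₂₁ E₁₃`. -/
def z23 : U := (E 0 0 - E 1 1 + 2) * E 1 2 - E 1 0 * E 0 2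

/-- `(ad z₂₁)^l (ad z₃₁)^k u_{ν + k(ε₁ - ε₃) + l(ε₁ - ε₂)}`. -/
def vec31 (α : ℂ) (ν : Fin 3 → ℤ) (l k : ℕ) : A α :=
  (ad α z21 ^ l) ((ad α z31 ^ k)
    (u α (ν + (k : ℤ) • (eps 0 - eps 2) + (l : ℤ) • (eps 0 - eps 1))))

/-- `(ad z₂₁)^l (ad z₂₃)^k u_{ν + k(ε₃ - ε₂) + l(ε₁ - ε₂)}`. -/
def vec23 (α : ℂ) (ν : Fin 3 → ℤ) (l k : ℕ) : A α :=
  (ad α z21 ^ l) ((ad α z23 ^ k)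
    (u α (ν + (k : ℤ) • (eps 2 - eps 1) + (l : ℤ) • (eps 0 - eps 1))))

/-- The form `⟨f, g⟩_ν = ⟨f u_ν, g u_ν⟩_α` on `R`. -/
def formR (α : ℂ) (ν : Fin 3 → ℤ) (f g : R α) : ℂ :=
  form α (cartan α f * u α ν) (cartan α g * u α ν)

/-- The family `f` is a basis of the vector space `R`, and its members are pairwise orthogonal for
`⟨·, ·⟩_ν`. -/
def IsOrthogonalBasis (α : ℂ) (ν : Fin 3 → ℤ) {ι : Type} (f : ι → R α) : Prop :=
  LinearIndependent ℂ f ∧ Submodule.span ℂ (Set.range f) = ⊤ ∧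
    ∀ i j, i ≠ j → formR α ν (f i) (f j) = 0

/-! ### The difference equations

`R` is the polynomial algebra in `H₁ = E₁₁ - E₂₂` and `H₂ = E₃₃`, and `shift` acts on polynomials
`f(H₁, H₂)` by translation of the arguments:
`shift 0 1` is `f(H₁ + 2, H₂)`, `shift 1 0` is `f(H₁ - 2, H₂)`,
`shift 2 0` is `f(H₁ - 1, H₂ + 1)`, `shift 0 2` is `f(H₁ + 1, H₂ - 1)`,
`shift 2 1` is `f(H₁ + 1, H₂ + 1)`, `shift 1 2` is `f(H₁ - 1, H₂ - 1)`. -/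

/-- `H₁ = E₁₁ - E₂₂`. -/
def H₁ (α : ℂ) : R α := h α 0 - h α 1

/-- `H₂ = E₃₃`. -/
def H₂ (α : ℂ) : R α := h α 2

/-- The constant `c` in `R`. -/
def cst (α : ℂ) (c : ℂ) : R α := algebraMap ℂ (R α) c

/-- The first difference equation, with `a = ν(E₁₁)`, `b = ν(E₂₂)`. -/
def DiffEq₁ (α : ℂ) (ν : Fin 3 → ℤ) (l : ℕ) (f : R α) : Prop :=
  let a : ℂ := ν 0
  let b : ℂ := ν 1
  (shift α 0 1 f - f) *
      (cst α (1 / 4) * (H₁ α - H₂ α + cst α (α + 2)) * (H₁ α + H₂ α - cst α α)) -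
    (f - shift α 1 0 f) *
      (cst α (1 / 4) * (H₁ α - H₂ α + cst α (α - 2 * a)) *
        (H₁ α + H₂ α - cst α (α + 2 - 2 * b))) =
  cst α (l ^ 2 + l * (a - b + 1)) * f

/-- The second difference equation, with `a = ν(E₁₁)`, `b = ν(E₂₂)`, `c = ν(E₃₃)`. -/
def DiffEq₂ (α : ℂ) (ν : Fin 3 → ℤ) (l k : ℕ) (f : R α) : Prop :=
  let a : ℂ := ν 0
  let b : ℂ := ν 1
  let c : ℂ := ν 2
  (cst α (α - c * (α + 2 + c)) + cst α (2 * α + 1 + 2 * c) * H₂ α - 2 * H₂ α ^ 2) * f -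
    cst α (1 / 2) * (H₂ α + cst α (1 - c)) * (H₁ α - H₂ α + cst α (α - 2 * a)) * shift α 2 0 f -
    cst α (1 / 2) * H₂ α * (H₁ α - H₂ α + cst α (α + 2)) * shift α 0 2 f -
    cst α (1 / 2) * (H₂ α + cst α (1 - c)) * (cst α α - H₁ α - H₂ α) * shift α 2 1 f -
    cst α (1 / 2) * H₂ α * (cst α (α + 2 - 2 * b) - H₁ α - H₂ α) * shift α 1 2 f =
  cst α (k ^ 2 + 2 * k * l + 2 * k * (1 + a) + l * (1 + a + b) + 3 * a + 2 * b - b * (a + b)) * f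

end GL3

end

noncomputable section

namespace GL3

attribute [local instance 100] LieRing.ofAssociativeRing

set_option linter.unusedSimpArgs false

/-! An element of weight `ν` in `A α` takes `x^k` to a multiple of `x^(k+ν)`; the multiple is a
polynomial in the exponents times the fixed factor of `u α ν` (`weightSpace_eq`). So the algebra is
described by `R`, by its translations along the roots, and by the products `u_ν u_{-ν}`, which lie
in `R` and are products of falling and rising factorials (`u_mul_u_neg`).

A trace on `A α` vanishes on nonzero weights, and on `R` the trace property becomes invariance under
translations (`IsShiftInvariant`). On products of falling factorials this is a recursion with
exactly one normalised solution `Λ` (`shiftInvariant_unique`, `exists_shiftInvariant`). Since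
central elements become scalars in `A α` (`toA_center`), the normalisation is `L 1 = 1`. The trace
functional exists because for natural `α` the module is finite-dimensional and has a normalised
trace, and for other `α` the functional `Λ` extends by zero to the nonzero weights. Uniqueness also
makes `Λ` invariant under permutations, which gives the statement on the Weyl group. The form is
`⟨f, g⟩_ν = Λ (f g u_ν u_{-ν})`.

A weight `ν = a ε₁ + b ε₂ + c ε₃` in `Q⁺` has `a ≥ 0 ≥ b` (`Qplus_nonneg_nonpos`). If also `c ≤ 0`,
root vectors act on the coefficients `f` of `f u_ν` by explicit difference operators, and `f_{l,k}`
arises from `1` by those of `z₃₁` and `z₂₁` (`hahn`). The quadratic Casimir element commutes with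
these operators, and `E₂₁E₁₂` acts as `sl(2)` theory prescribes; so `f_{l,k}` is a joint eigenvector
(`casimir_hahn`, `casimir₁_hahn`), and the two difference equations are eigenvalue equations. Both
operators are symmetric for the form by summation by parts, and their eigenvalues separate the pairs
`(l, k)`: this gives orthogonality. The `f_{l,k}` do not vanish, because `f_{0,k}` is a polynomial
in `E₃₃` of exact degree `k` and `E₁₂` leads from `f_{l+1,k}` back to a nonzero multiple of an
`f_{l,k}`. Hence they are independent, and as their degree is at most `l + k` they span `R`. The
form may be degenerate; this argument does not need the contrary.

For `c ≥ 0`, the Fourier transform `x_i ↦ ∂_i`, `∂_i ↦ -x_i` followed by the exchange of the indices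
1 and 2 turns `z₃₁` into `-z₂₃` and `α` into `-3 - α`. Its effect on `R` is `dual`, which carries
the first family to the second. -/

/-! ### Generalities on `R` -/

/-- The algebra homomorphism out of `R` with prescribed values on the generators. -/
def liftR {α : ℂ} {B : Type*} [CommRing B] [Algebra ℂ B] (g : Fin 3 → B)
    (hg : g 0 + g 1 + g 2 = algebraMap ℂ B α) : R α →ₐ[ℂ] B :=
  Ideal.Quotient.liftₐ (relIdeal α) (MvPolynomial.aeval g)
    (lift_aux _ (by simpa only [MvPolynomial.aeval_X] using hg))

theorem liftR_h {α : ℂ} {B : Type*} [CommRing B] [Algebra ℂ B] (g : Fin 3 → B)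
    (hg : g 0 + g 1 + g 2 = algebraMap ℂ B α) (i : Fin 3) : liftR g hg (h α i) = g i :=
  MvPolynomial.aeval_X g i

theorem R_induction {α : ℂ} {p : R α → Prop} (hC : ∀ c, p (algebraMap ℂ (R α) c))
    (hadd : ∀ f g, p f → p g → p (f + g)) (hmul : ∀ f i, p f → p (f * h α i)) (f : R α) : p f := by
  obtain ⟨q, rfl⟩ := Ideal.Quotient.mk_surjective f
  induction q using MvPolynomial.induction_on with
  | C c => exact hC c
  | add a b ha hb => rw [map_add]; exact hadd _ _ ha hb
  | mul_X a i ha => rw [map_mul]; exact hmul _ i ha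

theorem R_smul {α : ℂ} (c : ℂ) (f : R α) : c • f = algebraMap ℂ (R α) c * f := Algebra.smul_def c f

theorem h_zero (α : ℂ) : h α 0 = algebraMap ℂ (R α) α - h α 1 - h α 2 := by
  rw [← h_sum]; ring

theorem R_algHom_ext {α : ℂ} {B : Type*} [Ring B] [Algebra ℂ B] {φ ψ : R α →ₐ[ℂ] B}
    (h1 : φ (h α 1) = ψ (h α 1)) (h2 : φ (h α 2) = ψ (h α 2)) : φ = ψ := by
  refine AlgHom.ext fun f => ?_
  have h0 : φ (h α 0) = ψ (h α 0) := by
    rw [h_zero]; simp only [map_sub, AlgHom.commutes, h1, h2]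
  induction f using R_induction with
  | hC c => simp only [AlgHom.commutes]
  | hadd f g hf hg => rw [map_add, map_add, hf, hg]
  | hmul f i hf =>
    rw [map_mul, map_mul, hf]
    fin_cases i
    · exact congrArg _ h0
    · exact congrArg _ h1
    · exact congrArg _ h2

/-- The value of an element of `R` at the point `(α - x - y, x, y)`. -/
def ev (α x y : ℂ) : R α →ₐ[ℂ] ℂ := liftR ![α - x - y, x, y] (by simp; ring)

@[simp] theorem ev_h0 (α x y : ℂ) : ev α x y (h α 0) = α - x - y := liftR_h _ _ 0
@[simp] theorem ev_h1 (α x y : ℂ) : ev α x y (h α 1) = x := liftR_h _ _ 1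
@[simp] theorem ev_h2 (α x y : ℂ) : ev α x y (h α 2) = y := liftR_h _ _ 2

/-- The identification of `R` with a polynomial ring in `E₂₂` and `E₃₃`. -/
def toPoly (α : ℂ) : R α →ₐ[ℂ] MvPolynomial (Fin 2) ℂ :=
  liftR ![MvPolynomial.C α - MvPolynomial.X 0 - MvPolynomial.X 1, MvPolynomial.X 0,
    MvPolynomial.X 1] (by simp [MvPolynomial.algebraMap_eq]; ring)

/-- The inverse of `toPoly`. -/
def ofPoly (α : ℂ) : MvPolynomial (Fin 2) ℂ →ₐ[ℂ] R α := MvPolynomial.aeval ![h α 1, h α 2]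

theorem ofPoly_toPoly (α : ℂ) (f : R α) : ofPoly α (toPoly α f) = f := by
  have : (ofPoly α).comp (toPoly α) = AlgHom.id ℂ _ := by
    apply R_algHom_ext <;> simp [toPoly, liftR_h, ofPoly]
  exact AlgHom.congr_fun this f

theorem toPoly_injective (α : ℂ) : Function.Injective (toPoly α) :=
  Function.LeftInverse.injective (ofPoly_toPoly α)

theorem eval_toPoly (α x y : ℂ) (f : R α) :
    MvPolynomial.eval ![x, y] (toPoly α f) = ev α x y f := by
  have : (MvPolynomial.aeval (R := ℂ) ![x, y]).comp (toPoly α) = ev α x y := by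
    apply R_algHom_ext <;> simp [toPoly, liftR_h]
  rw [← this]
  simp [MvPolynomial.aeval_eq_eval]

/-- The set `ℕ × ℕ` is Zariski dense in the plane. Its points are the exponents `(k₂, k₃)` of the
monomials in `S^α(V)` when `α` is not a natural number. -/
theorem R_ext {α : ℂ} {f g : R α} (hfg : ∀ b c : ℕ, ev α b c f = ev α b c g) : f = g := by
  apply toPoly_injective α
  refine MvPolynomial.funext_set (fun _ => Set.range (Nat.cast : ℕ → ℂ))
    (fun _ => Set.infinite_range_of_injective Nat.cast_injective) fun p hp => ?_
  obtain ⟨b, hb⟩ := hp 0 trivial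
  obtain ⟨c, hc⟩ := hp 1 trivial
  have : p = ![(b : ℂ), (c : ℂ)] := by
    funext i; fin_cases i
    · exact hb.symm
    · exact hc.symm
  rw [this, eval_toPoly, eval_toPoly, hfg]

theorem R_isUnit {α : ℂ} {f : R α} (hf : IsUnit f) : ∃ c : ℂ, c ≠ 0 ∧ f = algebraMap ℂ _ c := by
  have h1 := hf.map (toPoly α)
  rw [MvPolynomial.isUnit_iff_eq_C_of_isReduced] at h1
  obtain ⟨c, hc, h2⟩ := h1
  refine ⟨c, hc.ne_zero, toPoly_injective α ?_⟩
  rw [h2, AlgHom.commutes]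
  rfl

instance (α : ℂ) : Nontrivial (R α) := (ev α 0 0).toRingHom.domain_nontrivial

instance (α : ℂ) : NoZeroDivisors (R α) :=
  (toPoly_injective α).noZeroDivisors _ (map_zero _) (map_mul _)

/-- The translation `f(E₂₂, E₃₃) ↦ f(E₂₂ + s, E₃₃ + t)`. -/
def sh (α : ℂ) (s t : ℤ) : R α →ₐ[ℂ] R α :=
  liftR ![h α 0 - s - t, h α 1 + s, h α 2 + t] (by
    rw [← h_sum]; simp; ring)

@[simp] theorem sh_h0 (α : ℂ) (s t : ℤ) : sh α s t (h α 0) = h α 0 - s - t := liftR_h _ _ 0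
@[simp] theorem sh_h1 (α : ℂ) (s t : ℤ) : sh α s t (h α 1) = h α 1 + s := liftR_h _ _ 1
@[simp] theorem sh_h2 (α : ℂ) (s t : ℤ) : sh α s t (h α 2) = h α 2 + t := liftR_h _ _ 2

@[simp] theorem sh_sh (α : ℂ) (s t s' t' : ℤ) (f : R α) :
    sh α s t (sh α s' t' f) = sh α (s + s') (t + t') f := by
  have : (sh α s t).comp (sh α s' t') = sh α (s + s') (t + t') := by
    apply R_algHom_ext <;> simp <;> ring
  exact AlgHom.congr_fun this f

@[simp] theorem sh_zero (α : ℂ) (f : R α) : sh α 0 0 f = f := by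
  have : sh α 0 0 = AlgHom.id ℂ _ := by
    apply R_algHom_ext <;> simp
  exact AlgHom.congr_fun this f

theorem ev_sh (α x y : ℂ) (s t : ℤ) (f : R α) : ev α x y (sh α s t f) = ev α (x + s) (y + t) f := by
  have : (ev α x y).comp (sh α s t) = ev α (x + s) (y + t) := by
    apply R_algHom_ext <;> simp
  exact AlgHom.congr_fun this f

theorem shift_h (α : ℂ) (i j m : Fin 3) :
    shift α i j (h α m) = h α m + (if m = i then 1 else 0) - (if m = j then 1 else 0) :=
  MvPolynomial.aeval_X _ m

theorem weyl_h (α : ℂ) (w : Equiv.Perm (Fin 3)) (m : Fin 3) :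
    weyl α w (h α m) = h α (w m) :=
  MvPolynomial.aeval_X _ m

/-- Written through `sh`, composites of root translations have the normal form given by `sh_sh`, so
that identities between difference operators can be left to `ring`. -/
theorem shift_01 (α : ℂ) : shift α 0 1 = sh α (-1) 0 := by
  apply R_algHom_ext <;> simp [shift_h, sub_eq_add_neg]

theorem shift_10 (α : ℂ) : shift α 1 0 = sh α 1 0 := by
  apply R_algHom_ext <;> simp [shift_h]

theorem shift_02 (α : ℂ) : shift α 0 2 = sh α 0 (-1) := by
  apply R_algHom_ext <;> simp [shift_h, sub_eq_add_neg]

theorem shift_20 (α : ℂ) : shift α 2 0 = sh α 0 1 := by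
  apply R_algHom_ext <;> simp [shift_h]

theorem shift_12 (α : ℂ) : shift α 1 2 = sh α 1 (-1) := by
  apply R_algHom_ext <;> simp [shift_h, sub_eq_add_neg]

theorem shift_21 (α : ℂ) : shift α 2 1 = sh α (-1) 1 := by
  apply R_algHom_ext <;> simp [shift_h, sub_eq_add_neg]

theorem shift_shift (α : ℂ) {i j : Fin 3} (f : R α) :
    shift α i j (shift α j i f) = f := by
  have : (shift α i j).comp (shift α j i) = AlgHom.id ℂ _ := by
    apply R_algHom_ext <;> simp [shift_h, apply_ite (shift α i j)]
  exact AlgHom.congr_fun this f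

theorem weyl_shift (α : ℂ) (w : Equiv.Perm (Fin 3)) (i j : Fin 3) (f : R α) :
    weyl α w (shift α i j f) = shift α (w i) (w j) (weyl α w f) := by
  have : (weyl α w).comp (shift α i j) = (shift α (w i) (w j)).comp (weyl α w) := by
    apply R_algHom_ext <;> simp [shift_h, weyl_h, apply_ite (weyl α w)]
  exact AlgHom.congr_fun this f

theorem weyl_weyl (α : ℂ) (w v : Equiv.Perm (Fin 3)) (f : R α) :
    weyl α w (weyl α v f) = weyl α (w * v) f := by
  have : (weyl α w).comp (weyl α v) = weyl α (w * v) := by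
    apply R_algHom_ext <;> simp [weyl_h]
  exact AlgHom.congr_fun this f

theorem weyl_one (α : ℂ) (f : R α) : weyl α 1 f = f := by
  have : weyl α 1 = AlgHom.id ℂ _ := by
    apply R_algHom_ext <;> simp [weyl_h]
  exact AlgHom.congr_fun this f

/-! ### Degrees -/

/-- The elements of `R` of degree less than `n`. -/
def degLT (α : ℂ) (n : ℕ) : Submodule ℂ (R α) :=
  Submodule.span ℂ ((fun p : ℕ × ℕ => h α 1 ^ p.1 * h α 2 ^ p.2) '' {p | p.1 + p.2 < n})

theorem degLT_mono {α : ℂ} {m n : ℕ} (hmn : m ≤ n) : degLT α m ≤ degLT α n :=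
  Submodule.span_mono (Set.image_mono fun _ hp => lt_of_lt_of_le hp hmn)

theorem h1_mul_mem {α : ℂ} {n : ℕ} {f : R α} (hf : f ∈ degLT α n) : h α 1 * f ∈ degLT α (n + 1) := by
  induction hf using Submodule.span_induction with
  | mem x hx =>
    obtain ⟨p, hp, rfl⟩ := hx
    refine Submodule.subset_span ⟨(p.1 + 1, p.2), ?_, by simp; ring⟩
    have : p.1 + p.2 < n := hp
    simp; omega
  | zero => simp
  | add x y _ _ hx hy => rw [mul_add]; exact add_mem hx hy
  | smul c x _ hx => rw [mul_smul_comm]; exact Submodule.smul_mem _ _ hx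

theorem h2_mul_mem {α : ℂ} {n : ℕ} {f : R α} (hf : f ∈ degLT α n) : h α 2 * f ∈ degLT α (n + 1) := by
  induction hf using Submodule.span_induction with
  | mem x hx =>
    obtain ⟨p, hp, rfl⟩ := hx
    refine Submodule.subset_span ⟨(p.1, p.2 + 1), ?_, by simp; ring⟩
    have : p.1 + p.2 < n := hp
    simp; omega
  | zero => simp
  | add x y _ _ hx hy => rw [mul_add]; exact add_mem hx hy
  | smul c x _ hx => rw [mul_smul_comm]; exact Submodule.smul_mem _ _ hx

theorem const_mul_mem {α : ℂ} {n : ℕ} {f : R α} (c : ℂ) (hf : f ∈ degLT α n) :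
    algebraMap ℂ (R α) c * f ∈ degLT α n := by
  rw [← Algebra.smul_def]; exact Submodule.smul_mem _ _ hf

theorem one_mem_degLT (α : ℂ) : (1 : R α) ∈ degLT α 1 :=
  Submodule.subset_span ⟨(0, 0), by simp, by simp⟩

/-- Translations preserve the degree and the leading form. -/
theorem sh_sub_mem {α : ℂ} (s t : ℤ) {n : ℕ} {f : R α} (hf : f ∈ degLT α (n + 1)) :
    sh α s t f - f ∈ degLT α n := by
  have key : ∀ p q : ℕ, sh α s t (h α 1 ^ p * h α 2 ^ q) - h α 1 ^ p * h α 2 ^ q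
      ∈ degLT α (p + q) := by
    have mem : ∀ p q : ℕ, h α 1 ^ p * h α 2 ^ q ∈ degLT α (p + q + 1) := fun p q =>
      Submodule.subset_span ⟨(p, q), by simp, rfl⟩
    intro p
    induction p with
    | zero =>
      intro q
      induction q with
      | zero => simp
      | succ q ih =>
        -- The discrete Leibniz rule: `T(yg) - yg = y(Tg - g) + t((Tg - g) + g)` if the translation
        -- `T` takes `y` to `y + t`.
        have e : sh α s t (h α 1 ^ 0 * h α 2 ^ (q + 1)) - h α 1 ^ 0 * h α 2 ^ (q + 1)
          = h α 2 * (sh α s t (h α 1 ^ 0 * h α 2 ^ q) - h α 1 ^ 0 * h α 2 ^ q)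
            + algebraMap ℂ _ (t : ℂ) * ((sh α s t (h α 1 ^ 0 * h α 2 ^ q)
              - h α 1 ^ 0 * h α 2 ^ q) + h α 1 ^ 0 * h α 2 ^ q) := by
          simp; ring
        rw [e]
        exact add_mem (h2_mul_mem ih) (const_mul_mem _ (add_mem (degLT_mono (by omega) ih)
          (degLT_mono (by omega) (mem 0 q))))
    | succ p ih =>
      intro q
      have e : sh α s t (h α 1 ^ (p + 1) * h α 2 ^ q) - h α 1 ^ (p + 1) * h α 2 ^ q
        = h α 1 * (sh α s t (h α 1 ^ p * h α 2 ^ q) - h α 1 ^ p * h α 2 ^ q)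
          + algebraMap ℂ _ (s : ℂ) * ((sh α s t (h α 1 ^ p * h α 2 ^ q)
            - h α 1 ^ p * h α 2 ^ q) + h α 1 ^ p * h α 2 ^ q) := by
        simp; ring
      rw [e, show p + 1 + q = p + q + 1 by ring]
      exact add_mem (h1_mul_mem (ih q)) (const_mul_mem _ (add_mem (degLT_mono (by omega) (ih q))
        (mem p q)))
  induction hf using Submodule.span_induction with
  | mem x hx =>
    obtain ⟨p, hp, rfl⟩ := hx
    have : p.1 + p.2 < n + 1 := hp
    exact degLT_mono (by omega) (key p.1 p.2)
  | zero => simp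
  | add x y _ _ hx hy =>
    rw [map_add, add_sub_add_comm]; exact add_mem hx hy
  | smul c x _ hx => rw [map_smul, ← smul_sub]; exact Submodule.smul_mem _ _ hx

theorem exists_mem_degLT {α : ℂ} (f : R α) : ∃ n, f ∈ degLT α n := by
  induction f using R_induction with
  | hC c => exact ⟨1, by simpa using const_mul_mem c (one_mem_degLT α)⟩
  | hadd f g hf hg =>
    obtain ⟨m, hm⟩ := hf
    obtain ⟨n, hn⟩ := hg
    exact ⟨max m n, add_mem (degLT_mono (le_max_left _ _) hm) (degLT_mono (le_max_right _ _) hn)⟩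
  | hmul f i hf =>
    obtain ⟨n, hn⟩ := hf
    have h1 := h1_mul_mem hn
    have h2 := h2_mul_mem hn
    refine ⟨n + 1, ?_⟩
    rw [mul_comm]
    fin_cases i
    · have e : h α 0 * f = algebraMap ℂ _ α * f - h α 1 * f - h α 2 * f := by
        rw [h_zero]; ring
      change h α 0 * f ∈ _
      rw [e]
      exact sub_mem (sub_mem (const_mul_mem _ (degLT_mono (by omega) hn)) h1) h2
    · exact h1
    · exact h2

/-- A linearly independent family indexed by `ℕ × ℕ` whose `(l, k)` member has degree at most
`l + k` spans `R`. -/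
theorem span_eq_top_of_degree {α : ℂ} {f : ℕ × ℕ → R α} (hf : LinearIndependent ℂ f)
    (hd : ∀ p, f p ∈ degLT α (p.1 + p.2 + 1)) : Submodule.span ℂ (Set.range f) = ⊤ := by
  rw [eq_top_iff]
  rintro g -
  obtain ⟨n, hn⟩ := exists_mem_degLT g
  let I : Finset (ℕ × ℕ) := (Finset.range n ×ˢ Finset.range n).filter fun p => p.1 + p.2 < n
  have hI : ∀ p : ℕ × ℕ, p ∈ I ↔ p.1 + p.2 < n := by
    intro p; simp [I]; omega
  have hfin : degLT α n = Submodule.span ℂ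
      (Set.range fun p : I => h α 1 ^ p.1.1 * h α 2 ^ p.1.2) := by
    unfold degLT
    congr 1
    ext x
    simp only [Set.mem_image, Set.mem_range, Subtype.exists, hI]
    simp
  have : FiniteDimensional ℂ (degLT α n) := by
    rw [hfin]; exact FiniteDimensional.span_of_finite ℂ (Set.finite_range _)
  have hle : Submodule.span ℂ (Set.range fun p : I => f p.1) ≤ degLT α n := by
    rw [Submodule.span_le]
    rintro _ ⟨p, rfl⟩
    exact degLT_mono (by have := (hI p.1).mp p.2; omega) (hd p.1)
  -- Dimension count: `degLT α n` is spanned by as many monomials as there are indices in `I`, and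
  -- the `f p` with `p` in `I` are equally many independent elements of it.
  have heq : Submodule.span ℂ (Set.range fun p : I => f p.1) = degLT α n := by
    refine Submodule.eq_of_le_of_finrank_le hle ?_
    have hli : LinearIndependent ℂ fun p : I => f p.1 := hf.comp _ Subtype.val_injective
    rw [finrank_span_eq_card hli, hfin]
    exact finrank_range_le_card _
  rw [← heq] at hn
  exact Submodule.span_mono (by rintro _ ⟨p, rfl⟩; exact ⟨p.1, rfl⟩) hn

/-! ### Shift invariant functionals on `R` -/

/-- Invariance of a functional on `R` under the translations by roots, on the elements on which it
is implied by the trace property. -/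
def IsShiftInvariant {α : ℂ} (Λ : R α →ₗ[ℂ] ℂ) : Prop :=
  ∀ i j, i ≠ j → ∀ f : R α,
    Λ (shift α i j (f * (h α i * (h α j + 1)))) = Λ (f * (h α i * (h α j + 1)))

/-- In `A α` the element `h i * (h j + 1)` is `E_ij E_ji`, and `shift i j` turns it into `E_ji
E_ij`. So the condition for `(j, i)` at `f` is the condition for `(i, j)` at `shift j i f` read
backwards, and three of the six roots suffice. -/
theorem shiftInvariant_symm {α : ℂ} {Λ : R α →ₗ[ℂ] ℂ} {i j : Fin 3} (hij : i ≠ j)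
    (H : ∀ f : R α, Λ (shift α i j (f * (h α i * (h α j + 1)))) = Λ (f * (h α i * (h α j + 1))))
    (f : R α) : Λ (shift α j i (f * (h α j * (h α i + 1)))) = Λ (f * (h α j * (h α i + 1))) := by
  have e1 : shift α j i (f * (h α j * (h α i + 1))) = shift α j i f * (h α i * (h α j + 1)) := by
    simp only [map_mul, map_add, map_one, shift_h, if_pos, if_neg hij, if_neg hij.symm]
    ring
  have e2 : shift α i j (shift α j i f * (h α i * (h α j + 1))) = f * (h α j * (h α i + 1)) := by
    rw [map_mul, shift_shift]
    simp only [map_mul, map_add, map_one, shift_h, if_pos, if_neg hij, if_neg hij.symm]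
    ring
  rw [e1, ← H, e2]

theorem shiftInvariant_of_pairs {α : ℂ} {Λ : R α →ₗ[ℂ] ℂ}
    (H01 : ∀ f : R α, Λ (shift α 0 1 (f * (h α 0 * (h α 1 + 1)))) = Λ (f * (h α 0 * (h α 1 + 1))))
    (H02 : ∀ f : R α, Λ (shift α 0 2 (f * (h α 0 * (h α 2 + 1)))) = Λ (f * (h α 0 * (h α 2 + 1))))
    (H12 : ∀ f : R α, Λ (shift α 1 2 (f * (h α 1 * (h α 2 + 1)))) = Λ (f * (h α 1 * (h α 2 + 1)))) :
    IsShiftInvariant Λ := by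
  intro i j hij
  fin_cases i <;> fin_cases j
  · simp at hij
  · exact H01
  · exact H02
  · exact shiftInvariant_symm (by decide) H01
  · simp at hij
  · exact H12
  · exact shiftInvariant_symm (by decide) H02
  · exact shiftInvariant_symm (by decide) H12
  · simp at hij

/-! ### Falling factorials and the recursion for invariant functionals -/

/-- The falling factorial of `E_{ii}`. -/
def fall (α : ℂ) (i : Fin 3) (p : ℕ) : R α := ∏ r ∈ Finset.range p, (h α i - r)

theorem fall_zero (α : ℂ) (i : Fin 3) : fall α i 0 = 1 := rfl

theorem fall_succ (α : ℂ) (i : Fin 3) (p : ℕ) : fall α i (p + 1) = fall α i p * (h α i - p) :=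
  Finset.prod_range_succ _ p

theorem h_mul_fall (α : ℂ) (i : Fin 3) (p : ℕ) :
    h α i * fall α i p = fall α i (p + 1) + p * fall α i p := by
  rw [fall_succ]; ring

/-- The products of falling factorials of `E₂₂` and `E₃₃`. -/
def fallProd (α : ℂ) (p q : ℕ) : R α := fall α 1 p * fall α 2 q

theorem h1_mul_fallProd (α : ℂ) (p q : ℕ) :
    h α 1 * fallProd α p q = fallProd α (p + 1) q + (p : ℂ) • fallProd α p q := by
  rw [fallProd, fallProd, ← mul_assoc, h_mul_fall, R_smul]
  simp; ring

theorem h2_mul_fallProd (α : ℂ) (p q : ℕ) :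
    h α 2 * fallProd α p q = fallProd α p (q + 1) + (q : ℂ) • fallProd α p q := by
  rw [fallProd, fallProd, mul_left_comm, h_mul_fall, R_smul]
  simp; ring

/-- A unit translation changes only one end factor of a falling factorial. For this reason shift
invariance becomes a short recursion in the basis of falling factorials. -/
theorem sh_fall_one (α : ℂ) (t : ℤ) (p : ℕ) :
    sh α 1 t (fall α 1 (p + 1)) = (h α 1 + 1) * fall α 1 p := by
  induction p with
  | zero => simp [fall]
  | succ p ih => rw [fall_succ, map_mul, ih, fall_succ]; simp; ring

theorem sh_fall_two (α : ℂ) (s : ℤ) (p : ℕ) :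
    sh α s 1 (fall α 2 (p + 1)) = (h α 2 + 1) * fall α 2 p := by
  induction p with
  | zero => simp [fall]
  | succ p ih => rw [fall_succ, map_mul, ih, fall_succ]; simp; ring

theorem sh_fall_one_of (α : ℂ) (t : ℤ) (p : ℕ) : sh α 0 t (fall α 1 p) = fall α 1 p := by
  simp [fall, map_prod]

theorem sh_fall_two_of (α : ℂ) (s : ℤ) (p : ℕ) : sh α s 0 (fall α 2 p) = fall α 2 p := by
  simp [fall, map_prod]

theorem sh_neg_fall_one (α : ℂ) (t : ℤ) (p : ℕ) :
    sh α (-1) t ((h α 1 + 1) * fall α 1 p) = fall α 1 (p + 1) := by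
  rw [← sh_fall_one α (-t), sh_sh]; simp

theorem sh_neg_fall_two (α : ℂ) (s : ℤ) (p : ℕ) :
    sh α s (-1) ((h α 2 + 1) * fall α 2 p) = fall α 2 (p + 1) := by
  rw [← sh_fall_two α (-s), sh_sh]; simp

theorem span_fallProd (α : ℂ) :
    Submodule.span ℂ (Set.range fun p : ℕ × ℕ => fallProd α p.1 p.2) = ⊤ := by
  set W := Submodule.span ℂ (Set.range fun p : ℕ × ℕ => fallProd α p.1 p.2) with hW
  have mem : ∀ p q, fallProd α p q ∈ W := fun p q => Submodule.subset_span ⟨(p, q), rfl⟩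
  have m1 : ∀ f ∈ W, h α 1 * f ∈ W := by
    intro f hf
    induction hf using Submodule.span_induction with
    | mem x hx =>
      obtain ⟨p, rfl⟩ := hx
      rw [h1_mul_fallProd]
      exact add_mem (mem _ _) (Submodule.smul_mem _ _ (mem _ _))
    | zero => simp
    | add x y _ _ hx hy => rw [mul_add]; exact add_mem hx hy
    | smul c x _ hx => rw [mul_smul_comm]; exact Submodule.smul_mem _ _ hx
  have m2 : ∀ f ∈ W, h α 2 * f ∈ W := by
    intro f hf
    induction hf using Submodule.span_induction with
    | mem x hx =>
      obtain ⟨p, rfl⟩ := hx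
      rw [h2_mul_fallProd]
      exact add_mem (mem _ _) (Submodule.smul_mem _ _ (mem _ _))
    | zero => simp
    | add x y _ _ hx hy => rw [mul_add]; exact add_mem hx hy
    | smul c x _ hx => rw [mul_smul_comm]; exact Submodule.smul_mem _ _ hx
  rw [eq_top_iff]
  rintro f -
  induction f using R_induction with
  | hC c =>
    have : algebraMap ℂ (R α) c = c • fallProd α 0 0 := by
      rw [R_smul]; simp [fallProd, fall_zero]
    rw [this]
    exact Submodule.smul_mem _ _ (mem _ _)
  | hadd f g hf hg => exact add_mem hf hg
  | hmul f i hf =>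
    rw [mul_comm]
    fin_cases i
    · have e : h α 0 * f = α • f - h α 1 * f - h α 2 * f := by
        rw [h_zero, R_smul]; ring
      change h α 0 * f ∈ _
      rw [e]
      exact sub_mem (sub_mem (Submodule.smul_mem _ _ hf) (m1 f hf)) (m2 f hf)
    · exact m1 f hf
    · exact m2 f hf

/-- Two linear maps on `R` that agree on the products of falling factorials are equal. -/
theorem linearMap_ext_fallProd {α : ℂ} {M : Type*} [AddCommGroup M] [Module ℂ M]
    {φ ψ : R α →ₗ[ℂ] M} (H : ∀ p q, φ (fallProd α p q) = ψ (fallProd α p q)) : φ = ψ := by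
  refine LinearMap.ext_on_range (v := fun p : ℕ × ℕ => fallProd α p.1 p.2) (span_fallProd α) ?_
  exact fun p => H p.1 p.2

theorem shift_sub_fallProd_01 (α : ℂ) (p q : ℕ) :
    fallProd α p q * (h α 0 * (h α 1 + 1)) - shift α 0 1 (fallProd α p q * (h α 0 * (h α 1 + 1)))
      = ((p + 1) * (α - p - q) : ℂ) • fallProd α p q - (p + 2 : ℂ) • fallProd α (p + 1) q
        - (p + 1 : ℂ) • fallProd α p (q + 1) := by
  have e : fallProd α p q * (h α 0 * (h α 1 + 1))
      = ((h α 1 + 1) * fall α 1 p) * fall α 2 q * h α 0 := by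
    rw [fallProd]; ring
  rw [shift_01, e, map_mul, map_mul, sh_neg_fall_one, sh_fall_two_of, sh_h0, h_zero]
  simp only [R_smul, fallProd, fall_succ, map_mul, map_add, map_sub, map_natCast,
    map_one, map_ofNat, Int.cast_neg, Int.cast_one, Int.cast_zero]
  ring

theorem shift_sub_fallProd_02 (α : ℂ) (p q : ℕ) :
    fallProd α p q * (h α 0 * (h α 2 + 1)) - shift α 0 2 (fallProd α p q * (h α 0 * (h α 2 + 1)))
      = ((q + 1) * (α - p - q) : ℂ) • fallProd α p q - (q + 2 : ℂ) • fallProd α p (q + 1)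
        - (q + 1 : ℂ) • fallProd α (p + 1) q := by
  have e : fallProd α p q * (h α 0 * (h α 2 + 1))
      = fall α 1 p * ((h α 2 + 1) * fall α 2 q) * h α 0 := by
    rw [fallProd]; ring
  rw [shift_02, e, map_mul, map_mul, sh_neg_fall_two, sh_fall_one_of, sh_h0, h_zero]
  simp only [R_smul, fallProd, fall_succ, map_mul, map_add, map_sub, map_natCast,
    map_one, map_ofNat, Int.cast_neg, Int.cast_one, Int.cast_zero]
  ring

/-- The test elements are translated by `sh (-1) 0` so that the factor `h 1` completes them to `fall
1 (p + 1)`. The translation is invertible, so they still span `R`. -/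
theorem shift_sub_fallProd_12 (α : ℂ) (p q : ℕ) :
    sh α (-1) 0 (fallProd α p q) * (h α 1 * (h α 2 + 1))
        - shift α 1 2 (sh α (-1) 0 (fallProd α p q) * (h α 1 * (h α 2 + 1)))
      = (q + 1 : ℂ) • fallProd α (p + 1) q - (p + 1 : ℂ) • fallProd α p (q + 1) := by
  have e : sh α (-1) 0 (fallProd α p q) * (h α 1 * (h α 2 + 1))
      = fall α 1 (p + 1) * ((h α 2 + 1) * fall α 2 q) := by
    rw [fallProd, map_mul, ← sh_neg_fall_one α 0, map_mul, sh_fall_two_of]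
    simp; ring
  rw [shift_12, e, map_mul, sh_neg_fall_two, sh_fall_one]
  simp only [R_smul, fallProd, fall_succ, map_add, map_natCast, map_one]
  ring

/-- Shift invariance is linear in `f`, hence can be tested on the spanning family `fallProd`; the
three equations are the roots 12, 13 and 23. -/
theorem shiftInvariant_iff {α : ℂ} (Λ : R α →ₗ[ℂ] ℂ) : IsShiftInvariant Λ ↔ ∀ p q : ℕ,
    (p + 1) * (α - p - q) * Λ (fallProd α p q) - (p + 2) * Λ (fallProd α (p + 1) q)
        - (p + 1) * Λ (fallProd α p (q + 1)) = 0 ∧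
    (q + 1) * (α - p - q) * Λ (fallProd α p q) - (q + 2) * Λ (fallProd α p (q + 1))
        - (q + 1) * Λ (fallProd α (p + 1) q) = 0 ∧
    (q + 1) * Λ (fallProd α (p + 1) q) - (p + 1) * Λ (fallProd α p (q + 1)) = 0 := by
  constructor
  · intro H p q
    have h1 := congrArg Λ (shift_sub_fallProd_01 α p q)
    have h2 := congrArg Λ (shift_sub_fallProd_02 α p q)
    have h3 := congrArg Λ (shift_sub_fallProd_12 α p q)
    rw [map_sub, H 0 1 (by decide), sub_self] at h1
    rw [map_sub, H 0 2 (by decide), sub_self] at h2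
    rw [map_sub, H 1 2 (by decide), sub_self] at h3
    simp only [map_sub, map_smul, smul_eq_mul] at h1 h2 h3
    exact ⟨h1.symm, h2.symm, h3.symm⟩
  · intro H
    refine shiftInvariant_of_pairs (fun f => ?_) (fun f => ?_) (fun f => ?_)
    · have : Λ ∘ₗ (shift α 0 1).toLinearMap ∘ₗ LinearMap.mulRight ℂ (h α 0 * (h α 1 + 1))
          = Λ ∘ₗ LinearMap.mulRight ℂ (h α 0 * (h α 1 + 1)) := by
        refine linearMap_ext_fallProd fun p q => ?_
        have h1 := congrArg Λ (shift_sub_fallProd_01 α p q)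
        simp only [map_sub, map_smul, smul_eq_mul] at h1
        rw [(H p q).1] at h1
        exact (sub_eq_zero.mp h1).symm
      exact LinearMap.congr_fun this f
    · have : Λ ∘ₗ (shift α 0 2).toLinearMap ∘ₗ LinearMap.mulRight ℂ (h α 0 * (h α 2 + 1))
          = Λ ∘ₗ LinearMap.mulRight ℂ (h α 0 * (h α 2 + 1)) := by
        refine linearMap_ext_fallProd fun p q => ?_
        have h1 := congrArg Λ (shift_sub_fallProd_02 α p q)
        simp only [map_sub, map_smul, smul_eq_mul] at h1
        rw [(H p q).2.1] at h1
        exact (sub_eq_zero.mp h1).symm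
      exact LinearMap.congr_fun this f
    · have : Λ ∘ₗ (shift α 1 2).toLinearMap ∘ₗ LinearMap.mulRight ℂ (h α 1 * (h α 2 + 1))
            ∘ₗ (sh α (-1) 0).toLinearMap
          = Λ ∘ₗ LinearMap.mulRight ℂ (h α 1 * (h α 2 + 1)) ∘ₗ (sh α (-1) 0).toLinearMap := by
        refine linearMap_ext_fallProd fun p q => ?_
        have h1 := congrArg Λ (shift_sub_fallProd_12 α p q)
        simp only [map_sub, map_smul, smul_eq_mul] at h1
        rw [(H p q).2.2] at h1
        exact (sub_eq_zero.mp h1).symm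
      have h2 := LinearMap.congr_fun this (sh α 1 0 f)
      simp only [LinearMap.comp_apply, AlgHom.toLinearMap_apply, LinearMap.mulRight_apply, sh_sh,
        neg_add_cancel, add_zero, sh_zero] at h2
      exact h2

theorem shiftInvariant_unique {α : ℂ} {Λ Λ' : R α →ₗ[ℂ] ℂ} (hΛ : IsShiftInvariant Λ)
    (hΛ' : IsShiftInvariant Λ') (h1 : Λ 1 = Λ' 1) : Λ = Λ' := by
  rw [shiftInvariant_iff] at hΛ hΛ'
  have key : ∀ M p q : ℕ, p + q = M → Λ (fallProd α p q) - Λ' (fallProd α p q) = 0 := by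
    intro M
    induction M with
    | zero =>
      intro p q hpq
      obtain ⟨rfl, rfl⟩ : p = 0 ∧ q = 0 := by omega
      simp only [fallProd, fall_zero, mul_one, h1, sub_self]
    | succ M ih =>
      have step : ∀ p q : ℕ, p + q = M →
          Λ (fallProd α (p + 1) q) - Λ' (fallProd α (p + 1) q) = 0 ∧
          Λ (fallProd α p (q + 1)) - Λ' (fallProd α p (q + 1)) = 0 := by
        intro p q hpq
        obtain ⟨a1, a2, a3⟩ := hΛ p q
        obtain ⟨b1, b2, b3⟩ := hΛ' p q
        have h0 := ih p q hpq
        -- Eliminating `fallProd p (q + 1)` from the first relation by the third gives `(p + q + 3)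
        -- Λ(p + 1, q) = (p + 1)(α - p - q) Λ(p, q)`.
        have c : (p + q + 3 : ℂ) ≠ 0 := by exact_mod_cast (by omega : p + q + 3 ≠ 0)
        have d : (q + 2 : ℂ) ≠ 0 := by exact_mod_cast (by omega : q + 2 ≠ 0)
        have e : Λ (fallProd α (p + 1) q) - Λ' (fallProd α (p + 1) q) = 0 := by
          refine (mul_eq_zero.mp (?_ : (p + q + 3 : ℂ) * _ = 0)).resolve_left c
          linear_combination (p + 1) * (α - p - q) * h0 - a1 + b1 + a3 - b3
        refine ⟨e, (mul_eq_zero.mp (?_ : (q + 2 : ℂ) * _ = 0)).resolve_left d⟩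
        linear_combination (q + 1) * (α - p - q) * h0 - a2 + b2 - (q + 1) * e
      intro p q hpq
      rcases p with _ | p
      · rcases q with _ | q
        · omega
        · exact (step 0 q (by omega)).2
      · exact (step p q (by omega)).1
  exact linearMap_ext_fallProd fun p q => sub_eq_zero.mp (key _ p q rfl)

/-- Joint eigenvectors of two operators with real eigenvalues that separate them are linearly
independent. -/
theorem linearIndependent_of_joint_eigen {V : Type*} [AddCommGroup V] [Module ℂ V] {ι : Type*}
    (A B : Module.End ℂ V) (f : ι → V) (lam mu : ι → ℝ)
    (hA : ∀ i, A (f i) = (lam i : ℂ) • f i) (hB : ∀ i, B (f i) = (mu i : ℂ) • f i)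
    (hinj : ∀ i j, lam i = lam j → mu i = mu j → i = j) (h0 : ∀ i, f i ≠ 0) :
    LinearIndependent ℂ f := by
  -- Reality of the eigenvalues makes the single operator `A + iB` suffice: its eigenvalue `λ + iμ`
  -- determines both `λ` and `μ`.
  refine Module.End.eigenvectors_linearIndependent' (A + Complex.I • B)
    (fun i => (lam i : ℂ) + mu i * Complex.I) ?_ f fun i => ?_
  · intro i j hij
    have h1 := congrArg Complex.re hij
    have h2 := congrArg Complex.im hij
    simp at h1 h2
    exact hinj i j h1 h2
  · refine ⟨?_, h0 i⟩
    rw [Module.End.mem_eigenspace_iff, LinearMap.add_apply, LinearMap.smul_apply, hA, hB, smul_smul,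
      add_smul, mul_comm]

theorem fall_ne_zero (α : ℂ) (p q : ℕ) : fallProd α p q ≠ 0 := by
  intro H
  have := congrArg (ev α p q) H
  simp only [fallProd, fall, map_mul, map_prod, map_sub, ev_h1, ev_h2, map_natCast, map_zero,
    mul_eq_zero, Finset.prod_eq_zero_iff, Finset.mem_range, sub_eq_zero, Nat.cast_inj] at this
  rcases this with ⟨a, h1, h2⟩ | ⟨a, h1, h2⟩ <;> omega

/-- With `T` the translation by `-1` in one variable `y`, the operator `y(1 - T)` multiplies the
falling factorial of length `p` by `p`. -/
theorem linearIndependent_fallProd (α : ℂ) :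
    LinearIndependent ℂ fun p : ℕ × ℕ => fallProd α p.1 p.2 := by
  refine linearIndependent_of_joint_eigen
    (LinearMap.mulLeft ℂ (h α 1) ∘ₗ (LinearMap.id - (sh α (-1) 0).toLinearMap))
    (LinearMap.mulLeft ℂ (h α 2) ∘ₗ (LinearMap.id - (sh α 0 (-1)).toLinearMap)) _
    (fun p => p.1) (fun p => p.2) ?_ ?_ ?_ fun p => fall_ne_zero α _ _
  · rintro ⟨p, q⟩
    have e := sh_neg_fall_one α 0 p
    simp only [fall_succ, map_mul, map_add, sh_h1, map_one] at e
    simp only [fallProd, LinearMap.comp_apply, LinearMap.sub_apply, LinearMap.id_apply,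
      AlgHom.toLinearMap_apply, map_mul, LinearMap.mulLeft_apply, sh_fall_two_of,
      R_smul]
    simp at e ⊢
    linear_combination (-fall α 2 q) * e
  · rintro ⟨p, q⟩
    have e := sh_neg_fall_two α 0 q
    simp only [fall_succ, map_mul, map_add, sh_h2, map_one] at e
    simp only [fallProd, LinearMap.comp_apply, LinearMap.sub_apply, LinearMap.id_apply,
      AlgHom.toLinearMap_apply, map_mul, LinearMap.mulLeft_apply, sh_fall_one_of,
      R_smul]
    simp at e ⊢
    linear_combination (-fall α 1 p) * e
  · rintro ⟨p, q⟩ ⟨p', q'⟩ h1 h2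
    simp at h1 h2
    rw [h1, h2]

/-- The moments of the invariant functional on products of falling factorials. -/
def moment (α : ℂ) : ℕ → ℂ
  | 0 => 1
  | M + 1 => (α - M) / (M + 3) * moment α M

/-- The recursion forces the value `p! q! moment(p + q)` on `fallProd p q`; conversely these values
satisfy all three relations, and a basis can be given any values. -/
theorem exists_shiftInvariant (α : ℂ) : ∃ Λ : R α →ₗ[ℂ] ℂ, IsShiftInvariant Λ ∧ Λ 1 = 1 := by
  let b := Module.Basis.mk (linearIndependent_fallProd α) (span_fallProd α).ge
  let Λ : R α →ₗ[ℂ] ℂ := b.constr ℂ fun p : ℕ × ℕ =>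
    (p.1.factorial : ℂ) * p.2.factorial * moment α (p.1 + p.2)
  have hb : ∀ p q, Λ (fallProd α p q) = (p.factorial : ℂ) * q.factorial * moment α (p + q) := by
    intro p q
    have : fallProd α p q = b (p, q) := by simp [b]
    rw [this, Module.Basis.constr_basis]
  refine ⟨Λ, (shiftInvariant_iff Λ).mpr fun p q => ?_, ?_⟩
  · have c : (p + q + 3 : ℂ) ≠ 0 := by exact_mod_cast (by omega : p + q + 3 ≠ 0)
    have hm : (p + q + 3 : ℂ) * moment α (p + q + 1) = (α - p - q) * moment α (p + q) := by
      rw [moment]; push_cast; field_simp; ring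
    simp only [hb, show p + 1 + q = p + q + 1 by ring, ← add_assoc, Nat.factorial_succ]
    push_cast
    refine ⟨?_, ?_, ?_⟩
    · linear_combination (-(p + 1 : ℂ) * p.factorial * q.factorial) * hm
    · linear_combination (-(q + 1 : ℂ) * p.factorial * q.factorial) * hm
    · ring
  · have := hb 0 0
    simpa [fallProd, fall_zero, moment] using this

/-- A permutation of the indices permutes the conditions of shift invariance and fixes `1`, so
uniqueness applies to `Λ ∘ w`. -/
theorem shiftInvariant_weyl {α : ℂ} {Λ : R α →ₗ[ℂ] ℂ} (hΛ : IsShiftInvariant Λ)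
    (w : Equiv.Perm (Fin 3)) (f : R α) : Λ (weyl α w f) = Λ f := by
  have : Λ ∘ₗ (weyl α w).toLinearMap = Λ := by
    refine shiftInvariant_unique (fun i j hij f => ?_) hΛ (by simp)
    simp only [LinearMap.comp_apply, AlgHom.toLinearMap_apply]
    rw [weyl_shift]
    simp only [map_mul (weyl α w), map_add (weyl α w), map_one (weyl α w), weyl_h]
    exact hΛ _ _ (w.injective.ne hij) _
  exact LinearMap.congr_fun this f

/-! ### The action of the root vectors on the coefficients

For `a ≥ 0 ≥ b` and `c ≤ 0` the elements of weight `a ε₁ + b ε₂ + c ε₃` are the `f u_ν`, and the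
adjoint action of `E_{ij}` takes `f u_ν` to `(raise_{ij} f) u_{ν + ε_i - ε_j}`. -/

theorem cst_add (α a b : ℂ) : cst α (a + b) = cst α a + cst α b := map_add _ a b
theorem cst_sub (α a b : ℂ) : cst α (a - b) = cst α a - cst α b := map_sub _ a b
theorem cst_mul (α a b : ℂ) : cst α (a * b) = cst α a * cst α b := map_mul _ a b
theorem cst_neg (α a : ℂ) : cst α (-a) = -cst α a := map_neg _ a
theorem cst_pow (α a : ℂ) (n : ℕ) : cst α (a ^ n) = cst α a ^ n := map_pow _ a n
theorem cst_one (α : ℂ) : cst α 1 = 1 := map_one _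
theorem cst_zero (α : ℂ) : cst α 0 = 0 := map_zero _
theorem cst_natCast (α : ℂ) (n : ℕ) : cst α n = n := map_natCast _ n
theorem cst_two (α : ℂ) : cst α 2 = 2 := map_ofNat _ 2
theorem algHom_cst {α β : ℂ} (φ : R α →ₐ[ℂ] R β) (c : ℂ) : φ (cst α c) = cst β c := φ.commutes c
theorem h_zero' (α : ℂ) : h α 0 = cst α α - h α 1 - h α 2 := h_zero α
theorem smul_eq_cst {α : ℂ} (c : ℂ) (f : R α) : c • f = cst α c * f := R_smul c f
theorem cst_ne_zero {α c : ℂ} (hc : c ≠ 0) : cst α c ≠ 0 := by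
  intro H
  exact hc ((map_eq_zero_iff _ (algebraMap ℂ (R α)).injective).mp H)
theorem cst_mul_mem {α : ℂ} {n : ℕ} {f : R α} (c : ℂ) (hf : f ∈ degLT α n) :
    cst α c * f ∈ degLT α n := const_mul_mem c hf

variable {α : ℂ}

/-- The coefficient of `[E₁₂, f u_ν]`. -/
def raise12 (f : R α) : R α := sh α 1 0 f - f

/-- The coefficient of `[E₁₃, f u_ν]`. -/
def raise13 (f : R α) : R α := sh α 0 1 f - f

/-- The coefficient of `[E₂₁, f u_ν]`. -/
def raise21 (a b : ℂ) (f : R α) : R α :=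
  sh α (-1) 0 f * ((h α 0 + 1) * h α 1) - f * ((h α 0 - cst α a + 1) * (h α 1 - cst α b))

/-- The coefficient of `[E₃₁, f u_ν]`. -/
def raise31 (a c : ℂ) (f : R α) : R α :=
  sh α 0 (-1) f * ((h α 0 + 1) * h α 2) - f * ((h α 0 - cst α a + 1) * (h α 2 - cst α c))

/-- The coefficient of `[E₃₂, f u_ν]`. -/
def raise32 (c : ℂ) (f : R α) : R α := sh α 1 (-1) f * h α 2 - f * (h α 2 - cst α c)

/-- The coefficient of `[E₂₃, f u_ν]`. -/
def raise23 (b : ℂ) (f : R α) : R α := sh α (-1) 1 f * h α 1 - f * (h α 1 - cst α b)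

/-- The coefficient of `(ad z₃₁)(f u_ν)`. -/
def lower31 (a b c : ℂ) (f : R α) : R α :=
  cst α (a - b + 1) * raise31 a c f + raise21 a (b - 1) (raise32 c f)

/-- The coefficient of `(ad E₂₁)(ad E₁₂)(f u_ν)`. -/
def casimir₁ (a b : ℂ) (f : R α) : R α := raise21 (a + 1) (b - 1) (raise12 f)

/-- The coefficient of `(ad E₁₃)(ad E₃₁)(f u_ν) + (ad E₂₃)(ad E₃₂)(f u_ν)`. -/
def casimir₂ (a b c : ℂ) (f : R α) : R α :=
  raise13 (raise31 a c f) + raise23 (b - 1) (raise32 c f)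

/-- The coefficient of the quadratic Casimir element of `gl(3)` acting on `f u_ν`. -/
def casimir (a b c : ℂ) (f : R α) : R α :=
  casimir₁ a b f + casimir₂ a b c f + cst α (a ^ 2 + b ^ 2 + a * b - a - 2 * b) * f

-- Centrality of the Casimir element, seen on coefficients. The operator `casimir` is half of `∑
-- E_ij E_ji`, its constant term being what remains after normal ordering and `c = -a - b`. As an
-- identity of difference operators it holds for complex `a`, `b`, and is checked by expansion.
set_option maxRecDepth 4000 in
set_option maxHeartbeats 1000000 in
theorem casimir_raise21 (a b c : ℂ) (hs : a + b + c = 0) (f : R α) :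
    casimir (a - 1) (b + 1) c (raise21 a b f) = raise21 a b (casimir a b c f) := by
  obtain rfl : c = -a - b := by linear_combination hs
  simp only [casimir, casimir₁, casimir₂, raise21, raise12, raise13, raise31, raise23, raise32,
    map_sub, map_add, map_mul, map_neg, map_pow, map_zero,
    map_ofNat, sh_sh, sh_h0, sh_h1, sh_h2, algHom_cst, map_one,
    Int.reduceAdd, Int.reduceNeg, sh_zero, cst_add, cst_sub, cst_mul, cst_pow, cst_one, cst_neg,
    cst_two, Int.cast_neg, Int.cast_one, Int.cast_zero]
  rw [h_zero' α]
  ring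

set_option maxRecDepth 4000 in
set_option maxHeartbeats 1000000 in
theorem casimir_raise31 (a b c : ℂ) (hs : a + b + c = 0) (f : R α) :
    casimir (a - 1) b (c + 1) (raise31 a c f) = raise31 a c (casimir a b c f) := by
  obtain rfl : c = -a - b := by linear_combination hs
  simp only [casimir, casimir₁, casimir₂, raise21, raise12, raise13, raise31, raise23, raise32,
    map_sub, map_add, map_mul, map_neg, map_pow, map_zero,
    map_ofNat, sh_sh, sh_h0, sh_h1, sh_h2, algHom_cst, map_one,
    Int.reduceAdd, Int.reduceNeg, sh_zero, cst_add, cst_sub, cst_mul, cst_pow, cst_one, cst_neg,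
    cst_two, Int.cast_neg, Int.cast_one, Int.cast_zero]
  rw [h_zero' α]
  ring

set_option maxRecDepth 4000 in
set_option maxHeartbeats 1000000 in
theorem casimir_raise32 (a b c : ℂ) (hs : a + b + c = 0) (f : R α) :
    casimir a (b - 1) (c + 1) (raise32 c f) = raise32 c (casimir a b c f) := by
  obtain rfl : c = -a - b := by linear_combination hs
  simp only [casimir, casimir₁, casimir₂, raise21, raise12, raise13, raise31, raise23, raise32,
    map_sub, map_add, map_mul, map_neg, map_pow, map_zero,
    map_ofNat, sh_sh, sh_h0, sh_h1, sh_h2, algHom_cst, map_one,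
    Int.reduceAdd, Int.reduceNeg, sh_zero, cst_add, cst_sub, cst_mul, cst_pow, cst_one, cst_neg,
    cst_two, Int.cast_neg, Int.cast_one, Int.cast_zero]
  rw [h_zero' α]
  ring

/-- For `a ≥ 0 ≥ b, c` the vector `u_ν` comes from the highest vector `E₁₃^a` by the action of
`E₃₂`, up to a scalar, and `a(a + 2)` is the Casimir eigenvalue for the highest weight `a(ε₁ - ε₃)`.
-/
theorem casimir_one (a b c : ℂ) (hs : a + b + c = 0) :
    casimir a b c (1 : R α) = cst α (a * (a + 2)) := by
  obtain rfl : c = -a - b := by linear_combination hs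
  simp only [casimir, casimir₁, casimir₂, raise21, raise12, raise13, raise31, raise23, raise32,
    map_sub, map_add, map_mul, map_neg, map_pow, map_zero, map_ofNat, sh_h0, sh_h1, sh_h2, algHom_cst, map_one,
    cst_add, cst_sub, cst_mul, cst_pow, cst_one, cst_neg,
    cst_two, Int.cast_neg, Int.cast_one, Int.cast_zero]
  rw [h_zero' α]
  ring

/-- This is `[E₁₂, E₂₁] = E₁₁ - E₂₂`, which acts on the weight by `a - b`. -/
theorem raise12_raise21 (a b : ℂ) (f : R α) :
    raise12 (raise21 a b f) = casimir₁ a b f + cst α (a - b) * f := by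
  simp only [casimir₁, raise21, raise12, map_sub, map_add, map_mul, map_neg, map_pow, map_zero,
    map_ofNat, sh_sh, sh_h0, sh_h1, sh_h2,
    algHom_cst, map_one, Int.reduceAdd, Int.reduceNeg, sh_zero, cst_add, cst_sub, cst_one,
    Int.cast_neg, Int.cast_one, Int.cast_zero]
  ring

theorem raise21_cst_mul (a b e : ℂ) (f : R α) :
    raise21 a b (cst α e * f) = cst α e * raise21 a b f := by
  simp only [raise21, map_mul, algHom_cst]; ring

theorem raise31_cst_mul (a c e : ℂ) (f : R α) :
    raise31 a c (cst α e * f) = cst α e * raise31 a c f := by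
  simp only [raise31, map_mul, algHom_cst]; ring

theorem raise32_cst_mul (c e : ℂ) (f : R α) :
    raise32 c (cst α e * f) = cst α e * raise32 c f := by
  simp only [raise32, map_mul, algHom_cst]; ring

theorem casimir_add (a b c : ℂ) (f g : R α) :
    casimir a b c (f + g) = casimir a b c f + casimir a b c g := by
  simp only [casimir, casimir₁, casimir₂, raise21, raise12, raise13, raise31, raise23, raise32,
    map_add, map_sub, map_mul]; ring

theorem casimir_cst_mul (a b c e : ℂ) (f : R α) :
    casimir a b c (cst α e * f) = cst α e * casimir a b c f := by
  simp only [casimir, casimir₁, casimir₂, raise21, raise12, raise13, raise31, raise23, raise32,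
    map_add, map_sub, map_mul, algHom_cst]; ring

theorem casimir_lower31 (a b c : ℂ) (hs : a + b + c = 0) (f : R α) :
    casimir (a - 1) b (c + 1) (lower31 a b c f) = lower31 a b c (casimir a b c f) := by
  rw [lower31, casimir_add, casimir_cst_mul, casimir_raise31 a b c hs]
  have h1 := casimir_raise21 (α := α) a (b - 1) (c + 1) (by linear_combination hs) (raise32 c f)
  rw [sub_add_cancel] at h1
  rw [h1, casimir_raise32 a b c hs, lower31]

/-! ### The polynomials -/

/-- The polynomial `f_{l,k}^ν`, `ν = a ε₁ + b ε₂ + c ε₃`. -/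
def hahn (α : ℂ) : ℕ → ℕ → ℂ → ℂ → ℂ → R α
  | 0, 0, _, _, _ => 1
  | 0, k + 1, a, b, c => lower31 (a + 1) b (c - 1) (hahn α 0 k (a + 1) b (c - 1))
  | l + 1, k, a, b, c => raise21 (a + 1) (b - 1) (hahn α l k (a + 1) (b - 1) c)

theorem lower31_cst_mul (a b c e : ℂ) (f : R α) :
    lower31 a b c (cst α e * f) = cst α e * lower31 a b c f := by
  rw [lower31, raise31_cst_mul, raise32_cst_mul, raise21_cst_mul, lower31]; ring

theorem casimir_hahn (l k : ℕ) (a b c : ℂ) (hs : a + b + c = 0) :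
    casimir a b c (hahn α l k a b c) = cst α ((a + k + l) * (a + k + l + 2)) * hahn α l k a b c := by
  induction l generalizing a b c with
  | zero =>
    induction k generalizing a b c with
    | zero => simp only [hahn, casimir_one a b c hs]; simp
    | succ k ih =>
      have h1 := casimir_lower31 (a + 1) b (c - 1) (by linear_combination hs)
        (hahn α 0 k (a + 1) b (c - 1))
      rw [add_sub_cancel_right, sub_add_cancel, ih _ _ _ (by linear_combination hs),
        lower31_cst_mul] at h1
      rw [hahn, h1]
      congr 2
      push_cast; ring
  | succ l ih =>
    have h1 := casimir_raise21 (a + 1) (b - 1) c (by linear_combination hs)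
      (hahn α l k (a + 1) (b - 1) c)
    rw [add_sub_cancel_right, sub_add_cancel, ih _ _ _ (by linear_combination hs),
      raise21_cst_mul] at h1
    rw [hahn, h1]
    congr 2
    push_cast; ring

/-! ### The highest vectors `f_{0,k}` and nonvanishing -/

/-- The polynomial in `E₃₃` that equals `f_{0,k}^ν`. -/
def hahnPoly (α : ℂ) : ℕ → ℂ → ℂ → ℂ → Polynomial ℂ
  | 0, _, _, _ => 1
  | k + 1, a, b, c =>
    Polynomial.C (a + 1) *
      ((hahnPoly α k (a + 1) b (c - 1)).comp (Polynomial.X - 1) *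
          (Polynomial.X * (Polynomial.C (α + 2 - b) - Polynomial.X)) -
        hahnPoly α k (a + 1) b (c - 1) *
          ((Polynomial.X - Polynomial.C (c - 1)) * (Polynomial.C (α - a) - Polynomial.X)))

/-- The lowering operator `z₃₁` preserves vectors killed by `E₁₂`. On coefficients, being killed by
`E₁₂` is invariance under translation of `E₂₂`, so `f_{0,k}` depends on `E₃₃` alone and obeys a
recursion in one variable. -/
theorem hahn_zero_eq (k : ℕ) (a b c : ℂ) (hs : a + b + c = 0) :
    hahn α 0 k a b c = Polynomial.aeval (h α 2) (hahnPoly α k a b c) := by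
  induction k generalizing a b c with
  | zero => simp [hahn, hahnPoly]
  | succ k ih =>
    rw [hahn, ih _ _ _ (by linear_combination hs), hahnPoly]
    set P := hahnPoly α k (a + 1) b (c - 1)
    have e : ∀ s t : ℤ, sh α s t (Polynomial.aeval (h α 2) P) = Polynomial.aeval (h α 2 + t) P := by
      intro s t
      rw [← Polynomial.aeval_algHom_apply, sh_h2]
    have e0 : ∀ s : ℤ, sh α s 0 (Polynomial.aeval (h α 2) P) = Polynomial.aeval (h α 2) P := by
      intro s; rw [e]; simp
    have e1 : ∀ s : ℤ, sh α s (-1) (Polynomial.aeval (h α 2) P)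
        = Polynomial.aeval (h α 2) (P.comp (Polynomial.X - 1)) := by
      intro s; rw [e, Polynomial.aeval_comp]; simp [sub_eq_add_neg]
    have e2 : ∀ s : ℤ, sh α s 0 (Polynomial.aeval (h α 2) (P.comp (Polynomial.X - 1)))
        = Polynomial.aeval (h α 2) (P.comp (Polynomial.X - 1)) := by
      intro s; rw [← e1 0, sh_sh, zero_add, e1, e1]
    have hC : ∀ z : ℂ, algebraMap ℂ (R α) z = cst α z := fun _ => rfl
    obtain rfl : c = -a - b := by linear_combination hs
    simp only [map_mul, map_sub, map_add, map_neg, Polynomial.aeval_X, Polynomial.aeval_C, map_one, e2, lower31,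
      raise31, raise32, raise21, e0, e1, sh_h1, sh_h2, algHom_cst, hC, cst_sub, cst_add, cst_neg,
      cst_one, cst_two, Int.reduceAdd, Int.reduceNeg, Int.cast_neg, Int.cast_one, Int.cast_zero,
      add_zero]
    rw [h_zero' α]
    ring

theorem coeff_comp_X_sub_one {P : Polynomial ℂ} {d : ℕ} (hP : P.natDegree ≤ d + 1) :
    (P.comp (Polynomial.X - 1)).coeff (d + 1) = P.coeff (d + 1) ∧
      (P.comp (Polynomial.X - 1)).coeff d = P.coeff d - (d + 1) * P.coeff (d + 1) := by
  have hX : (Polynomial.X - 1 : Polynomial ℂ) = Polynomial.X + Polynomial.C (-1) := by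
    simp [sub_eq_add_neg]
  have hc : ∀ m, (P.comp (Polynomial.X - 1)).coeff m
      = ∑ i ∈ Finset.range (d + 2), P.coeff i * ((-1) ^ (i - m) * (i.choose m : ℂ)) := by
    intro m
    rw [Polynomial.comp, Polynomial.eval₂_eq_sum_range' _ (by omega : P.natDegree < d + 2),
      Polynomial.finsetSum_coeff, hX]
    simp only [Polynomial.coeff_C_mul, Polynomial.coeff_X_add_C_pow]
  constructor
  · rw [hc, Finset.sum_range_succ, Finset.sum_eq_zero]
    · simp
    · intro i hi
      rw [Nat.choose_eq_zero_of_lt (Finset.mem_range.mp hi)]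
      simp
  · rw [hc, Finset.sum_range_succ, Finset.sum_range_succ, Finset.sum_eq_zero]
    · simp; ring
    · intro i hi
      rw [Nat.choose_eq_zero_of_lt (Finset.mem_range.mp hi)]
      simp

theorem coeff_comp_X_sub_one_top {P : Polynomial ℂ} {d : ℕ} (hP : P.natDegree ≤ d) :
    (P.comp (Polynomial.X - 1)).coeff d = P.coeff d := by
  rcases d with _ | d
  · rw [Polynomial.eq_C_of_natDegree_le_zero hP]; simp
  · exact (coeff_comp_X_sub_one hP).1

/-- In the recursion the terms of degree `k + 2` cancel, since `P(X)` and `P(X - 1)` have the same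
leading term. The coefficient in degree `k + 1` is `(a + 1)(k + 2a + 3)` times that of `P` in degree
`k`, and this factor is nonzero because `a` is natural. -/
theorem hahnPoly_degree (α : ℂ) (k a : ℕ) (b c : ℂ) (hs : a + b + c = 0) :
    (hahnPoly α k a b c).natDegree ≤ k ∧ (hahnPoly α k a b c).coeff k ≠ 0 := by
  induction k generalizing a c with
  | zero => simp [hahnPoly]
  | succ k ih =>
    have ih' := ih (a + 1) (c - 1) (by push_cast; linear_combination hs)
    rw [Nat.cast_succ] at ih'
    rw [hahnPoly]
    set P := hahnPoly α k (a + 1) b (c - 1)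
    obtain ⟨hd, hk⟩ := ih'
    set D := P.comp (Polynomial.X - 1) with hD
    have hDd : D.natDegree ≤ k := by
      refine Polynomial.natDegree_comp_le.trans ?_
      have : (Polynomial.X - 1 : Polynomial ℂ).natDegree = 1 := by
        rw [← Polynomial.C_1]; exact Polynomial.natDegree_X_sub_C 1
      rw [this, mul_one]; exact hd
    have hDk : D.coeff k = P.coeff k := coeff_comp_X_sub_one_top hd
    -- Grouped by the explicit powers of `X`, so that `X ^ 2` multiplies `P - D`, which has no
    -- coefficient in degree `k` or above.
    have e : D * (Polynomial.X * (Polynomial.C (α + 2 - b) - Polynomial.X)) -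
        P * ((Polynomial.X - Polynomial.C (c - 1)) * (Polynomial.C (α - a) - Polynomial.X))
        = (P - D) * Polynomial.X ^ 2 + (Polynomial.C (α + 2 - b) * D
          - Polynomial.C (α - a + c - 1) * P) * Polynomial.X
          + Polynomial.C ((c - 1) * (α - a)) * P := by
      simp only [Polynomial.C_add, Polynomial.C_sub, Polynomial.C_mul]
      ring
    rw [e]
    have z : ∀ m, k < m → P.coeff m = 0 := fun m hm =>
      Polynomial.coeff_eq_zero_of_natDegree_lt (lt_of_le_of_lt hd hm)
    have z' : ∀ m, k < m → D.coeff m = 0 := fun m hm =>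
      Polynomial.coeff_eq_zero_of_natDegree_lt (lt_of_le_of_lt hDd hm)
    constructor
    · rw [Polynomial.natDegree_le_iff_coeff_eq_zero]
      intro N hN
      obtain ⟨m, rfl⟩ : ∃ m, N = m + 2 := ⟨N - 2, by omega⟩
      have : P.coeff m - D.coeff m = 0 := by
        rcases (by omega : k = m ∨ k < m) with rfl | hm
        · rw [hDk, sub_self]
        · rw [z m hm, z' m hm, sub_self]
      rw [Polynomial.coeff_C_mul, Polynomial.coeff_add, Polynomial.coeff_add,
        Polynomial.coeff_mul_X_pow, show m + 2 = m + 1 + 1 from rfl, Polynomial.coeff_mul_X,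
        Polynomial.coeff_sub, Polynomial.coeff_sub, Polynomial.coeff_C_mul, Polynomial.coeff_C_mul,
        Polynomial.coeff_C_mul, z (m + 1) (by omega), z' (m + 1) (by omega),
        z (m + 1 + 1) (by omega), this]
      simp
    · have main : (Polynomial.C ((a : ℂ) + 1) * ((P - D) * Polynomial.X ^ 2
          + (Polynomial.C (α + 2 - b) * D - Polynomial.C (α - a + c - 1) * P) * Polynomial.X
          + Polynomial.C ((c - 1) * (α - a)) * P)).coeff (k + 1)
          = (a + 1) * ((k + 2 * a + 3) * P.coeff k) := by
        rw [Polynomial.coeff_C_mul, Polynomial.coeff_add, Polynomial.coeff_add,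
          Polynomial.coeff_mul_X, Polynomial.coeff_C_mul, Polynomial.coeff_sub,
          Polynomial.coeff_C_mul, Polynomial.coeff_C_mul, z (k + 1) (by omega), hDk]
        rcases k with _ | d
        · rw [Polynomial.coeff_mul_X_pow', if_neg (by norm_num)]
          push_cast
          linear_combination (-(a + 1) * P.coeff 0) * hs
        · rw [Polynomial.coeff_mul_X_pow', if_pos (by omega), show d + 1 + 1 - 2 = d by omega,
            Polynomial.coeff_sub, (coeff_comp_X_sub_one hd).2]
          push_cast
          linear_combination (-(a + 1) * P.coeff (d + 1)) * hs
      rw [main]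
      have c1 : (a + 1 : ℂ) ≠ 0 := Nat.cast_add_one_ne_zero a
      have c2 : (k + 2 * a + 3 : ℂ) ≠ 0 := by exact_mod_cast (by omega : k + 2 * a + 3 ≠ 0)
      exact mul_ne_zero c1 (mul_ne_zero c2 hk)

theorem hahn_zero_ne_zero (α : ℂ) (k a : ℕ) (b c : ℂ) (hs : a + b + c = 0) :
    hahn α 0 k a b c ≠ 0 := by
  rw [hahn_zero_eq k _ b c hs]
  have hP : hahnPoly α k a b c ≠ 0 := by
    intro H
    exact (hahnPoly_degree α k a b c hs).2 (by rw [H, Polynomial.coeff_zero])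
  intro H
  apply hP
  refine Polynomial.funext fun y => ?_
  have := congrArg (ev α 0 y) H
  rw [← Polynomial.aeval_algHom_apply, ev_h2, map_zero] at this
  rw [Polynomial.eval_zero, ← this, Polynomial.coe_aeval_eq_eval]

theorem raise12_hahn_zero (k : ℕ) (a b c : ℂ) (hs : a + b + c = 0) :
    raise12 (hahn α 0 k a b c) = 0 := by
  rw [hahn_zero_eq k _ b c hs, raise12, ← Polynomial.aeval_algHom_apply, sh_h2]
  simp

theorem raise21_zero (a b : ℂ) : raise21 a b (0 : R α) = 0 := by simp [raise21]

/-- The `sl(2)` computation along the string below the highest vector `f_{0,k}`. The eigenvalue of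
`E₂₁E₁₂` at step `l` and the action of `E₁₂` at step `l + 1` imply each other through
`raise12_raise21`, so they are proved together. -/
theorem raise12_hahn_succ_and (l k : ℕ) (a b c : ℂ) (hs : a + b + c = 0) :
    casimir₁ a b (hahn α l k a b c) = cst α (l * (l + a - b + 1)) * hahn α l k a b c ∧
    raise12 (hahn α (l + 1) k a b c)
      = cst α ((l + 1) * (l + a - b + 2)) * hahn α l k (a + 1) (b - 1) c := by
  induction l generalizing a b c with
  | zero =>
    have h0 : casimir₁ a b (hahn α 0 k a b c) = 0 := by
      rw [casimir₁, raise12_hahn_zero k a b c hs, raise21_zero]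
    have h1 : casimir₁ (a + 1) (b - 1) (hahn α 0 k (a + 1) (b - 1) c) = 0 := by
      rw [casimir₁, raise12_hahn_zero k _ _ c (by linear_combination hs), raise21_zero]
    refine ⟨by rw [h0]; simp [cst_zero], ?_⟩
    rw [hahn, raise12_raise21, h1, zero_add]
    congr 2
    push_cast; ring
  | succ l ih =>
    obtain ⟨-, h2⟩ := ih a b c hs
    obtain ⟨-, h4⟩ := ih (a + 1) (b - 1) c (by linear_combination hs)
    have h5 : ∀ a b : ℂ, a + b + c = 0 →
        casimir₁ a b (hahn α (l + 1) k a b c)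
          = cst α (((l + 1 : ℕ) : ℂ) * ((l + 1 : ℕ) + a - b + 1)) * hahn α (l + 1) k a b c := by
      intro a b hs
      obtain ⟨-, h2⟩ := ih a b c hs
      rw [casimir₁, h2, raise21_cst_mul, hahn]
      congr 2
      push_cast; ring
    refine ⟨h5 a b hs, ?_⟩
    rw [hahn, raise12_raise21, h5 (a + 1) (b - 1) (by linear_combination hs), ← add_mul, ← cst_add]
    congr 2
    push_cast; ring

theorem casimir₁_hahn (l k : ℕ) (a b c : ℂ) (hs : a + b + c = 0) :
    casimir₁ a b (hahn α l k a b c) = cst α (l * (l + a - b + 1)) * hahn α l k a b c :=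
  (raise12_hahn_succ_and l k a b c hs).1

/-- The operator `casimir₂` is `casimir` minus `casimir₁` minus a constant, so its eigenvalue is the
corresponding difference. -/
theorem casimir₂_hahn (l k : ℕ) (a b c : ℂ) (hs : a + b + c = 0) :
    casimir₂ a b c (hahn α l k a b c)
      = cst α (k ^ 2 + 2 * k * l + 2 * k * (1 + a) + l * (1 + a + b) + 3 * a + 2 * b
        - b * (a + b)) * hahn α l k a b c := by
  have h1 := casimir_hahn (α := α) l k a b c hs
  rw [casimir, casimir₁_hahn l k a b c hs] at h1
  simp only [cst_add, cst_sub, cst_mul, cst_pow, cst_one, cst_two] at h1 ⊢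
  have h3 : cst α 3 = 3 := map_ofNat _ 3
  rw [h3]
  linear_combination h1

/-- If `f_{l+1,k}` vanished, so would its image under `E₁₂`, a multiple of `f_{l,k}` at a
neighbouring weight. The factor `(l + 1)(l + a + m + 2)` is nonzero because `a` and `m = -b` are
natural. -/
theorem hahn_ne_zero (l k a m : ℕ) (c : ℂ) (hs : (a : ℂ) + -m + c = 0) :
    hahn α l k a (-m) c ≠ 0 := by
  induction l generalizing a m with
  | zero => exact hahn_zero_ne_zero α k a (-m) c hs
  | succ l ih =>
    intro H
    have h1 := (raise12_hahn_succ_and (α := α) l k a (-m) c hs).2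
    rw [H, raise12, map_zero, sub_zero] at h1
    have h2 := ih (a + 1) (m + 1) (by push_cast; linear_combination hs)
    push_cast at h2
    rw [neg_add'] at h2
    refine mul_ne_zero (cst_ne_zero ?_) h2 h1.symm
    rw [sub_neg_eq_add]
    exact_mod_cast (by positivity : (l + 1) * (l + a + m + 2) ≠ 0)

/-! ### Degrees and completeness of the family -/

theorem h0_mul_mem {n : ℕ} {f : R α} (hf : f ∈ degLT α n) : h α 0 * f ∈ degLT α (n + 1) := by
  have e : h α 0 * f = cst α α * f - h α 1 * f - h α 2 * f := by
    rw [h_zero']; ring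
  rw [e]
  exact sub_mem (sub_mem (cst_mul_mem _ (degLT_mono (by omega) hf)) (h1_mul_mem hf)) (h2_mul_mem hf)

/-- The quadratic factors of the two terms have the same leading part, so it multiplies only `sh f -
f`, which has smaller degree. Hence the degree grows by one and not by two; for `raise32` it does
not grow. -/
theorem raise21_mem (a b : ℂ) {n : ℕ} {f : R α} (hf : f ∈ degLT α (n + 1)) :
    raise21 a b f ∈ degLT α (n + 2) := by
  have hd := sh_sub_mem (-1) 0 hf
  have e : raise21 a b f = h α 0 * (h α 1 * (sh α (-1) 0 f - f)) + h α 1 * (sh α (-1) 0 f - f)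
      + (cst α b * (h α 0 * f) + cst α a * (h α 1 * f) + cst α (b - a * b) * f) := by
    simp only [raise21, cst_sub, cst_mul]; ring
  rw [e]
  exact add_mem (add_mem (h0_mul_mem (h1_mul_mem hd)) (degLT_mono (by omega) (h1_mul_mem hd)))
    (add_mem (add_mem (cst_mul_mem _ (h0_mul_mem hf)) (cst_mul_mem _ (h1_mul_mem hf)))
      (cst_mul_mem _ (degLT_mono (by omega) hf)))

theorem raise31_mem (a c : ℂ) {n : ℕ} {f : R α} (hf : f ∈ degLT α (n + 1)) :
    raise31 a c f ∈ degLT α (n + 2) := by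
  have hd := sh_sub_mem 0 (-1) hf
  have e : raise31 a c f = h α 0 * (h α 2 * (sh α 0 (-1) f - f)) + h α 2 * (sh α 0 (-1) f - f)
      + (cst α c * (h α 0 * f) + cst α a * (h α 2 * f) + cst α (c - a * c) * f) := by
    simp only [raise31, cst_sub, cst_mul]; ring
  rw [e]
  exact add_mem (add_mem (h0_mul_mem (h2_mul_mem hd)) (degLT_mono (by omega) (h2_mul_mem hd)))
    (add_mem (add_mem (cst_mul_mem _ (h0_mul_mem hf)) (cst_mul_mem _ (h2_mul_mem hf)))
      (cst_mul_mem _ (degLT_mono (by omega) hf)))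

theorem raise32_mem (c : ℂ) {n : ℕ} {f : R α} (hf : f ∈ degLT α (n + 1)) :
    raise32 c f ∈ degLT α (n + 1) := by
  have e : raise32 c f = h α 2 * (sh α 1 (-1) f - f) + cst α c * f := by
    simp only [raise32]; ring
  rw [e]
  exact add_mem (h2_mul_mem (sh_sub_mem 1 (-1) hf)) (cst_mul_mem _ hf)

theorem hahn_mem (l k : ℕ) (a b c : ℂ) : hahn α l k a b c ∈ degLT α (l + k + 1) := by
  induction l generalizing a b c with
  | zero =>
    induction k generalizing a b c with
    | zero => rw [hahn]; exact one_mem_degLT α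
    | succ k ih =>
      have h1 := ih (a + 1) b (c - 1)
      rw [hahn]
      exact add_mem (cst_mul_mem _ (raise31_mem _ _ h1)) (raise21_mem _ _ (raise32_mem _ h1))
  | succ l ih =>
    rw [hahn, show l + 1 + k + 1 = l + k + 2 by ring]
    exact raise21_mem _ _ (ih _ _ _)

/-- `casimir₁` as a linear map. -/
def casimir₁Lin (α a b : ℂ) : Module.End ℂ (R α) where
  toFun := casimir₁ a b
  map_add' f g := by simp only [casimir₁, raise12, raise21, map_add, map_sub]; ring
  map_smul' e f := by
    simp only [smul_eq_cst, casimir₁, raise12, raise21, map_add, map_sub, map_mul, algHom_cst,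
      RingHom.id_apply]; ring

/-- `casimir` as a linear map. -/
def casimirLin (α a b c : ℂ) : Module.End ℂ (R α) where
  toFun := casimir a b c
  map_add' := casimir_add a b c
  map_smul' e f := by simp only [smul_eq_cst, casimir_cst_mul, RingHom.id_apply]

/-- The eigenvalue `l(l + a + m + 1)` is strictly increasing in `l` and determines it; then `(a + k
+ l)(a + k + l + 2)` determines `k`. -/
theorem hahn_linearIndependent (α : ℂ) (a m : ℕ) (c : ℂ) (hs : (a : ℂ) + -m + c = 0) :
    LinearIndependent ℂ fun p : ℕ × ℕ => hahn α p.1 p.2 a (-m) c := by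
  refine linearIndependent_of_joint_eigen (casimir₁Lin α a (-m)) (casimirLin α a (-m) c) _
    (fun p => (p.1 * (p.1 + a + m + 1) : ℕ)) (fun p => ((a + p.2 + p.1) * (a + p.2 + p.1 + 2) : ℕ))
    (fun p => ?_) (fun p => ?_) ?_ fun p => hahn_ne_zero _ _ _ _ _ hs
  · rw [smul_eq_cst]
    refine (casimir₁_hahn p.1 p.2 a (-m) c hs).trans ?_
    congr 2
    push_cast; ring
  · rw [smul_eq_cst]
    refine (casimir_hahn p.1 p.2 a (-m) c hs).trans ?_
    congr 2
    push_cast; ring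
  · rintro ⟨l, k⟩ ⟨l', k'⟩ h1 h2
    simp only [Nat.cast_inj] at h1 h2
    have hl : l = l' := by
      rcases lt_trichotomy l l' with hlt | he | hlt
      · nlinarith
      · exact he
      · nlinarith
    subst hl
    have hk : k = k' := by
      rcases lt_trichotomy k k' with hlt | he | hlt
      · nlinarith
      · exact he
      · nlinarith
    rw [hk]

theorem hahn_span (α : ℂ) (a m : ℕ) (c : ℂ) (hs : (a : ℂ) + -m + c = 0) :
    Submodule.span ℂ (Set.range fun p : ℕ × ℕ => hahn α p.1 p.2 a (-m) c) = ⊤ :=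
  span_eq_top_of_degree (hahn_linearIndependent α a m c hs) fun _ => hahn_mem _ _ _ _ _

/-! ### Difference equations -/

/-- Since `H₁ - H₂ + α = 2E₁₁` and `α - H₁ - H₂ = 2E₂₂`, the equation is the eigenvalue equation of
`casimir₁` in the coordinates `H₁`, `H₂`. -/
theorem diffEq₁_of_casimir₁ {ν : Fin 3 → ℤ} {l : ℕ} {f : R α}
    (hf : casimir₁ (ν 0) (ν 1) f = cst α (l * (l + ν 0 - ν 1 + 1)) * f) : DiffEq₁ α ν l f := by
  -- The constant `1/4` becomes an atom `q` with `q * 4 = 1`, since `R` is only a commutative ring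
  -- for `linear_combination`.
  have h4 : cst α (1 / 4) * 4 = 1 := by
    have : cst α (1 / 4) * cst α 4 = cst α 1 := by rw [← cst_mul]; norm_num
    rwa [cst_one, show cst α 4 = 4 from map_ofNat _ 4] at this
  simp only [DiffEq₁]
  generalize cst α (1 / 4) = q at h4 ⊢
  simp only [casimir₁, raise21, raise12, map_sub, sh_sh, Int.reduceAdd, Int.reduceNeg, sh_zero,
    cst_add, cst_mul, cst_sub, cst_one] at hf
  simp only [shift_01, shift_10, H₁, H₂, cst_add, cst_mul, cst_sub, cst_one, cst_two, cst_pow]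
  rw [h_zero'] at hf ⊢
  linear_combination hf + ((f - sh α (-1) 0 f) * ((cst α α - h α 1 - h α 2 + 1) * h α 1) -
    (sh α 1 0 f - f) * ((cst α α - h α 1 - h α 2 - cst α (ν 0)) * (h α 1 - cst α (ν 1) + 1))) * h4

theorem diffEq₂_of_casimir₂ {ν : Fin 3 → ℤ} (hν : ν ∈ Q) {l k : ℕ} {f : R α}
    (hf : casimir₂ (ν 0) (ν 1) (ν 2) f
      = cst α (k ^ 2 + 2 * k * l + 2 * k * (1 + ν 0) + l * (1 + ν 0 + ν 1) + 3 * ν 0 + 2 * ν 1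
        - ν 1 * (ν 0 + ν 1)) * f) : DiffEq₂ α ν l k f := by
  have h2 : cst α (1 / 2) * 2 = 1 := by
    have : cst α (1 / 2) * cst α 2 = cst α 1 := by rw [← cst_mul]; norm_num
    rwa [cst_one, cst_two] at this
  have hc : (ν 2 : ℂ) = -ν 0 - ν 1 := by
    have : ν 0 + ν 1 + ν 2 = 0 := hν
    have h3 : ((ν 0 + ν 1 + ν 2 : ℤ) : ℂ) = 0 := by rw [this]; simp
    push_cast at h3
    linear_combination h3
  simp only [DiffEq₂]
  generalize cst α (1 / 2) = q at h2 ⊢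
  rw [← hf, hc]
  simp only [casimir₂, raise31, raise13, raise23, raise32, map_sub, map_mul, map_add, map_one,
    map_neg, sh_h0, sh_h1, sh_h2, sh_sh, Int.reduceAdd, Int.reduceNeg, sh_zero, algHom_cst,
    shift_20, shift_02, shift_21, shift_12, H₁, H₂,
    cst_add, cst_mul, cst_sub, cst_one, cst_two, cst_pow, cst_neg, Int.cast_neg, Int.cast_one,
    Int.cast_zero]
  rw [h_zero']
  set z := cst α α - h α 1 - h α 2
  linear_combination (-(h α 2 + (1 + cst α (ν 0) + cst α (ν 1))) * (z - cst α (ν 0)) * sh α 0 1 f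
    - h α 2 * (z + 1) * sh α 0 (-1) f
    - (h α 2 + (1 + cst α (ν 0) + cst α (ν 1))) * h α 1 * sh α (-1) 1 f
    - h α 2 * (h α 1 + 1 - cst α (ν 1)) * sh α 1 (-1) f) * h2

/-! ### Orthogonality -/

/-- The rising factorial `(E_{ii} + 1) ⋯ (E_{ii} + m)`. -/
def rise (α : ℂ) (i : Fin 3) (m : ℕ) : R α := ∏ r ∈ Finset.range m, (h α i + 1 + r)

/-- The element `r_i^n r_i^{-n}` of `R`. -/
def weight (α : ℂ) (i : Fin 3) (n : ℤ) : R α :=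
  if 0 ≤ n then fall α i n.toNat else rise α i (-n).toNat

theorem weight_natCast (i : Fin 3) (n : ℕ) : weight α i n = fall α i n := by simp [weight]

theorem weight_neg_natCast (i : Fin 3) (n : ℕ) : weight α i (-n) = rise α i n := by
  rcases n with _ | n
  · simp [weight, fall, rise]
  · rw [weight, if_neg (by omega)]; simp

theorem map_fall {β : ℂ} (φ : R α →ₐ[ℂ] R β) (i : Fin 3) (n : ℕ) :
    φ (fall α i n) = ∏ r ∈ Finset.range n, (φ (h α i) - r) := by
  simp [fall, map_prod]

theorem map_rise {β : ℂ} (φ : R α →ₐ[ℂ] R β) (i : Fin 3) (n : ℕ) :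
    φ (rise α i n) = ∏ r ∈ Finset.range n, (φ (h α i) + 1 + r) := by
  simp [rise, map_prod]

theorem prod_fall_succ {B : Type*} [CommRing B] (x : B) (n : ℕ) :
    (∏ r ∈ Finset.range n, (x - r)) * (x - n) = x * ∏ r ∈ Finset.range n, (x - 1 - r) := by
  rw [← Finset.prod_range_succ (fun r : ℕ => x - r), Finset.prod_range_succ']
  rw [mul_comm]
  simp [sub_sub, add_comm]

theorem prod_rise_succ {B : Type*} [CommRing B] (x : B) (n : ℕ) :
    (∏ r ∈ Finset.range n, (x + 1 + r)) * (x + 1 + n)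
      = (x + 1) * ∏ r ∈ Finset.range n, (x + 1 + 1 + r) := by
  rw [← Finset.prod_range_succ (fun r : ℕ => x + 1 + r), Finset.prod_range_succ', mul_comm (x + 1)]
  congr 1
  · refine Finset.prod_congr rfl fun r _ => ?_
    push_cast; ring
  · simp

/-- The weight for which the `f_{l,k}^ν` are orthogonal, `ν = a ε₁ - m ε₂ - q ε₃`. -/
def regionWeight (α : ℂ) (a m q : ℕ) : R α := fall α 0 a * rise α 1 m * rise α 2 q

/-- A discrete Pearson equation. It says that the weight and its translate have a rational quotient
made of exactly the factors that occur in `casimir₁`. -/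
theorem regionWeight_01 (a m q : ℕ) :
    regionWeight α a m q * ((h α 0 - a) * (h α 1 + 1 + m))
      = sh α 1 0 (regionWeight α a m q) * (h α 0 * (h α 1 + 1)) := by
  have e1 := prod_fall_succ (h α 0) a
  have e2 := prod_rise_succ (h α 1) m
  simp only [regionWeight, map_mul, map_fall, map_rise, sh_h0, sh_h1, sh_h2,
    Int.cast_one, Int.cast_zero, sub_zero, add_zero]
  simp only [fall, rise]
  linear_combination (∏ r ∈ Finset.range m, (h α 1 + 1 + (r : R α))) * (h α 1 + 1 + m) *
    (∏ r ∈ Finset.range q, (h α 2 + 1 + (r : R α))) * e1 +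
    h α 0 * (∏ r ∈ Finset.range a, (h α 0 - 1 - (r : R α))) *
    (∏ r ∈ Finset.range q, (h α 2 + 1 + (r : R α))) * e2

theorem regionWeight_02 (a m q : ℕ) :
    regionWeight α a m q * ((h α 0 - a) * (h α 2 + 1 + q))
      = sh α 0 1 (regionWeight α a m q) * (h α 0 * (h α 2 + 1)) := by
  have e1 := prod_fall_succ (h α 0) a
  have e2 := prod_rise_succ (h α 2) q
  simp only [regionWeight, map_mul, map_fall, map_rise, sh_h0, sh_h1, sh_h2,
    Int.cast_one, Int.cast_zero, sub_zero, add_zero]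
  simp only [fall, rise]
  linear_combination (∏ r ∈ Finset.range q, (h α 2 + 1 + (r : R α))) * (h α 2 + 1 + q) *
    (∏ r ∈ Finset.range m, (h α 1 + 1 + (r : R α))) * e1 +
    h α 0 * (∏ r ∈ Finset.range a, (h α 0 - 1 - (r : R α))) *
    (∏ r ∈ Finset.range m, (h α 1 + 1 + (r : R α))) * e2

/-- Along this root both rising factorials move. The intermediate `V`, in which only the one of
`E₂₂` has moved, is comparable both with the weight and, after translation, with the weight again.
-/
theorem regionWeight_12 (a m q : ℕ) : ∃ V : R α,
    regionWeight α a m q * (h α 1 + 1 + m) = V * (h α 1 + 1) ∧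
    regionWeight α a m q * (h α 2 + 1 + q) = sh α (-1) 1 V * (h α 2 + 1) := by
  have e1 := prod_rise_succ (h α 1) m
  have e2 := prod_rise_succ (h α 2) q
  refine ⟨fall α 0 a * sh α 1 0 (rise α 1 m) * rise α 2 q, ?_, ?_⟩
  · simp only [regionWeight, map_mul, map_fall, map_rise, sh_h0, sh_h1, sh_h2,
      Int.cast_one, Int.cast_zero, sub_zero, add_zero]
    simp only [fall, rise]
    linear_combination (∏ r ∈ Finset.range a, (h α 0 - (r : R α))) *
      (∏ r ∈ Finset.range q, (h α 2 + 1 + (r : R α))) * e1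
  · simp only [regionWeight, map_mul, sh_sh, Int.reduceAdd, Int.reduceNeg]
    simp only [map_fall, map_rise, sh_h0, sh_h1, sh_h2,
      Int.cast_one, Int.cast_zero, Int.cast_neg, sub_zero, add_zero, sub_neg_eq_add,
      add_sub_cancel_right]
    simp only [fall, rise]
    linear_combination (∏ r ∈ Finset.range a, (h α 0 - (r : R α))) *
      (∏ r ∈ Finset.range m, (h α 1 + 1 + (r : R α))) * e2

/-- Summation by parts: shift invariance moves the translation from `f` to `g` and to the weight,
and the Pearson equation removes it from the weight. -/
theorem shift_adjoint_01 {Λ : R α →ₗ[ℂ] ℂ} (hΛ : IsShiftInvariant Λ) (a m q : ℕ)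
    (f g : R α) :
    Λ (sh α (-1) 0 f * g * ((h α 0 + 1) * h α 1) * regionWeight α a m q)
      = Λ (f * sh α 1 0 g * ((h α 0 - a) * (h α 1 + 1 + m)) * regionWeight α a m q) := by
  have h1 := hΛ 0 1 (by decide) (f * sh α 1 0 g * sh α 1 0 (regionWeight α a m q))
  rw [shift_01] at h1
  calc _ = Λ (sh α (-1) 0 (f * sh α 1 0 g * sh α 1 0 (regionWeight α a m q)
        * (h α 0 * (h α 1 + 1)))) := by
        congr 1
        simp only [map_mul, sh_sh, Int.reduceAdd, Int.reduceNeg, sh_zero, map_add, map_one, sh_h0,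
          sh_h1, Int.cast_neg, Int.cast_one, Int.cast_zero]
        ring
    _ = _ := by
      rw [h1]
      congr 1
      linear_combination (-f * sh α 1 0 g) * regionWeight_01 (α := α) a m q

theorem shift_adjoint_02 {Λ : R α →ₗ[ℂ] ℂ} (hΛ : IsShiftInvariant Λ) (a m q : ℕ)
    (f g : R α) :
    Λ (sh α 0 (-1) f * g * ((h α 0 + 1) * h α 2) * regionWeight α a m q)
      = Λ (f * sh α 0 1 g * ((h α 0 - a) * (h α 2 + 1 + q)) * regionWeight α a m q) := by
  have h1 := hΛ 0 2 (by decide) (f * sh α 0 1 g * sh α 0 1 (regionWeight α a m q))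
  rw [shift_02] at h1
  calc _ = Λ (sh α 0 (-1) (f * sh α 0 1 g * sh α 0 1 (regionWeight α a m q)
        * (h α 0 * (h α 2 + 1)))) := by
        congr 1
        simp only [map_mul, sh_sh, Int.reduceAdd, Int.reduceNeg, sh_zero, map_add, map_one, sh_h0,
          sh_h2, Int.cast_neg, Int.cast_one, Int.cast_zero]
        ring
    _ = _ := by
      rw [h1]
      congr 1
      linear_combination (-f * sh α 0 1 g) * regionWeight_02 (α := α) a m q

theorem shift_adjoint_12 {Λ : R α →ₗ[ℂ] ℂ} (hΛ : IsShiftInvariant Λ) (a m q : ℕ)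
    (f g : R α) :
    Λ (sh α 1 (-1) f * g * (h α 2 * (h α 1 + 1 + m)) * regionWeight α a m q)
      = Λ (f * sh α (-1) 1 g * ((h α 2 + 1 + q) * h α 1) * regionWeight α a m q) := by
  obtain ⟨V, hV1, hV2⟩ := regionWeight_12 (α := α) a m q
  have h1 := hΛ 2 1 (by decide) (sh α 1 (-1) f * g * V)
  rw [shift_21] at h1
  calc _ = Λ (sh α 1 (-1) f * g * V * (h α 2 * (h α 1 + 1))) := by
        congr 1
        linear_combination (sh α 1 (-1) f * g * h α 2) * hV1
    _ = _ := by
      rw [← h1]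
      congr 1
      simp only [map_mul, sh_sh, Int.reduceAdd, Int.reduceNeg, sh_zero, map_add, map_one, sh_h2,
          sh_h1, Int.cast_neg, Int.cast_one, Int.cast_zero]
      linear_combination (-f * sh α (-1) 1 g * h α 1) * hV2

/-- Besides multiplications, `casimir₁` consists of a translation term and its inverse translation
term, which are adjoint to each other by `shift_adjoint_01`. -/
theorem casimir₁_symm {Λ : R α →ₗ[ℂ] ℂ} (hΛ : IsShiftInvariant Λ) (a m q : ℕ) (f g : R α) :
    Λ (casimir₁ a (-m) f * g * regionWeight α a m q)
      = Λ (f * casimir₁ a (-m) g * regionWeight α a m q) := by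
  have h1 := shift_adjoint_01 hΛ a m q f g
  have h2 := shift_adjoint_01 hΛ a m q g f
  rw [← sub_eq_zero, ← map_sub] at h1 h2 ⊢
  rw [← neg_eq_zero, ← map_neg] at h1
  rw [← add_zero (0 : ℂ)]
  nth_rewrite 1 [← h1]
  rw [← h2, ← map_add]
  congr 1
  simp only [casimir₁, raise21, raise12, map_sub, sh_sh, Int.reduceAdd, Int.reduceNeg, sh_zero,
    cst_add, cst_sub, cst_neg, cst_one, cst_natCast]
  ring

theorem casimir₂_symm {Λ : R α →ₗ[ℂ] ℂ} (hΛ : IsShiftInvariant Λ) (a m q : ℕ) (f g : R α) :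
    Λ (casimir₂ a (-m) (-q) f * g * regionWeight α a m q)
      = Λ (f * casimir₂ a (-m) (-q) g * regionWeight α a m q) := by
  have h1 := shift_adjoint_02 hΛ a m q f g
  have h2 := shift_adjoint_02 hΛ a m q g f
  have h3 := shift_adjoint_12 hΛ a m q f g
  have h4 := shift_adjoint_12 hΛ a m q g f
  rw [← sub_eq_zero] at h1 h2 h3 h4 ⊢
  have key : casimir₂ a (-m) (-q) f * g * regionWeight α a m q
      - f * casimir₂ a (-m) (-q) g * regionWeight α a m q
      = -(sh α 0 (-1) f * g * ((h α 0 + 1) * h α 2) * regionWeight α a m q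
          - f * sh α 0 1 g * ((h α 0 - a) * (h α 2 + 1 + q)) * regionWeight α a m q)
        + (sh α 0 (-1) g * f * ((h α 0 + 1) * h α 2) * regionWeight α a m q
          - g * sh α 0 1 f * ((h α 0 - a) * (h α 2 + 1 + q)) * regionWeight α a m q)
        - (sh α 1 (-1) f * g * (h α 2 * (h α 1 + 1 + m)) * regionWeight α a m q
          - f * sh α (-1) 1 g * ((h α 2 + 1 + q) * h α 1) * regionWeight α a m q)
        + (sh α 1 (-1) g * f * (h α 2 * (h α 1 + 1 + m)) * regionWeight α a m q
          - g * sh α (-1) 1 f * ((h α 2 + 1 + q) * h α 1) * regionWeight α a m q) := by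
    simp only [casimir₂, raise31, raise13, raise23, raise32, map_sub, map_mul, map_add, map_one,
      map_neg, sh_h0, sh_h1, sh_h2, sh_sh, Int.reduceAdd, Int.reduceNeg, sh_zero, algHom_cst,
      cst_add, cst_sub, cst_neg, cst_one, cst_natCast, map_natCast, Int.cast_neg, Int.cast_one,
      Int.cast_zero]
    ring
  rw [← map_sub] at h1 h2 h3 h4 ⊢
  rw [key, map_add, map_sub, map_add, map_neg, h1, h2, h3, h4]
  simp

theorem casimir_symm {Λ : R α →ₗ[ℂ] ℂ} (hΛ : IsShiftInvariant Λ) (a m q : ℕ) (f g : R α) :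
    Λ (casimir a (-m) (-q) f * g * regionWeight α a m q)
      = Λ (f * casimir a (-m) (-q) g * regionWeight α a m q) := by
  have h1 := casimir₁_symm hΛ a m q f g
  have h2 := casimir₂_symm hΛ a m q f g
  simp only [casimir, add_mul, mul_add, map_add, h1, h2]
  congr 2
  ring

/-- Eigenvectors of a symmetric operator with distinct eigenvalues are orthogonal. -/
theorem eigen_orthogonal {Λ : R α →ₗ[ℂ] ℂ} {T : R α → R α} {W f g : R α} {e e' : ℂ}
    (hT : Λ (T f * g * W) = Λ (f * T g * W)) (hf : T f = cst α e * f) (hg : T g = cst α e' * g)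
    (he : e ≠ e') : Λ (f * g * W) = 0 := by
  rw [hf, hg, show cst α e * f * g * W = e • (f * g * W) by rw [smul_eq_cst]; ring,
    show f * (cst α e' * g) * W = e' • (f * g * W) by rw [smul_eq_cst]; ring, map_smul, map_smul,
    smul_eq_mul, smul_eq_mul, ← sub_eq_zero, ← sub_mul] at hT
  exact (mul_eq_zero.mp hT).resolve_left (sub_ne_zero.mpr he)

/-- Members with different `l` are separated by `casimir₁`, those with equal `l` and different `k`
by `casimir`. -/
theorem hahn_orthogonal {Λ : R α →ₗ[ℂ] ℂ} (hΛ : IsShiftInvariant Λ) (a m q : ℕ) (hs : a = m + q)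
    {p p' : ℕ × ℕ} (hp : p ≠ p') :
    Λ (hahn α p.1 p.2 a (-m) (-q) * hahn α p'.1 p'.2 a (-m) (-q) * regionWeight α a m q) = 0 := by
  have hs' : (a : ℂ) + -m + -q = 0 := by rw [hs]; push_cast; ring
  obtain ⟨l, k⟩ := p
  obtain ⟨l', k'⟩ := p'
  by_cases hl : l = l'
  · subst hl
    have hk : k ≠ k' := fun hk => hp (by rw [hk])
    refine eigen_orthogonal (casimir_symm hΛ a m q _ _) (casimir_hahn _ _ _ _ _ hs')
      (casimir_hahn _ _ _ _ _ hs') ?_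
    intro H
    have H2 : (a + k + l) * (a + k + l + 2) = (a + k' + l) * (a + k' + l + 2) := by exact_mod_cast H
    rcases lt_or_gt_of_ne hk with hlt | hlt <;> nlinarith
  · refine eigen_orthogonal (casimir₁_symm hΛ a m q _ _) (casimir₁_hahn _ _ _ _ _ hs')
      (casimir₁_hahn _ _ _ _ _ hs') ?_
    intro H
    simp only [sub_neg_eq_add] at H
    have H2 : l * (l + a + m + 1) = l' * (l' + a + m + 1) := by exact_mod_cast H
    rcases lt_or_gt_of_ne hl with hlt | hlt <;> nlinarith

/-! ### The symmetry exchanging the two families -/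

/-- The isomorphism `E_{11} ↦ -1 - E_{22}`, `E_{22} ↦ -1 - E_{11}`, `E_{33} ↦ -1 - E_{33}`. -/
def dual (α : ℂ) : R (-3 - α) →ₐ[ℂ] R α :=
  liftR ![-1 - h α 1, -1 - h α 0, -1 - h α 2] (by
    simp only [Matrix.cons_val, map_sub, map_neg, ← h_sum, map_ofNat]; ring)

@[simp] theorem dual_h0 (α : ℂ) : dual α (h _ 0) = -1 - h α 1 := liftR_h _ _ 0
@[simp] theorem dual_h1 (α : ℂ) : dual α (h _ 1) = -1 - h α 0 := liftR_h _ _ 1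
@[simp] theorem dual_h2 (α : ℂ) : dual α (h _ 2) = -1 - h α 2 := liftR_h _ _ 2

theorem dual_bijective (α : ℂ) : Function.Bijective (dual α) := by
  let ψ : R α →ₐ[ℂ] R (-3 - α) := liftR ![-1 - h _ 1, -1 - h _ 0, -1 - h _ 2] (by
    have := h_sum (-3 - α)
    simp only [map_sub, map_neg, map_ofNat] at this
    simp only [Matrix.cons_val]; linear_combination -this)
  have p0 : ψ (h α 0) = -1 - h _ 1 := liftR_h _ _ 0
  have p1 : ψ (h α 1) = -1 - h _ 0 := liftR_h _ _ 1
  have p2 : ψ (h α 2) = -1 - h _ 2 := liftR_h _ _ 2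
  have e1 : ψ.comp (dual α) = AlgHom.id ℂ _ := by
    apply R_algHom_ext <;> simp [p0, p1, p2]
  have e2 : (dual α).comp ψ = AlgHom.id ℂ _ := by
    apply R_algHom_ext <;> simp [p0, p1, p2]
  exact ⟨Function.LeftInverse.injective (g := ψ) (AlgHom.congr_fun e1),
    Function.RightInverse.surjective (g := ψ) (AlgHom.congr_fun e2)⟩

theorem dual_sh (α : ℂ) (s t : ℤ) (f : R (-3 - α)) :
    dual α (sh _ s t f) = sh α (s + t) (-t) (dual α f) := by
  have : (dual α).comp (sh _ s t) = (sh α (s + t) (-t)).comp (dual α) := by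
    apply R_algHom_ext <;> simp <;> ring
  exact AlgHom.congr_fun this f

/-- By `(-1 - x)(-1 - y + 1) = y(x + 1)`, the products that occur in shift invariance go to products
of the same form, and root translations go to root translations. -/
theorem dual_shiftInvariant {Λ : R α →ₗ[ℂ] ℂ} (hΛ : IsShiftInvariant Λ) :
    IsShiftInvariant (Λ ∘ₗ (dual α).toLinearMap) := by
  refine shiftInvariant_of_pairs (fun f => ?_) (fun f => ?_) (fun f => ?_)
  · have h1 := hΛ 0 1 (by decide) (dual α f)
    simp only [LinearMap.comp_apply, AlgHom.toLinearMap_apply]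
    rw [shift_01] at h1 ⊢
    rw [dual_sh]
    convert h1 using 2 <;>
      simp only [map_mul, map_add, map_one, dual_h0, dual_h1, dual_h2, sh_h0, sh_h1, sh_h2, map_sub,
        map_neg, Int.reduceAdd, Int.reduceNeg, neg_zero, Int.cast_neg, Int.cast_one,
        Int.cast_zero] <;> ring
  · have h1 := hΛ 2 1 (by decide) (dual α f)
    simp only [LinearMap.comp_apply, AlgHom.toLinearMap_apply]
    rw [shift_21] at h1
    rw [shift_02, dual_sh]
    convert h1 using 2 <;>
      simp only [map_mul, map_add, map_one, dual_h0, dual_h1, dual_h2, sh_h0, sh_h1, sh_h2, map_sub,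
        map_neg, Int.reduceAdd, Int.reduceNeg, neg_zero, Int.cast_neg, Int.cast_one,
        Int.cast_zero] <;> ring
  · have h1 := hΛ 2 0 (by decide) (dual α f)
    simp only [LinearMap.comp_apply, AlgHom.toLinearMap_apply]
    rw [shift_20] at h1
    rw [shift_12, dual_sh]
    convert h1 using 2 <;>
      simp only [map_mul, map_add, map_one, dual_h0, dual_h1, dual_h2, sh_h0, sh_h1, sh_h2, map_sub,
        map_neg, Int.reduceAdd, Int.reduceNeg, neg_zero, Int.cast_neg, Int.cast_one,
        Int.cast_zero] <;> ring

/-- The coefficient of `[E₂₃, f u_ν]` for `ν(E₃₃) ≥ 1`. -/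
def raise23' (b c : ℂ) (f : R α) : R α :=
  sh α (-1) 1 f * (h α 1 * (h α 2 + 1)) - f * ((h α 1 - cst α b) * (h α 2 - cst α c + 1))

/-- The coefficient of `[E₁₃, f u_ν]` for `ν(E₃₃) ≥ 1`. -/
def raise13' (c : ℂ) (f : R α) : R α := sh α 0 1 f * (h α 2 + 1) - f * (h α 2 - cst α c + 1)

/-- The coefficient of `(ad z₂₃)(f u_ν)` for `ν(E₃₃) ≥ 1`. -/
def lower23 (a b c : ℂ) (f : R α) : R α :=
  cst α (a - b + 1) * raise23' b c f - raise21 (a + 1) b (raise13' c f)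

theorem dual_raise21 (a b : ℂ) (f : R (-3 - α)) :
    dual α (raise21 (-b) (-a) f) = raise21 a b (dual α f) := by
  simp only [raise21, map_sub, map_mul, map_add, map_neg, map_one, dual_sh, dual_h0, dual_h1, algHom_cst, cst_neg,
    Int.reduceAdd, Int.reduceNeg, neg_zero]
  ring

/-- The Fourier transform followed by the exchange of indices takes `z₃₁` to `-z₂₃` and the weight
`(-b, -a, -c)` to `(a, b, c)`; the sign disappears in the normalisation of the `u_ν`. -/
theorem dual_lower31 (a b c : ℂ) (f : R (-3 - α)) :
    dual α (lower31 (-b) (-a) (-c) f) = lower23 a b c (dual α f) := by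
  rw [lower31, show -a - 1 = -(a + 1) by ring, map_add, dual_raise21]
  simp only [lower23, raise31, raise32, raise23', raise13', raise21, map_sub, map_mul, map_add,
    map_neg, map_one, dual_sh, dual_h0, dual_h1, dual_h2, algHom_cst, cst_neg, cst_sub, cst_add,
    Int.reduceAdd, Int.reduceNeg, neg_zero, neg_neg, sh_sh, sh_h0, sh_h1, sh_h2]
  ring

/-- The polynomial `f_{l,k}^ν` for the formula with `z₂₃`. -/
def hahn' (α : ℂ) (l k : ℕ) (a b c : ℂ) : R α := dual α (hahn (-3 - α) l k (-b) (-a) (-c))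

theorem hahn'_zero (α a b c : ℂ) : hahn' α 0 0 a b c = 1 := by rw [hahn', hahn, map_one]

theorem hahn'_zero_succ (α : ℂ) (k : ℕ) (a b c : ℂ) :
    hahn' α 0 (k + 1) a b c = lower23 a (b - 1) (c + 1) (hahn' α 0 k a (b - 1) (c + 1)) := by
  rw [hahn', hahn, hahn', ← dual_lower31, show -b + 1 = -(b - 1) by ring,
    show -c - 1 = -(c + 1) by ring]

theorem hahn'_succ (α : ℂ) (l k : ℕ) (a b c : ℂ) :
    hahn' α (l + 1) k a b c = raise21 (a + 1) (b - 1) (hahn' α l k (a + 1) (b - 1) c) := by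
  rw [hahn', hahn, hahn', ← dual_raise21, show -b + 1 = -(b - 1) by ring,
    show -a - 1 = -(a + 1) by ring]

theorem hahn'_linearIndependent (α : ℂ) (a m q : ℕ) (hs : a + q = m) :
    LinearIndependent ℂ fun p : ℕ × ℕ => hahn' α p.1 p.2 a (-m) q := by
  have := hahn_linearIndependent (-3 - α) m a (-q) (by rw [← hs]; push_cast; ring)
  simp only [hahn', neg_neg]
  exact this.map' (dual α).toLinearMap (LinearMap.ker_eq_bot.mpr (dual_bijective α).1)

theorem hahn'_span (α : ℂ) (a m q : ℕ) (hs : a + q = m) :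
    Submodule.span ℂ (Set.range fun p : ℕ × ℕ => hahn' α p.1 p.2 a (-m) q) = ⊤ := by
  have := hahn_span (-3 - α) m a (-q) (by rw [← hs]; push_cast; ring)
  simp only [hahn', neg_neg]
  have h2 := congrArg (Submodule.map (dual α).toLinearMap) this
  rw [Submodule.map_span, Submodule.map_top, LinearMap.range_eq_top.mpr (dual_bijective α).2,
    ← Set.range_comp] at h2
  exact h2

theorem dual_fall (i j : Fin 3) (hij : dual α (h _ i) = -1 - h α j) (n : ℕ) :
    dual α (fall _ i n) = (-1) ^ n * rise α j n := by
  have e : (-1 : R α) ^ n = ∏ _r ∈ Finset.range n, (-1 : R α) := by simp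
  rw [map_fall, hij, rise, e, ← Finset.prod_mul_distrib]
  exact Finset.prod_congr rfl fun r _ => by ring

theorem dual_rise (i j : Fin 3) (hij : dual α (h _ i) = -1 - h α j) (n : ℕ) :
    dual α (rise _ i n) = (-1) ^ n * fall α j n := by
  have e : (-1 : R α) ^ n = ∏ _r ∈ Finset.range n, (-1 : R α) := by simp
  rw [map_rise, hij, fall, e, ← Finset.prod_mul_distrib]
  exact Finset.prod_congr rfl fun r _ => by ring

/-- Falling and rising factorials are exchanged up to signs, whose product `(-1)^(m + a + q)` is `1`
because `m = a + q`. So the first orthogonality at `-3 - α` is transported. -/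
theorem hahn'_orthogonal {Λ : R α →ₗ[ℂ] ℂ} (hΛ : IsShiftInvariant Λ) (a m q : ℕ) (hs : a + q = m)
    {p p' : ℕ × ℕ} (hp : p ≠ p') :
    Λ (hahn' α p.1 p.2 a (-m) q * hahn' α p'.1 p'.2 a (-m) q
      * (fall α 0 a * rise α 1 m * fall α 2 q)) = 0 := by
  have h1 := hahn_orthogonal (dual_shiftInvariant hΛ) m a q hs.symm hp
  simp only [LinearMap.comp_apply, AlgHom.toLinearMap_apply, map_mul, regionWeight,
    dual_fall 0 1 (dual_h0 α), dual_rise 1 0 (dual_h1 α), dual_rise 2 2 (dual_h2 α)] at h1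
  simp only [hahn', neg_neg]
  rw [← h1]
  congr 1
  have e : ((-1 : R α) ^ m * (-1) ^ a * (-1) ^ q) = 1 := by
    rw [← hs, ← pow_add, ← pow_add]
    have h2 : (-1 : R α) ^ 2 = 1 := by ring
    rw [show a + q + a + q = 2 * (a + q) by ring, pow_mul, h2, one_pow]
  linear_combination (-dual α (hahn (-3 - α) p.1 p.2 m (-a) (-q))
    * dual α (hahn (-3 - α) p'.1 p'.2 m (-a) (-q)) * (fall α 0 a * rise α 1 m * fall α 2 q)) * e

/-! ### The action on monomials -/

/-- The elements with `p` form a subalgebra containing the image of `ι`. By the universal property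
the identity of `U` factors through it. -/
theorem U_induction {p : U → Prop} (hC : ∀ c, p (algebraMap ℂ U c)) (hE : ∀ i j, p (E i j))
    (hadd : ∀ a b, p a → p b → p (a + b)) (hmul : ∀ a b, p a → p b → p (a * b)) (x : U) : p x := by
  let B : Subalgebra ℂ U :=
    { carrier := {x | p x}
      mul_mem' := fun {a b} => hmul a b
      add_mem' := fun {a b} => hadd a b
      algebraMap_mem' := hC }
  have hι : ∀ M : gl3, UniversalEnvelopingAlgebra.ι ℂ M ∈ B := by
    intro M
    rw [matrix_eq_sum M]
    simp only [map_sum, map_smul]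
    exact sum_mem fun i _ => sum_mem fun j _ => B.smul_mem (hE i j) _
  let g : gl3 →ₗ⁅ℂ⁆ B :=
    { toFun := fun M => ⟨UniversalEnvelopingAlgebra.ι ℂ M, hι M⟩
      map_add' := fun M N => Subtype.ext (map_add _ M N)
      map_smul' := fun c M => Subtype.ext (map_smul _ c M)
      map_lie' := fun {M N} => Subtype.ext (LieHom.map_lie _ M N) }
  have h : B.val.comp (UniversalEnvelopingAlgebra.lift ℂ g) = AlgHom.id ℂ U := by
    apply UniversalEnvelopingAlgebra.hom_ext
    ext M
    change ((UniversalEnvelopingAlgebra.lift ℂ g (UniversalEnvelopingAlgebra.ι ℂ M) : B) : U)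
      = UniversalEnvelopingAlgebra.ι ℂ M
    rw [UniversalEnvelopingAlgebra.lift_ι_apply]
    rfl
  have h2 := AlgHom.congr_fun h x
  change ((UniversalEnvelopingAlgebra.lift ℂ g x : B) : U) = x at h2
  have h3 : x ∈ B := by
    rw [← h2]
    exact Subtype.property _
  exact h3

theorem toA_surjective (α : ℂ) : Function.Surjective (toA α) := Ideal.Quotient.mk_surjective

theorem rep_coe (α : ℂ) (x : U) (v : S α) : (rep α x v : Mono) = actU x v := by
  induction x using U_induction generalizing v with
  | hC c => rw [AlgHom.commutes, AlgHom.commutes]; simp [Module.algebraMap_end_apply]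
  | hE i j => rw [rep_E, actU_E]
  | hadd a b ha hb => rw [map_add, map_add, LinearMap.add_apply, LinearMap.add_apply,
      Submodule.coe_add, ha, hb]
  | hmul a b ha hb => rw [map_mul, map_mul, Module.End.mul_apply, Module.End.mul_apply, ha, hb]

/-- The quotient by the kernel is faithful on `S^α(V)`, so equality is tested on its monomials.
Using `actU` on all formal monomials avoids membership in `S α` in the computations. -/
theorem toA_eq_of_expo {α : ℂ} {x y : U}
    (H : ∀ k ∈ expo α, actU x (mono k) = actU y (mono k)) : toA α x = toA α y := by
  rw [← sub_eq_zero, ← map_sub, toA_eq_zero]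
  refine LinearMap.ext fun v => Subtype.ext ?_
  rw [rep_coe]
  obtain ⟨v, hv⟩ := v
  simp only [map_sub, LinearMap.sub_apply, LinearMap.zero_apply, Submodule.coe_zero, sub_eq_zero]
  induction hv using Submodule.span_induction with
  | mem x hx => obtain ⟨k, hk, rfl⟩ := hx; exact H k hk
  | zero => simp
  | add x y _ _ hx hy => rw [map_add, map_add, hx, hy]
  | smul c x _ hx => rw [map_smul, map_smul, hx]

theorem actU_eq_of_toA {α : ℂ} {x y : U} (H : toA α x = toA α y) {k : Fin 3 → ℂ}
    (hk : k ∈ expo α) : actU x (mono k) = actU y (mono k) := by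
  rw [← sub_eq_zero, ← map_sub, toA_eq_zero] at H
  have h1 := rep_coe α (x - y) ⟨mono k, Submodule.subset_span ⟨k, hk, rfl⟩⟩
  rw [H] at h1
  simp only [map_sub, LinearMap.sub_apply, LinearMap.zero_apply, Submodule.coe_zero] at h1
  exact (sub_eq_zero.mp h1.symm)

theorem actU_E_mono (i j : Fin 3) (k : Fin 3 → ℂ) :
    actU (E i j) (mono k) = k j • mono (k - Pi.single j 1 + Pi.single i 1) := by
  rw [actU_E, unit_mono]

theorem actU_polyU (p : MvPolynomial (Fin 3) ℂ) (k : Fin 3 → ℂ) :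
    actU (polyU p) (mono k) = MvPolynomial.eval k p • mono k := by
  induction p using MvPolynomial.induction_on with
  | C c =>
    rw [← MvPolynomial.algebraMap_eq, AlgHom.commutes, AlgHom.commutes]
    simp [Module.algebraMap_end_apply, MvPolynomial.algebraMap_eq]
  | add p q hp hq => simp only [map_add, LinearMap.add_apply, hp, hq, add_smul]
  | mul_X p i hp =>
    rw [map_mul, map_mul, polyU_X, Module.End.mul_apply, actU_E_mono, sub_add_cancel, map_smul, hp,
      smul_smul, map_mul, MvPolynomial.eval_X, mul_comm]

theorem cartan_mk (α : ℂ) (p : MvPolynomial (Fin 3) ℂ) :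
    cartan α (Ideal.Quotient.mk (relIdeal α) p) = toA α (polyU p) := rfl

theorem ev_mk {α : ℂ} (p : MvPolynomial (Fin 3) ℂ) {k : Fin 3 → ℂ} (hk : k 0 + k 1 + k 2 = α) :
    ev α (k 1) (k 2) (Ideal.Quotient.mk (relIdeal α) p) = MvPolynomial.eval k p := by
  have e : k = ![α - k 1 - k 2, k 1, k 2] := by
    funext i; fin_cases i
    · change k 0 = α - k 1 - k 2; rw [← hk]; ring
    · rfl
    · rfl
  have : ev α (k 1) (k 2) (Ideal.Quotient.mk (relIdeal α) p)
      = MvPolynomial.aeval ![α - k 1 - k 2, k 1, k 2] p := rfl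
  rw [this, ← e, MvPolynomial.aeval_eq_eval]

theorem ev_h {α : ℂ} {k : Fin 3 → ℂ} (hk : k 0 + k 1 + k 2 = α) (i : Fin 3) :
    ev α (k 1) (k 2) (h α i) = k i := by
  rw [h, ev_mk _ hk, MvPolynomial.eval_X]

/-- A criterion for `x = f y` in `A^α`. -/
theorem toA_eq_cartan_mul {α : ℂ} {x y : U} {f : R α}
    (H : ∀ k : Fin 3 → ℂ, k 0 + k 1 + k 2 = α → ∃ (s t : ℂ) (k' : Fin 3 → ℂ),
      k' 0 + k' 1 + k' 2 = α ∧ actU x (mono k) = s • mono k' ∧ actU y (mono k) = t • mono k' ∧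
      s = ev α (k' 1) (k' 2) f * t) : toA α x = cartan α f * toA α y := by
  obtain ⟨p, rfl⟩ := Ideal.Quotient.mk_surjective f
  rw [cartan_mk, ← map_mul]
  refine toA_eq_of_expo fun k hk => ?_
  obtain ⟨s, t, k', hk', h1, h2, h3⟩ := H k hk.1
  rw [h1, map_mul, Module.End.mul_apply, h2, map_smul, actU_polyU, smul_smul, h3, ev_mk _ hk',
    mul_comm]

/-- The scalar by which `r^n` takes `x^z` to `x^{z + n}`. -/
def rho (n : ℤ) (z : ℂ) : ℂ := if 0 ≤ n then 1 else ∏ r ∈ Finset.range (-n).toNat, (z - r)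

theorem mulX_pow_mono (i : Fin 3) (n : ℕ) (k : Fin 3 → ℂ) :
    (mulX i ^ n) (mono k) = mono (k + Pi.single i (n : ℂ)) := by
  induction n with
  | zero => simp
  | succ n ih =>
    rw [pow_succ', Module.End.mul_apply, ih, mulX_mono, add_assoc, ← Pi.single_add]
    push_cast; rfl

theorem der_pow_mono (i : Fin 3) (n : ℕ) (k : Fin 3 → ℂ) :
    (der i ^ n) (mono k) = (∏ r ∈ Finset.range n, (k i - r)) • mono (k + Pi.single i (-(n : ℂ))) := by
  induction n with
  | zero => simp
  | succ n ih =>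
    rw [pow_succ', Module.End.mul_apply, ih, map_smul, der_mono, smul_smul, Finset.prod_range_succ,
      Pi.add_apply, Pi.single_eq_same, ← sub_eq_add_neg, add_sub_assoc, ← Pi.single_sub]
    push_cast
    rw [neg_add']

theorem rOp_mono (i : Fin 3) (n : ℤ) (k : Fin 3 → ℂ) :
    rOp i n (mono k) = rho n (k i) • mono (k + Pi.single i (n : ℂ)) := by
  unfold rOp rho
  split_ifs with h0
  · rw [mulX_pow_mono, one_smul]
    congr 3
    exact_mod_cast Int.toNat_of_nonneg h0
  · rw [der_pow_mono]
    congr 4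
    have : ((-n).toNat : ℤ) = -n := Int.toNat_of_nonneg (by omega)
    have h2 : (((-n).toNat : ℤ) : ℂ) = -n := by rw [this]; push_cast; rfl
    push_cast at h2
    rw [h2, neg_neg]

/-- The scalar by which `u_ν` takes `x^k` to `x^{k + ν}`. -/
def rhoProd (ν : Fin 3 → ℤ) (k : Fin 3 → ℂ) : ℂ := ∏ i, rho (ν i) (k i)

theorem actU_uU_mono {ν : Fin 3 → ℤ} (hν : ν ∈ Q) (k : Fin 3 → ℂ) :
    actU (uU ν) (mono k) = rhoProd ν k • mono (k + fun i => (ν i : ℂ)) := by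
  rw [actU_uU hν, Module.End.mul_apply, Module.End.mul_apply, rOp_mono, map_smul, rOp_mono,
    map_smul, map_smul, rOp_mono, smul_smul, smul_smul, rhoProd, Fin.prod_univ_three]
  have e : k + Pi.single 2 (ν 2 : ℂ) + Pi.single 1 (ν 1 : ℂ) + Pi.single 0 (ν 0 : ℂ)
      = k + fun i => (ν i : ℂ) := by
    funext i; fin_cases i <;> simp
  rw [e]
  congr 1
  simp; ring

theorem sum_add_weight {α : ℂ} {ν : Fin 3 → ℤ} (hν : ν ∈ Q) {k : Fin 3 → ℂ}
    (hk : k 0 + k 1 + k 2 = α) : (k + fun i => (ν i : ℂ)) 0 + (k + fun i => (ν i : ℂ)) 1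
      + (k + fun i => (ν i : ℂ)) 2 = α := by
  have : ν 0 + ν 1 + ν 2 = 0 := hν
  have h3 : ((ν 0 + ν 1 + ν 2 : ℤ) : ℂ) = 0 := by rw [this]; simp
  push_cast at h3
  simp only [Pi.add_apply]
  linear_combination hk + h3

/-! ### Multiplication of the `u_ν` by root vectors -/

/-- `x r^n = (lmulX n) r^{n+1}`, as a function of `x ∂/∂x`. -/
def lmulX {B : Type*} [CommRing B] (n : ℤ) (x : B) : B := if 0 ≤ n then 1 else x
/-- `(∂/∂x) r^n = (lder n) r^{n-1}`. -/
def lder {B : Type*} [CommRing B] (n : ℤ) (x : B) : B := if 0 < n then x + 1 else 1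
/-- `r^n x = (rmulX n) r^{n+1}`. -/
def rmulX {B : Type*} [CommRing B] (n : ℤ) (x : B) : B := if 0 ≤ n then 1 else x - n
/-- `r^n (∂/∂x) = (rder n) r^{n-1}`. -/
def rder {B : Type*} [CommRing B] (n : ℤ) (x : B) : B := if 0 < n then x - n + 1 else 1

theorem rho_of_nonneg {n : ℤ} (hn : 0 ≤ n) (z : ℂ) : rho n z = 1 := if_pos hn

theorem rho_neg_natCast (n : ℕ) (z : ℂ) : rho (-n) z = ∏ r ∈ Finset.range n, (z - r) := by
  rcases n with _ | n
  · simp [rho]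
  · rw [rho, if_neg (by omega)]; simp

theorem rho_lmulX (n : ℤ) (z : ℂ) : rho n z = lmulX n (z + n + 1) * rho (n + 1) z := by
  by_cases h0 : 0 ≤ n
  · rw [rho_of_nonneg h0, rho_of_nonneg (by omega), lmulX, if_pos h0, one_mul]
  · obtain ⟨m, rfl⟩ : ∃ m : ℕ, n = -((m + 1 : ℕ) : ℤ) := ⟨(-n - 1).toNat, by omega⟩
    rw [lmulX, if_neg h0, rho_neg_natCast, show -((m + 1 : ℕ) : ℤ) + 1 = -(m : ℤ) by push_cast; ring,
      rho_neg_natCast, Finset.prod_range_succ]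
    push_cast; ring

theorem rho_lder (n : ℤ) (z : ℂ) : (z + n) * rho n z = lder n (z + n - 1) * rho (n - 1) z := by
  by_cases h0 : 0 < n
  · rw [rho_of_nonneg h0.le, rho_of_nonneg (by omega), lder, if_pos h0]; ring
  · obtain ⟨m, rfl⟩ : ∃ m : ℕ, n = -(m : ℤ) := ⟨(-n).toNat, by omega⟩
    rw [lder, if_neg h0, rho_neg_natCast, show -(m : ℤ) - 1 = -((m + 1 : ℕ) : ℤ) by push_cast; ring,
      rho_neg_natCast, Finset.prod_range_succ]
    push_cast; ring

theorem rho_rmulX (n : ℤ) (z : ℂ) : rho n (z + 1) = rmulX n (z + n + 1) * rho (n + 1) z := by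
  by_cases h0 : 0 ≤ n
  · rw [rho_of_nonneg h0, rho_of_nonneg (by omega), rmulX, if_pos h0, one_mul]
  · obtain ⟨m, rfl⟩ : ∃ m : ℕ, n = -((m + 1 : ℕ) : ℤ) := ⟨(-n - 1).toNat, by omega⟩
    rw [rmulX, if_neg h0, rho_neg_natCast, show -((m + 1 : ℕ) : ℤ) + 1 = -(m : ℤ) by push_cast; ring,
      rho_neg_natCast, Finset.prod_range_succ']
    have : ∀ r : ℕ, z + 1 - ((r + 1 : ℕ) : ℂ) = z - r := fun r => by push_cast; ring
    simp only [this]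
    push_cast; ring

theorem rho_rder (n : ℤ) (z : ℂ) : z * rho n (z - 1) = rder n (z + n - 1) * rho (n - 1) z := by
  by_cases h0 : 0 < n
  · rw [rho_of_nonneg h0.le, rho_of_nonneg (by omega), rder, if_pos h0]; ring
  · obtain ⟨m, rfl⟩ : ∃ m : ℕ, n = -(m : ℤ) := ⟨(-n).toNat, by omega⟩
    rw [rder, if_neg h0, rho_neg_natCast, show -(m : ℤ) - 1 = -((m + 1 : ℕ) : ℤ) by push_cast; ring,
      rho_neg_natCast, Finset.prod_range_succ']
    have : ∀ r : ℕ, z - 1 - (r : ℂ) = z - ((r + 1 : ℕ) : ℂ) := fun r => by push_cast; ring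
    simp only [this]
    push_cast; ring

theorem map_lmulX {B C : Type*} [CommRing B] [CommRing C] (φ : B →+* C) (n : ℤ) (x : B) :
    φ (lmulX n x) = lmulX n (φ x) := by unfold lmulX; split_ifs <;> simp
theorem map_lder {B C : Type*} [CommRing B] [CommRing C] (φ : B →+* C) (n : ℤ) (x : B) :
    φ (lder n x) = lder n (φ x) := by unfold lder; split_ifs <;> simp
theorem map_rmulX {B C : Type*} [CommRing B] [CommRing C] (φ : B →+* C) (n : ℤ) (x : B) :
    φ (rmulX n x) = rmulX n (φ x) := by unfold rmulX; split_ifs <;> simp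
theorem map_rder {B C : Type*} [CommRing B] [CommRing C] (φ : B →+* C) (n : ℤ) (x : B) :
    φ (rder n x) = rder n (φ x) := by unfold rder; split_ifs <;> simp

theorem prod_split {i j : Fin 3} (hij : i ≠ j) (g : Fin 3 → ℂ) :
    ∏ m, g m = g i * (g j * ∏ m ∈ (Finset.univ.erase i).erase j, g m) := by
  rw [Finset.mul_prod_erase _ g (by simp [hij.symm]), Finset.mul_prod_erase _ g (by simp)]

theorem root_mem_Q {ν : Fin 3 → ℤ} (hν : ν ∈ Q) (i j : Fin 3) : ν + eps i - eps j ∈ Q := by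
  have : ν 0 + ν 1 + ν 2 = 0 := hν
  fin_cases i <;> fin_cases j <;> simp [Q, eps] <;> linarith

/-- On monomials both sides shift the exponent by the same weight, with scalars that are products
over the three variables. Only the factors at `i` and `j` differ, by `rho_lmulX` and `rho_lder`. -/
theorem E_mul_u (α : ℂ) {ν : Fin 3 → ℤ} (hν : ν ∈ Q) {i j : Fin 3} (hij : i ≠ j) :
    toA α (E i j) * u α ν
      = cartan α (lmulX (ν i) (h α i) * lder (ν j) (h α j)) * u α (ν + eps i - eps j) := by
  have hν' := root_mem_Q hν i j
  rw [u, u, ← map_mul]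
  refine toA_eq_cartan_mul fun k hk => ?_
  refine ⟨(k j + ν j) * rhoProd ν k, rhoProd (ν + eps i - eps j) k,
    k + fun m => ((ν + eps i - eps j) m : ℂ), sum_add_weight hν' hk, ?_, actU_uU_mono hν' k, ?_⟩
  · rw [map_mul, Module.End.mul_apply, actU_uU_mono hν, map_smul, actU_E_mono, smul_smul, mul_comm]
    congr 2
    funext m
    simp [eps, Pi.single_apply]
    ring
  · rw [map_mul, ← AlgHom.coe_toRingHom, map_lmulX, map_lder, AlgHom.coe_toRingHom,
      ev_h (sum_add_weight hν' hk), ev_h (sum_add_weight hν' hk), rhoProd, rhoProd,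
      prod_split hij, prod_split hij (fun m => rho ((ν + eps i - eps j) m) (k m))]
    have e1 : (ν + eps i - eps j) i = ν i + 1 := by simp [eps, Pi.single_apply, hij]
    have e2 : (ν + eps i - eps j) j = ν j - 1 := by simp [eps, Pi.single_apply, hij.symm]
    have e3 : ∏ m ∈ (Finset.univ.erase i).erase j, rho (ν m) (k m)
        = ∏ m ∈ (Finset.univ.erase i).erase j, rho ((ν + eps i - eps j) m) (k m) := by
      refine Finset.prod_congr rfl fun m hm => ?_
      simp only [Finset.mem_erase, Finset.mem_univ, and_true] at hm
      simp [eps, Pi.single_apply, hm.1, hm.2]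
    rw [← e3]
    simp only [Pi.add_apply (f := k), e1, e2]
    have r1 := rho_lmulX (ν i) (k i)
    have r2 := rho_lder (ν j) (k j)
    push_cast
    rw [← add_assoc, ← add_sub_assoc]
    linear_combination (∏ m ∈ (Finset.univ.erase i).erase j, rho (ν m) (k m)) *
      ((k j + ν j) * rho (ν j) (k j) * r1
        + lmulX (ν i) (k i + ν i + 1) * rho (ν i + 1) (k i) * r2)

theorem u_mul_E (α : ℂ) {ν : Fin 3 → ℤ} (hν : ν ∈ Q) {i j : Fin 3} (hij : i ≠ j) :
    u α ν * toA α (E i j)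
      = cartan α (rmulX (ν i) (h α i) * rder (ν j) (h α j)) * u α (ν + eps i - eps j) := by
  have hν' := root_mem_Q hν i j
  rw [u, u, ← map_mul]
  refine toA_eq_cartan_mul fun k hk => ?_
  refine ⟨k j * rhoProd ν (k - Pi.single j 1 + Pi.single i 1), rhoProd (ν + eps i - eps j) k,
    k + fun m => ((ν + eps i - eps j) m : ℂ), sum_add_weight hν' hk, ?_, actU_uU_mono hν' k, ?_⟩
  · rw [map_mul, Module.End.mul_apply, actU_E_mono, map_smul, actU_uU_mono hν, smul_smul]
    congr 2
    funext m
    simp [eps, Pi.single_apply]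
    ring
  · rw [map_mul, ← AlgHom.coe_toRingHom, map_rmulX, map_rder, AlgHom.coe_toRingHom,
      ev_h (sum_add_weight hν' hk), ev_h (sum_add_weight hν' hk), rhoProd, rhoProd,
      prod_split hij, prod_split hij (fun m => rho ((ν + eps i - eps j) m) (k m))]
    have e1 : (ν + eps i - eps j) i = ν i + 1 := by simp [eps, Pi.single_apply, hij]
    have e2 : (ν + eps i - eps j) j = ν j - 1 := by simp [eps, Pi.single_apply, hij.symm]
    have e3 : ∏ m ∈ (Finset.univ.erase i).erase j,
          rho (ν m) ((k - Pi.single j 1 + Pi.single i 1 : Fin 3 → ℂ) m)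
        = ∏ m ∈ (Finset.univ.erase i).erase j, rho ((ν + eps i - eps j) m) (k m) := by
      refine Finset.prod_congr rfl fun m hm => ?_
      simp only [Finset.mem_erase, Finset.mem_univ, and_true] at hm
      simp [eps, Pi.single_apply, hm.1, hm.2]
    have e4 : (k - Pi.single j 1 + Pi.single i 1 : Fin 3 → ℂ) i = k i + 1 := by
      simp [Pi.single_apply, hij]
    have e5 : (k - Pi.single j 1 + Pi.single i 1 : Fin 3 → ℂ) j = k j - 1 := by
      simp [Pi.single_apply, hij.symm]
    rw [e3, e4, e5]
    simp only [Pi.add_apply (f := k), e1, e2]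
    have r1 := rho_rmulX (ν i) (k i)
    have r2 := rho_rder (ν j) (k j)
    push_cast
    rw [← add_assoc, ← add_sub_assoc]
    linear_combination (∏ m ∈ (Finset.univ.erase i).erase j, rho ((ν + eps i - eps j) m) (k m)) *
      (k j * rho (ν j) (k j - 1) * r1
        + rmulX (ν i) (k i + ν i + 1) * rho (ν i + 1) (k i) * r2)

theorem E_mul_E (i j k l : Fin 3) : E i j * E k l - E k l * E i j
    = (if j = k then E i l else 0) - (if l = i then E k j else 0) := by
  have h1 : ⁅E i j, E k l⁆ = UniversalEnvelopingAlgebra.ι ℂ (if j = k then Matrix.single i l 1 else 0)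
      - UniversalEnvelopingAlgebra.ι ℂ (if l = i then Matrix.single k j 1 else 0) := by
    rw [E, E, ← LieHom.map_lie, single_lie, map_sub]
  rw [LieRing.of_associative_ring_bracket] at h1
  rw [h1]
  congr 1 <;> split_ifs <;> simp [E]

/-- Passing from the left to the right of `E_ij`, a function of the weights is evaluated one root
lower; hence the reversed indices of `shift`. -/
theorem E_mul_cartan (α : ℂ) (i j : Fin 3) (f : R α) :
    toA α (E i j) * cartan α f = cartan α (shift α j i f) * toA α (E i j) := by
  induction f using R_induction with
  | hC c =>
    rw [AlgHom.commutes, AlgHom.commutes, AlgHom.commutes]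
    exact (Algebra.commutes c _).symm
  | hadd f g hf hg => simp only [map_add, mul_add, add_mul, hf, hg]
  | hmul f m hf =>
    rw [map_mul, ← mul_assoc, hf, mul_assoc, map_mul, map_mul, mul_assoc]
    congr 1
    have h1 := congrArg (toA α) (E_mul_E i j m m)
    rw [map_sub, map_mul, map_mul, sub_eq_iff_eq_add] at h1
    rw [shift_h, map_sub, map_add, cartan_h, h1]
    by_cases hj : m = j
    · subst hj
      by_cases hi : m = i
      · subst hi; simp
      · simp [hi]; noncomm_ring
    · by_cases hi : m = i
      · subst hi; simp [hj, Ne.symm hj]; noncomm_ring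
      · simp [hi, hj, Ne.symm hj]

/-- The adjoint action of a root vector on `f u_ν`. -/
theorem ad_E_cartan_u (α : ℂ) {ν : Fin 3 → ℤ} (hν : ν ∈ Q) {i j : Fin 3} (hij : i ≠ j) (f : R α) :
    ad α (E i j) (cartan α f * u α ν)
      = cartan α (shift α j i f * (lmulX (ν i) (h α i) * lder (ν j) (h α j))
        - f * (rmulX (ν i) (h α i) * rder (ν j) (h α j))) * u α (ν + eps i - eps j) := by
  rw [ad_E, ← mul_assoc, E_mul_cartan, mul_assoc, E_mul_u α hν hij, mul_assoc, u_mul_E α hν hij,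
    ← mul_assoc, ← mul_assoc, ← sub_mul, ← map_mul, ← map_mul, ← map_sub]

theorem cartan_comm (α : ℂ) (f g : R α) : cartan α f * cartan α g = cartan α g * cartan α f := by
  rw [← map_mul, mul_comm, map_mul]

theorem E_diag_u (α : ℂ) {ν : Fin 3 → ℤ} (hν : ν ∈ Q) (i : Fin 3) :
    toA α (E i i) * u α ν - u α ν * toA α (E i i) = (ν i : ℂ) • u α ν := by
  rw [u, ← map_mul, ← map_mul, ← map_sub, ← map_smul]
  refine toA_eq_of_expo fun k hk => ?_
  rw [map_sub, map_mul, map_mul, map_smul, LinearMap.sub_apply, LinearMap.smul_apply,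
    Module.End.mul_apply, Module.End.mul_apply, actU_uU_mono hν, map_smul, actU_E_mono,
    actU_E_mono, map_smul, sub_add_cancel, sub_add_cancel, actU_uU_mono hν, smul_smul, smul_smul,
    smul_smul, ← sub_smul]
  congr 1
  simp only [Pi.add_apply]
  ring

theorem ad_diag (α : ℂ) {ν : Fin 3 → ℤ} (hν : ν ∈ Q) (i : Fin 3) (f : R α) :
    ad α (E i i) (cartan α f * u α ν) = (ν i : ℂ) • (cartan α f * u α ν) := by
  rw [ad_E, ← cartan_h, ← mul_assoc, cartan_comm, mul_assoc, mul_assoc, ← mul_sub, cartan_h,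
    E_diag_u α hν, mul_smul_comm]

theorem cartan_mul_u_mem (α : ℂ) {ν : Fin 3 → ℤ} (hν : ν ∈ Q) (f : R α) :
    cartan α f * u α ν ∈ weightSpace α ν := fun i => by
  rw [← ad_E, ad_diag α hν]

theorem zero_mem_Q : (0 : Fin 3 → ℤ) ∈ Q := by simp [Q]

theorem u_zero (α : ℂ) : u α 0 = 1 := by simp [u, uU, uExp]

/-! ### The antiinvolution and the products `u_ν u_{-ν}` -/

theorem omega_mul (α : ℂ) (a b : A α) : omega α (a * b) = omega α b * omega α a := by
  simp [omega]

theorem omega_add (α : ℂ) (a b : A α) : omega α (a + b) = omega α a + omega α b := by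
  simp [omega]

theorem omega_algebraMap (α : ℂ) (c : ℂ) :
    omega α (algebraMap ℂ (A α) c) = algebraMap ℂ (A α) c := by
  rw [omega, AlgHom.commutes, MulOpposite.algebraMap_apply, MulOpposite.unop_op]

theorem omega_E_pow (α : ℂ) (i j : Fin 3) (n : ℕ) :
    omega α (toA α (E i j ^ n)) = toA α (E j i ^ n) := by
  induction n with
  | zero =>
    rw [pow_zero, pow_zero, map_one, omega, map_one, MulOpposite.unop_one]
  | succ n ih => rw [pow_succ, map_mul, omega_mul, ih, omega_E, ← map_mul, ← pow_succ']

theorem omega_cartan (α : ℂ) (f : R α) : omega α (cartan α f) = cartan α f := by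
  induction f using R_induction with
  | hC c => rw [AlgHom.commutes, omega_algebraMap]
  | hadd f g hf hg => rw [map_add, omega_add, hf, hg]
  | hmul f i hf =>
    rw [map_mul, omega_mul, hf, cartan_h, omega_E, ← cartan_h, cartan_comm]

theorem E_commute {i j k l : Fin 3} (h1 : j ≠ k) (h2 : l ≠ i) : Commute (E i j) (E k l) := by
  have := E_mul_E i j k l
  rw [if_neg h1, if_neg h2, sub_zero, sub_eq_zero] at this
  exact this

theorem neg_mem_Q {ν : Fin 3 → ℤ} (hν : ν ∈ Q) : -ν ∈ Q := by
  have : ν 0 + ν 1 + ν 2 = 0 := hν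
  change -ν 0 + -ν 1 + -ν 2 = 0
  omega

/-- The antiinvolution reverses the factors. For each sign pattern of `ν` at most two are
nontrivial, and these commute. -/
theorem omega_u (α : ℂ) {ν : Fin 3 → ℤ} (hν : ν ∈ Q) : omega α (u α ν) = u α (-ν) := by
  have hs : ν 0 + ν 1 + ν 2 = 0 := hν
  have hx : ∀ i j, uExp (-ν) i j = uExp ν j i := by
    intro i j
    simp only [uExp, Pi.neg_apply, neg_neg]
    rw [min_comm]
  unfold u uU
  simp only [map_mul, omega_mul, omega_E_pow, hx]
  simp only [← map_mul]
  congr 1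
  have k1 : ∀ i j, 0 ≤ -ν i → uExp ν i j = 0 := fun i j h => by
    unfold uExp; omega
  have k2 : ∀ i j, 0 ≤ ν j → uExp ν i j = 0 := fun i j h => by
    unfold uExp; omega
  have c1 : ∀ {i j k l : Fin 3} (m n : ℕ), j ≠ k → l ≠ i → E i j ^ m * E k l ^ n = E k l ^ n * E i j ^ m :=
    fun m n h1 h2 => ((E_commute h1 h2).pow_pow m n).eq
  rcases le_total 0 (ν 0) with h0 | h0 <;> rcases le_total 0 (ν 1) with h1 | h1 <;>
    rcases le_total 0 (ν 2) with h2 | h2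
  · simp [k2 _ _ h0, k2 _ _ h1, k2 _ _ h2]
  · simp [k2 _ _ h0, k2 _ _ h1, k1 2 _ (by omega)]
    exact c1 _ _ (by decide) (by decide)
  · simp [k2 _ _ h0, k1 1 _ (by omega), k2 _ _ h2]
    exact c1 _ _ (by decide) (by decide)
  · simp [k2 _ _ h0, k1 1 _ (by omega), k1 2 _ (by omega)]
    exact c1 _ _ (by decide) (by decide)
  · simp [k1 0 _ (by omega), k2 _ _ h1, k2 _ _ h2]
    exact c1 _ _ (by decide) (by decide)
  · simp [k1 0 _ (by omega), k2 _ _ h1, k1 2 _ (by omega)]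
    exact c1 _ _ (by decide) (by decide)
  · simp [k1 0 _ (by omega), k1 1 _ (by omega), k2 _ _ h2]
    exact c1 _ _ (by decide) (by decide)
  · simp [k1 0 _ (by omega), k1 1 _ (by omega), k1 2 _ (by omega)]

/-- The element `u_ν u_{-ν}` of `R`. -/
def weightProd (α : ℂ) (ν : Fin 3 → ℤ) : R α := ∏ i, weight α i (ν i)

theorem rho_mul_rho (n : ℤ) (α x y : ℂ) (i : Fin 3) :
    rho (-n) (ev α x y (h α i)) * rho n (ev α x y (h α i) - n) = ev α x y (weight α i n) := by
  generalize hz : ev α x y (h α i) = z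
  rcases le_total 0 n with hn | hn
  · obtain ⟨m, rfl⟩ : ∃ m : ℕ, n = m := ⟨n.toNat, by omega⟩
    rw [rho_of_nonneg hn, rho_neg_natCast, weight_natCast, fall, map_prod, mul_one]
    refine Finset.prod_congr rfl fun r _ => ?_
    rw [map_sub, map_natCast, hz]
  · obtain ⟨m, rfl⟩ : ∃ m : ℕ, n = -(m : ℤ) := ⟨(-n).toNat, by omega⟩
    rw [rho_of_nonneg (by omega), rho_neg_natCast, weight_neg_natCast, rise, map_prod, one_mul,
      ← Finset.prod_range_reflect]
    refine Finset.prod_congr rfl fun r hr => ?_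
    have := Finset.mem_range.mp hr
    rw [map_add, map_add, map_natCast, hz, map_one, Nat.sub_sub, Nat.cast_sub (by omega)]
    push_cast
    ring

theorem u_mul_u_neg (α : ℂ) {ν : Fin 3 → ℤ} (hν : ν ∈ Q) :
    u α ν * u α (-ν) = cartan α (weightProd α ν) := by
  have hν' := neg_mem_Q hν
  rw [← mul_one (cartan α (weightProd α ν)), ← map_one (toA α), u, u, ← map_mul]
  refine toA_eq_cartan_mul fun k hk => ?_
  have e : (k + fun i => (((-ν) i : ℤ) : ℂ)) + (fun i => ((ν i : ℤ) : ℂ)) = k := by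
    funext i; simp
  refine ⟨rhoProd (-ν) k * rhoProd ν (k + fun i => (((-ν) i : ℤ) : ℂ)), 1, k, hk, ?_, ?_, ?_⟩
  · rw [map_mul, Module.End.mul_apply, actU_uU_mono hν', map_smul, actU_uU_mono hν, e, smul_smul]
  · rw [map_one, one_smul, Module.End.one_apply]
  · rw [mul_one, weightProd, map_prod, rhoProd, rhoProd, ← Finset.prod_mul_distrib]
    refine Finset.prod_congr rfl fun i _ => ?_
    rw [← rho_mul_rho, ev_h hk]
    simp [sub_eq_add_neg]

/-- The form on `R` becomes integration of `f g` against a fixed weight, which is where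
orthogonality of polynomials enters. -/
theorem formR_eq (α : ℂ) {ν : Fin 3 → ℤ} (hν : ν ∈ Q) (f g : R α) :
    formR α ν f g = traceFunctional α (cartan α (f * g * weightProd α ν)) := by
  unfold formR form
  rw [omega_mul, omega_u α hν, omega_cartan, mul_assoc, ← mul_assoc (u α ν), u_mul_u_neg α hν,
    ← map_mul, ← map_mul]
  congr 2
  ring

theorem weyl_weightProd (α : ℂ) (w : Equiv.Perm (Fin 3)) (ν : Fin 3 → ℤ) :
    weyl α w (weightProd α ν) = weightProd α (fun i => ν (w.symm i)) := by
  rw [weightProd, weightProd, map_prod,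
    ← Equiv.prod_comp w fun i => weight α i (ν (w.symm i))]
  refine Finset.prod_congr rfl fun i _ => ?_
  rw [Equiv.symm_apply_apply]
  unfold weight
  split_ifs
  · rw [map_fall, weyl_h]; rfl
  · rw [map_rise, weyl_h]; rfl

/-! ### Weight spaces -/

/-- The span of the `f u_ν` contains `1` and is stable under left multiplication by every `E_ij`, so
it is all of `A α`. -/
theorem A_induction {α : ℂ} {p : A α → Prop} (hadd : ∀ a b, p a → p b → p (a + b))
    (hu : ∀ ν ∈ Q, ∀ f : R α, p (cartan α f * u α ν)) (a : A α) : p a := by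
  let V : Submodule ℂ (A α) := Submodule.span ℂ {a | ∃ ν ∈ Q, ∃ f : R α, a = cartan α f * u α ν}
  have hE : ∀ i j, ∀ a ∈ V, toA α (E i j) * a ∈ V := by
    intro i j a ha
    induction ha using Submodule.span_induction with
    | mem x hx =>
      obtain ⟨ν, hν, f, rfl⟩ := hx
      apply Submodule.subset_span
      by_cases hij : i = j
      · subst hij
        exact ⟨ν, hν, h α i * f, by rw [map_mul, cartan_h, mul_assoc]⟩
      · exact ⟨_, root_mem_Q hν i j, _, by
          rw [← mul_assoc, E_mul_cartan, mul_assoc, E_mul_u α hν hij, ← mul_assoc, ← map_mul]⟩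
    | zero => rw [mul_zero]; exact zero_mem _
    | add x y _ _ hx hy => rw [mul_add]; exact add_mem hx hy
    | smul c x _ hx => rw [mul_smul_comm]; exact V.smul_mem c hx
  have hU : ∀ x : U, ∀ a ∈ V, toA α x * a ∈ V := by
    intro x
    induction x using U_induction with
    | hC c =>
      intro a ha
      rw [AlgHom.commutes, ← Algebra.smul_def]
      exact V.smul_mem c ha
    | hE i j => exact hE i j
    | hadd x y hx hy =>
      intro a ha
      rw [map_add, add_mul]
      exact add_mem (hx a ha) (hy a ha)
    | hmul x y hx hy =>
      intro a ha
      rw [map_mul, mul_assoc]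
      exact hx _ (hy a ha)
  have h1 : (1 : A α) ∈ V := Submodule.subset_span ⟨0, zero_mem_Q, 1, by rw [u_zero]; simp⟩
  have ha : a ∈ V := by
    obtain ⟨x, rfl⟩ := toA_surjective α a
    have := hU x 1 h1
    rwa [mul_one] at this
  -- Strengthened to all multiples, because `p` is assumed additive only and the scalars must be
  -- absorbed into `f`.
  have key : ∀ c : ℂ, p (c • a) := by
    induction ha using Submodule.span_induction with
    | mem x hx =>
      intro c
      obtain ⟨ν, hν, f, rfl⟩ := hx
      have := hu ν hν (c • f)
      rwa [map_smul, smul_mul_assoc] at this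
    | zero =>
      intro c
      have := hu 0 zero_mem_Q 0
      rwa [map_zero, zero_mul, ← smul_zero c] at this
    | add x y _ _ hx hy => intro c; rw [smul_add]; exact hadd _ _ (hx c) (hy c)
    | smul d x _ hx => intro c; rw [smul_smul]; exact hx _
  simpa using key 1

/-- A functional separating the weights of `Q`. -/
def charge (ν : Fin 3 → ℤ) : ℂ := ν 0 + Complex.I * ν 1

theorem charge_injOn : Set.InjOn charge Q := by
  intro μ hμ ν hν h
  have hμ' : μ 0 + μ 1 + μ 2 = 0 := hμ
  have hν' : ν 0 + ν 1 + ν 2 = 0 := hν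
  have h0 := congrArg Complex.re h
  have h1 := congrArg Complex.im h
  simp [charge] at h0 h1
  funext i
  fin_cases i
  · exact h0
  · exact h1
  · change μ 2 = ν 2; omega

/-- The adjoint action of a generic element of the Cartan subalgebra. -/
def chargeOp (α : ℂ) : Module.End ℂ (A α) := ad α (E 0 0) + Complex.I • ad α (E 1 1)

theorem weightSpace_le_eigenspace {α : ℂ} {ν : Fin 3 → ℤ} {a : A α} (ha : a ∈ weightSpace α ν) :
    a ∈ (chargeOp α).eigenspace (charge ν) := by
  rw [Module.End.mem_eigenspace_iff, chargeOp, charge, LinearMap.add_apply, LinearMap.smul_apply,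
    ad_E, ad_E, ha 0, ha 1, smul_smul, ← add_smul]

/-- Modulo the eigenspaces of `chargeOp` for other eigenvalues every element is some `f u_ν`. If it
has weight `ν`, the difference lies in the eigenspace of `ν` too, and eigenspaces are independent.
-/
theorem weightSpace_eq {α : ℂ} {ν : Fin 3 → ℤ} (hν : ν ∈ Q) :
    weightSpace α ν = {a | ∃ f : R α, a = cartan α f * u α ν} := by
  ext a
  constructor
  · intro ha
    have key : ∀ a : A α, ∃ f : R α,
        a - cartan α f * u α ν ∈ ⨆ c ≠ charge ν, (chargeOp α).eigenspace c := by
      intro a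
      induction a using A_induction with
      | hadd a b ha hb =>
        obtain ⟨f, hf⟩ := ha
        obtain ⟨g, hg⟩ := hb
        refine ⟨f + g, ?_⟩
        have := add_mem hf hg
        rwa [sub_add_sub_comm, ← add_mul, ← map_add] at this
      | hu μ hμ f =>
        by_cases h : μ = ν
        · subst h
          exact ⟨f, by rw [sub_self]; exact zero_mem _⟩
        · refine ⟨0, ?_⟩
          rw [map_zero, zero_mul, sub_zero]
          have h1 : charge μ ≠ charge ν := fun h2 => h (charge_injOn hμ hν h2)
          exact Submodule.mem_iSup_of_mem _ (Submodule.mem_iSup_of_mem h1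
            (weightSpace_le_eigenspace (cartan_mul_u_mem α hμ f)))
    obtain ⟨f, hf⟩ := key a
    refine ⟨f, sub_eq_zero.mp ?_⟩
    have h1 : a - cartan α f * u α ν ∈ (chargeOp α).eigenspace (charge ν) :=
      sub_mem (weightSpace_le_eigenspace ha)
        (weightSpace_le_eigenspace (cartan_mul_u_mem α hν f))
    exact (Submodule.disjoint_def.mp ((chargeOp α).eigenspaces_iSupIndep (charge ν))) _ h1 hf
  · rintro ⟨f, rfl⟩
    exact cartan_mul_u_mem α hν f

/-! ### Freeness of the weight spaces -/

theorem mem_expo_of_not_nat {α : ℂ} (hα : ¬ ∃ n : ℕ, α = n) (b c : ℕ) :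
    ![α - b - c, (b : ℂ), (c : ℂ)] ∈ expo α := by
  refine ⟨by simp; ring, ⟨b, rfl⟩, ⟨c, rfl⟩, fun h => absurd h hα⟩

theorem ev_eq_of_cartan_eq {α : ℂ} {f g : R α} (hfg : cartan α f = cartan α g) {k : Fin 3 → ℂ}
    (hk : k ∈ expo α) : ev α (k 1) (k 2) f = ev α (k 1) (k 2) g := by
  obtain ⟨p, rfl⟩ := Ideal.Quotient.mk_surjective f
  obtain ⟨q, rfl⟩ := Ideal.Quotient.mk_surjective g
  rw [cartan_mk, cartan_mk] at hfg
  have h3 := actU_eq_of_toA hfg hk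
  rw [actU_polyU, actU_polyU] at h3
  have h4 := congrArg (mono.coord k) h3
  simp only [map_smul, Module.Basis.coord_apply, Module.Basis.repr_self, Finsupp.single_eq_same,
    smul_eq_mul, mul_one] at h4
  rwa [ev_mk p hk.1, ev_mk q hk.1]

/-- Right multiplication by `u_{-ν}` brings the question into `R`. For these `α` the map `R → A α`
is injective, since `(k₂, k₃)` runs over all of `ℕ × ℕ`, and the nonzero element `weightProd` can be
cancelled. -/
theorem cartan_mul_u_injective {α : ℂ} (hα : ¬ ∃ n : ℕ, α = n) {ν : Fin 3 → ℤ} (hν : ν ∈ Q)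
    {f g : R α} (hfg : cartan α f * u α ν = cartan α g * u α ν) : f = g := by
  have h1 : cartan α (f * weightProd α ν) = cartan α (g * weightProd α ν) := by
    rw [map_mul, map_mul, ← u_mul_u_neg α hν, ← mul_assoc, ← mul_assoc, hfg]
  have h2 : f * weightProd α ν = g * weightProd α ν := by
    refine R_ext fun b c => ?_
    have h3 := ev_eq_of_cartan_eq h1 (mem_expo_of_not_nat hα b c)
    exact h3
  refine mul_right_cancel₀ ?_ h2
  refine Finset.prod_ne_zero_iff.mpr fun i _ => ?_
  have hne : ∀ c : ℂ, h α i + algebraMap ℂ (R α) c ≠ 0 := by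
    intro c h0
    have e1 := congrArg (ev α 0 0) h0
    have e2 := congrArg (ev α 1 0) h0
    have e3 := congrArg (ev α 0 1) h0
    rw [map_add, AlgHom.commutes, map_zero] at e1 e2 e3
    fin_cases i <;> simp at e1 e2 e3
    · have : (1 : ℂ) = 0 := by linear_combination e1 - e2
      norm_num at this
    · have : (1 : ℂ) = 0 := by linear_combination e2 - e1
      norm_num at this
    · have : (1 : ℂ) = 0 := by linear_combination e3 - e1
      norm_num at this
  unfold weight
  split_ifs
  · refine Finset.prod_ne_zero_iff.mpr fun r _ => ?_
    have := hne (-r)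
    rwa [map_neg, map_natCast, ← sub_eq_add_neg] at this
  · refine Finset.prod_ne_zero_iff.mpr fun r _ => ?_
    have := hne (1 + r)
    rwa [map_add, map_one, map_natCast, ← add_assoc] at this

theorem generator_unique {α : ℂ} (hα : ¬ ∃ n : ℕ, α = n) {ν : Fin 3 → ℤ} (hν : ν ∈ Q) {a : A α}
    (ha : weightSpace α ν = {x | ∃ f : R α, x = cartan α f * a}) :
    ∃ c : ℂ, c ≠ 0 ∧ a = c • u α ν := by
  have h1 : a ∈ weightSpace α ν := by rw [ha]; exact ⟨1, by simp⟩
  have h2 : u α ν ∈ weightSpace α ν := by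
    have := cartan_mul_u_mem α hν 1
    rwa [map_one, one_mul] at this
  rw [ha] at h2
  rw [weightSpace_eq hν] at h1
  obtain ⟨f, rfl⟩ := h1
  obtain ⟨g, hg⟩ := h2
  rw [← mul_assoc, ← map_mul] at hg
  have h3 : g * f = 1 := (cartan_mul_u_injective hα hν (by rw [← hg, map_one, one_mul]))
  obtain ⟨c, hc, rfl⟩ := R_isUnit (IsUnit.of_mul_eq_one_right g h3)
  exact ⟨c, hc, by rw [AlgHom.commutes, ← Algebra.smul_def]⟩

/-! ### Trace functionals -/

theorem E_mul_E_swap (α : ℂ) {i j : Fin 3} (hij : i ≠ j) :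
    toA α (E i j) * toA α (E j i) = cartan α (h α i * (h α j + 1)) := by
  rw [← mul_one (cartan α (h α i * (h α j + 1))), ← map_one (toA α), ← map_mul]
  refine toA_eq_cartan_mul fun k hk => ⟨k i * (k j + 1), 1, k, hk, ?_, ?_, ?_⟩
  · rw [map_mul, Module.End.mul_apply, actU_E_mono, map_smul, actU_E_mono, smul_smul]
    congr 2
    · simp [Pi.single_apply, hij.symm]
    · abel
  · rw [map_one, one_smul, Module.End.one_apply]
  · rw [mul_one, map_mul, map_add, map_one, ev_h hk, ev_h hk]

/-- The trace property for the pair `E_ji f`, `E_ij` compares `E_ji f E_ij` with `E_ij E_ji f`, both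
of which lie in `R`. -/
theorem shiftInvariant_of_trace {α : ℂ} {L : A α →ₗ[ℂ] ℂ} (hL : ∀ a b : A α, L (a * b) = L (b * a)) :
    IsShiftInvariant (L ∘ₗ (cartan α).toLinearMap) := by
  intro i j hij f
  simp only [LinearMap.comp_apply, AlgHom.toLinearMap_apply]
  have h1 := hL (toA α (E j i) * cartan α f) (toA α (E i j))
  rw [E_mul_cartan, mul_assoc, E_mul_E_swap α hij.symm, ← map_mul, ← mul_assoc, ← E_mul_cartan,
    ← mul_assoc, E_mul_E_swap α hij, ← map_mul, mul_comm _ f] at h1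
  rw [← h1]
  congr 2
  simp only [map_mul, map_add, map_one, shift_h, if_pos, if_neg hij, if_neg hij.symm]
  ring

theorem trace_weight {α : ℂ} {L : A α →ₗ[ℂ] ℂ} (hL : ∀ a b : A α, L (a * b) = L (b * a))
    {ν : Fin 3 → ℤ} (hν : ν ≠ 0) {a : A α} (ha : a ∈ weightSpace α ν) : L a = 0 := by
  obtain ⟨i, hi⟩ : ∃ i, ν i ≠ 0 := Function.ne_iff.mp hν
  have h1 := congrArg L (ha i)
  rw [map_sub, hL, sub_self, map_smul, smul_eq_mul] at h1
  exact (mul_eq_zero.mp h1.symm).resolve_left (by exact_mod_cast hi)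

theorem trace_unique {α : ℂ} {L L' : A α →ₗ[ℂ] ℂ} (hL : ∀ a b : A α, L (a * b) = L (b * a))
    (hL' : ∀ a b : A α, L' (a * b) = L' (b * a)) (h1 : L 1 = L' 1) : L = L' := by
  have h2 := shiftInvariant_unique (shiftInvariant_of_trace hL) (shiftInvariant_of_trace hL')
    (by simpa using h1)
  refine LinearMap.ext fun a => ?_
  induction a using A_induction with
  | hadd a b ha hb => rw [map_add, map_add, ha, hb]
  | hu ν hν f =>
    by_cases h0 : ν = 0
    · subst h0
      rw [u_zero, mul_one]
      exact LinearMap.congr_fun h2 f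
    · rw [trace_weight hL h0 (cartan_mul_u_mem α hν f),
        trace_weight hL' h0 (cartan_mul_u_mem α hν f)]

/-- Commuting with `E_{i1}` gives `f` equal values at `k` and `k - ε₁ + ε_i` as long as `k₁ ≠ 0`.
Such moves lead from `(α, 0, 0)` to every exponent of `S^α(V)`. -/
theorem ev_const_of_comm {α : ℂ} {f : R α} (hf : ∀ i j, toA α (E i j) * cartan α f
    = cartan α f * toA α (E i j)) {k : Fin 3 → ℂ} (hk : k ∈ expo α) :
    ev α (k 1) (k 2) f = ev α 0 0 f := by
  obtain ⟨b, c, h0, h1, h2, hP, -⟩ := expo_param hk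
  have hstep : ∀ (i : Fin 3) (k : Fin 3 → ℂ), k ∈ expo α → k 0 ≠ 0 →
      ev α ((k - Pi.single 0 1 + Pi.single i 1 : Fin 3 → ℂ) 1)
        ((k - Pi.single 0 1 + Pi.single i 1 : Fin 3 → ℂ) 2) f = ev α (k 1) (k 2) f := by
    intro i k hk hk0
    have hk' := expo_move α i 0 k hk hk0
    obtain ⟨p, rfl⟩ := Ideal.Quotient.mk_surjective f
    have h3 := hf i 0
    rw [cartan_mk, ← map_mul, ← map_mul] at h3
    have h4 := actU_eq_of_toA h3 hk
    rw [map_mul, map_mul, Module.End.mul_apply, Module.End.mul_apply, actU_polyU, map_smul,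
      actU_E_mono, map_smul, actU_polyU, smul_smul, smul_smul] at h4
    have h5 := congrArg (mono.coord (k - Pi.single 0 1 + Pi.single i 1)) h4
    simp only [map_smul, Module.Basis.coord_apply, Module.Basis.repr_self, Finsupp.single_eq_same,
      smul_eq_mul, mul_one] at h5
    rw [ev_mk p hk'.1, ev_mk p hk.1]
    exact mul_left_cancel₀ hk0 (h5.symm.trans (mul_comm _ _))
  -- For natural `α` the product is nonzero exactly when `b + c ≤ α`; for other `α` it never
  -- vanishes.
  have hmem : ∀ b c : ℕ, (∏ r ∈ Finset.range (b + c), (α - r)) ≠ 0 →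
      (![α - b - c, (b : ℂ), (c : ℂ)] : Fin 3 → ℂ) ∈ expo α := by
    intro b c hP
    refine ⟨by simp; ring, ⟨b, rfl⟩, ⟨c, rfl⟩, ?_⟩
    rintro ⟨n, rfl⟩
    refine ⟨n - b - c, ?_⟩
    have : b + c ≤ n := by
      by_contra hlt
      exact hP (Finset.prod_eq_zero (Finset.mem_range.mpr (not_le.mp hlt)) (sub_self _))
    change (n : ℂ) - b - c = _
    rw [Nat.cast_sub (by omega), Nat.cast_sub (by omega)]
  have key : ∀ n b c : ℕ, b + c = n → (∏ r ∈ Finset.range (b + c), (α - r)) ≠ 0 →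
      ev α b c f = ev α 0 0 f := by
    intro n
    induction n with
    | zero =>
      intro b c hbc _
      obtain ⟨rfl, rfl⟩ : b = 0 ∧ c = 0 := by omega
      simp
    | succ n ih =>
      intro b c hbc hP
      rw [hbc, Finset.prod_range_succ] at hP
      rcases b with _ | b
      · obtain ⟨c, rfl⟩ : ∃ c', c = c' + 1 := ⟨n, by omega⟩
        obtain rfl : c = n := by omega
        have hP' := left_ne_zero_of_mul hP
        have h3 := hstep 2 _ (hmem 0 c (by rwa [zero_add])) (by
          simpa using right_ne_zero_of_mul hP)
        rw [← ih 0 c (by omega) (by rwa [zero_add])]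
        simpa [Matrix.vecHead, Matrix.vecTail] using h3
      · obtain rfl : b + c = n := by omega
        have hP' := left_ne_zero_of_mul hP
        have h3 := hstep 1 _ (hmem b c hP') (by
          have := right_ne_zero_of_mul hP
          push_cast at this
          rwa [← sub_sub] at this)
        rw [← ih b c rfl hP']
        simpa [Matrix.vecHead, Matrix.vecTail] using h3
  rw [h1, h2]
  exact key _ b c rfl hP

theorem highest_mem_expo (α : ℂ) : ![α, 0, 0] ∈ expo α :=
  ⟨by simp, ⟨0, by simp⟩, ⟨0, by simp⟩, fun hα => hα⟩

/-- A central element has weight zero, hence maps to some `f` in `R`. As it commutes with all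
`E_ij`, this `f` is constant on the exponents, and the constant is read off at the highest weight.
-/
theorem toA_center {α : ℂ} {z : U} (hz : z ∈ Subalgebra.center ℂ U) :
    toA α z = algebraMap ℂ _ (hcValue α z) := by
  have hcomm : ∀ i j, toA α (E i j) * toA α z = toA α z * toA α (E i j) := fun i j => by
    rw [← map_mul, ← map_mul, (Subalgebra.mem_center_iff.mp hz (E i j))]
  have h0 : toA α z ∈ weightSpace α 0 := fun i => by rw [hcomm, sub_self]; simp
  rw [weightSpace_eq zero_mem_Q] at h0
  obtain ⟨f, hf⟩ := h0
  rw [u_zero, mul_one] at hf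
  rw [hf] at hcomm
  have h1 : toA α z = algebraMap ℂ _ (ev α 0 0 f) := by
    rw [hf]
    obtain ⟨p, rfl⟩ := Ideal.Quotient.mk_surjective f
    rw [cartan_mk, ← AlgHom.commutes (toA α)]
    refine toA_eq_of_expo fun k hk => ?_
    rw [actU_polyU, ← ev_mk p hk.1, ev_const_of_comm hcomm hk, AlgHom.commutes,
      Module.algebraMap_end_apply]
  rw [h1]
  congr 1
  rw [← AlgHom.commutes (toA α)] at h1
  rw [hcValue, actU_eq_of_toA h1 (highest_mem_expo α), AlgHom.commutes,
    Module.algebraMap_end_apply]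
  simp only [map_smul, Module.Basis.coord_apply, Module.Basis.repr_self, Finsupp.single_eq_same,
      smul_eq_mul, mul_one]

theorem isTraceFunctional_iff {α : ℂ} {L : A α →ₗ[ℂ] ℂ} : IsTraceFunctional α L ↔
    (∀ a b : A α, L (a * b) = L (b * a)) ∧ L 1 = 1 := by
  constructor
  · rintro ⟨h1, h2⟩
    refine ⟨h1, ?_⟩
    have := h2 1 (one_mem _)
    rw [map_one] at this
    rw [this, hcValue, map_one, Module.End.one_apply, Module.Basis.coord_apply,
      Module.Basis.repr_self, Finsupp.single_eq_same]
  · rintro ⟨h1, h2⟩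
    refine ⟨h1, fun z hz => ?_⟩
    rw [toA_center hz, Algebra.algebraMap_eq_smul_one, map_smul, h2, smul_eq_mul, mul_one]

/-! ### Existence of the trace functional -/

/-- The representation of `A^α` on `S^α(V)`. -/
def repA (α : ℂ) : A α →ₐ[ℂ] Module.End ℂ (S α) :=
  Ideal.Quotient.liftₐ (J α) (rep α) fun _ hx => hx

theorem exists_traceFunctional_of_nat (n : ℕ) : ∃ L : A (n : ℂ) →ₗ[ℂ] ℂ,
    IsTraceFunctional (n : ℂ) L := by
  have hfin : (expo (n : ℂ)).Finite := by
    refine Set.Finite.subset (Set.finite_range fun p : Fin (n + 1) × Fin (n + 1) =>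
      (![(n : ℂ) - (p.1 : ℕ) - (p.2 : ℕ), ((p.1 : ℕ) : ℂ), ((p.2 : ℕ) : ℂ)] : Fin 3 → ℂ)) ?_
    rintro k ⟨h0, ⟨b, hb⟩, ⟨c, hc⟩, h3⟩
    obtain ⟨a, ha⟩ := h3 ⟨n, rfl⟩
    have : a + b + c = n := by
      rw [ha, hb, hc] at h0
      exact_mod_cast h0
    refine ⟨(⟨b, by omega⟩, ⟨c, by omega⟩), ?_⟩
    funext i
    fin_cases i
    · change (n : ℂ) - b - c = k 0
      rw [← h0, hb, hc]; ring
    · exact hb.symm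
    · exact hc.symm
  have : FiniteDimensional ℂ (S (n : ℂ)) := FiniteDimensional.span_of_finite ℂ (hfin.image _)
  have hne : (Module.finrank ℂ (S (n : ℂ)) : ℂ) ≠ 0 := by
    have : Nontrivial (S (n : ℂ)) := by
      refine ⟨⟨⟨mono ![(n : ℂ), 0, 0], Submodule.subset_span ⟨_, highest_mem_expo _, rfl⟩⟩, 0, ?_⟩⟩
      intro h0
      exact mono.ne_zero _ (congrArg Subtype.val h0)
    exact_mod_cast (Module.finrank_pos (R := ℂ) (M := S (n : ℂ))).ne'
  refine ⟨(Module.finrank ℂ (S (n : ℂ)) : ℂ)⁻¹ • (LinearMap.trace ℂ (S (n : ℂ)) ∘ₗ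
    (repA (n : ℂ)).toLinearMap), isTraceFunctional_iff.mpr ⟨fun a b => ?_, ?_⟩⟩
  · simp only [LinearMap.smul_apply, LinearMap.comp_apply, AlgHom.toLinearMap_apply, map_mul]
    rw [LinearMap.trace_mul_comm]
  · simp only [LinearMap.smul_apply, LinearMap.comp_apply, AlgHom.toLinearMap_apply, map_one]
    rw [LinearMap.trace_one, smul_eq_mul, inv_mul_cancel₀ hne]

/-- The diagonal matrix coefficients of an element of `A^α`. -/
def diagCoeff (α : ℂ) (k : expo α) : A α →ₗ[ℂ] ℂ :=
  mono.coord k ∘ₗ (S α).subtype ∘ₗ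
    LinearMap.applyₗ (⟨mono k, Submodule.subset_span ⟨k, k.2, rfl⟩⟩ : S α) ∘ₗ
      (repA α).toLinearMap

theorem diagCoeff_toA (α : ℂ) (k : expo α) (x : U) :
    diagCoeff α k (toA α x) = mono.coord k (actU x (mono k)) := by
  rw [← rep_coe α x ⟨mono k, Submodule.subset_span ⟨k, k.2, rfl⟩⟩]
  rfl

theorem diagCoeff_cartan_mul_u (α : ℂ) (k : expo α) {ν : Fin 3 → ℤ} (hν : ν ∈ Q) (f : R α) :
    diagCoeff α k (cartan α f * u α ν)
      = if ν = 0 then ev α (k.1 1) (k.1 2) f else 0 := by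
  obtain ⟨p, rfl⟩ := Ideal.Quotient.mk_surjective f
  rw [cartan_mk, u, ← map_mul, diagCoeff_toA, map_mul, Module.End.mul_apply, actU_uU_mono hν,
    map_smul, actU_polyU, map_smul, map_smul, Module.Basis.coord_apply, Module.Basis.repr_self]
  split_ifs with h0
  · subst h0
    have e : (k.1 + fun i => (((0 : Fin 3 → ℤ) i : ℤ) : ℂ)) = k.1 := by funext i; simp
    rw [e, Finsupp.single_eq_same, ev_mk p k.2.1]
    simp [rhoProd, rho]
  · rw [Finsupp.single_eq_of_ne, smul_zero, smul_zero]
    intro h1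
    apply h0
    funext i
    have := congrFun h1 i
    simpa using this

theorem u_root (α : ℂ) {i j : Fin 3} (hij : i ≠ j) : u α (eps i - eps j) = toA α (E i j) := by
  rw [u]
  congr 1
  fin_cases i <;> fin_cases j <;> simp at hij <;> simp [uU, uExp, eps]

/-- The diagonal matrix coefficients of `a` are the values of a polynomial `P a` in `R`, unique
because the exponents are dense, and the functional is `Λ ∘ P`. For natural `α` uniqueness of `P a`
fails, which is why that case uses the trace of the module. -/
theorem exists_traceFunctional_of_not_nat {α : ℂ} (hα : ¬ ∃ n : ℕ, α = n) :
    ∃ L : A α →ₗ[ℂ] ℂ, IsTraceFunctional α L := by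
  obtain ⟨Λ, hΛ, hΛ1⟩ := exists_shiftInvariant α
  have hinj : ∀ f g : R α, (∀ k : expo α, ev α (k.1 1) (k.1 2) f = ev α (k.1 1) (k.1 2) g) → f = g :=
    fun f g H => R_ext fun b c => H ⟨_, mem_expo_of_not_nat hα b c⟩
  have hex : ∀ a : A α, ∃ f : R α, ∀ k : expo α, ev α (k.1 1) (k.1 2) f = diagCoeff α k a := by
    intro a
    induction a using A_induction with
    | hadd a b ha hb =>
      obtain ⟨f, hf⟩ := ha
      obtain ⟨g, hg⟩ := hb
      exact ⟨f + g, fun k => by rw [map_add, map_add, hf, hg]⟩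
    | hu ν hν f =>
      by_cases h0 : ν = 0
      · exact ⟨f, fun k => by rw [diagCoeff_cartan_mul_u α k hν, if_pos h0]⟩
      · exact ⟨0, fun k => by rw [diagCoeff_cartan_mul_u α k hν, if_neg h0, map_zero]⟩
  choose P hP using hex
  let L : A α →ₗ[ℂ] ℂ :=
    { toFun := fun a => Λ (P a)
      map_add' := fun a b => by
        rw [← map_add]
        congr 1
        exact hinj _ _ fun k => by rw [map_add, hP, hP, hP, map_add]
      map_smul' := fun c a => by
        rw [RingHom.id_apply, ← map_smul]
        congr 1
        exact hinj _ _ fun k => by rw [map_smul, hP, hP, map_smul] }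
  have hL : ∀ ν ∈ Q, ∀ f, L (cartan α f * u α ν) = if ν = 0 then Λ f else 0 := by
    intro ν hν f
    have : P (cartan α f * u α ν) = if ν = 0 then f else 0 := by
      refine hinj _ _ fun k => ?_
      rw [hP, diagCoeff_cartan_mul_u α k hν]
      split_ifs
      · rfl
      · rw [map_zero]
    change Λ (P _) = _
    rw [this]
    split_ifs
    · rfl
    · rw [map_zero]
  have hL0 : ∀ f, L (cartan α f) = Λ f := by
    intro f
    have := hL 0 zero_mem_Q f
    rwa [u_zero, mul_one, if_pos rfl] at this
  have htr : ∀ (x : U) (b : A α), L (toA α x * b) = L (b * toA α x) := by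
    intro x
    induction x using U_induction with
    | hC c => intro b; rw [AlgHom.commutes, Algebra.commutes]
    | hadd x y hx hy => intro b; rw [map_add, add_mul, mul_add, map_add, map_add, hx, hy]
    | hmul x y hx hy => intro b; rw [map_mul (toA α), mul_assoc, hx, mul_assoc, hy, mul_assoc]
    | hE i j =>
      intro b
      induction b using A_induction with
      | hadd a b ha hb => rw [add_mul, mul_add, map_add, map_add, ha, hb]
      | hu ν hν f =>
        by_cases hij : i = j
        · subst hij
          rw [← sub_eq_zero, ← map_sub, cartan_mul_u_mem α hν f i, map_smul, hL ν hν]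
          split_ifs with h0
          · rw [h0]; simp
          · rw [smul_zero]
        -- Only for this weight can the products have weight zero; there the trace property is shift
        -- invariance along the root `ε_j - ε_i`.
        · by_cases h0 : ν = eps j - eps i
          · subst h0
            rw [u_root α (Ne.symm hij), ← mul_assoc, E_mul_cartan, mul_assoc,
              E_mul_E_swap α hij, mul_assoc, E_mul_E_swap α (Ne.symm hij), ← map_mul, ← map_mul,
              hL0, hL0, ← hΛ j i (Ne.symm hij)]
            congr 1
            simp only [map_mul, map_add, map_one, shift_h, if_pos, if_neg hij, if_neg (Ne.symm hij)]
            ring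
          · have h1 : ν + eps i - eps j ≠ 0 := fun h2 => h0 (by
              rw [sub_eq_zero] at h2; rw [← h2]; abel)
            rw [← mul_assoc, E_mul_cartan, mul_assoc, E_mul_u α hν hij, mul_assoc (cartan α f),
              u_mul_E α hν hij, ← mul_assoc, ← mul_assoc, ← map_mul, ← map_mul,
              hL _ (root_mem_Q hν i j), hL _ (root_mem_Q hν i j), if_neg h1, if_neg h1]
  refine ⟨L, isTraceFunctional_iff.mpr ⟨fun a b => ?_, ?_⟩⟩
  · obtain ⟨x, rfl⟩ := toA_surjective α a
    exact htr x b
  · rw [← map_one (cartan α), hL0, hΛ1]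

theorem existsUnique_traceFunctional (α : ℂ) : ∃! L : A α →ₗ[ℂ] ℂ, IsTraceFunctional α L := by
  have hex : ∃ L : A α →ₗ[ℂ] ℂ, IsTraceFunctional α L := by
    by_cases hα : ∃ n : ℕ, α = n
    · obtain ⟨n, rfl⟩ := hα
      exact exists_traceFunctional_of_nat n
    · exact exists_traceFunctional_of_not_nat hα
  obtain ⟨L, hL⟩ := hex
  refine ⟨L, hL, fun L' hL' => ?_⟩
  rw [isTraceFunctional_iff] at hL hL'
  exact trace_unique hL'.1 hL.1 (by rw [hL.2, hL'.2])

theorem traceFunctional_spec (α : ℂ) : IsTraceFunctional α (traceFunctional α) :=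
  Classical.epsilon_spec (existsUnique_traceFunctional α).exists

theorem shiftInvariant_traceFunctional (α : ℂ) :
    IsShiftInvariant (traceFunctional α ∘ₗ (cartan α).toLinearMap) :=
  shiftInvariant_of_trace (traceFunctional_spec α).1

theorem form_weight {α : ℂ} {μ ν : Fin 3 → ℤ} (hν : ν ∈ Q) (hμν : μ ≠ ν) {a b : A α}
    (ha : a ∈ weightSpace α μ) (hb : b ∈ weightSpace α ν) : form α a b = 0 := by
  have hb' : omega α b ∈ weightSpace α (-ν) := by
    rw [weightSpace_eq hν] at hb
    obtain ⟨f, rfl⟩ := hb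
    intro i
    have := E_diag_u α (neg_mem_Q hν) i
    rw [omega_mul, omega_cartan, omega_u α hν, mul_assoc (u α (-ν)), ← cartan_h,
      cartan_comm, cartan_h, ← mul_assoc, ← mul_assoc, ← sub_mul, this, smul_mul_assoc]
  refine trace_weight (traceFunctional_spec α).1 (ν := μ - ν) (sub_ne_zero.mpr hμν) fun i => ?_
  have h1 := ha i
  have h2 := hb' i
  have e : toA α (E i i) * (a * omega α b) - a * omega α b * toA α (E i i)
      = (toA α (E i i) * a - a * toA α (E i i)) * omega α b
        + a * (toA α (E i i) * omega α b - omega α b * toA α (E i i)) := by noncomm_ring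
  rw [e, h1, h2, smul_mul_assoc, mul_smul_comm, ← add_smul]
  congr 1
  simp [sub_eq_add_neg]

theorem formR_weyl (α : ℂ) {ν : Fin 3 → ℤ} (hν : ν ∈ Q) (w : Equiv.Perm (Fin 3)) (f g : R α) :
    formR α (fun i => ν (w.symm i)) (weyl α w f) (weyl α w g) = formR α ν f g := by
  have hν' : (fun i => ν (w.symm i)) ∈ Q := by
    have h0 : ν 0 + ν 1 + ν 2 = 0 := hν
    change ν (w.symm 0) + ν (w.symm 1) + ν (w.symm 2) = 0
    rw [← Fin.sum_univ_three (fun i => ν (w.symm i)), Equiv.sum_comp w.symm ν, Fin.sum_univ_three, h0]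
  rw [formR_eq α hν', formR_eq α hν, ← weyl_weightProd, ← map_mul, ← map_mul]
  exact shiftInvariant_weyl (shiftInvariant_traceFunctional α) w _

theorem isOrthogonalBasis_weyl {α : ℂ} {ν : Fin 3 → ℤ} (hν : ν ∈ Q) {ι : Type} {f : ι → R α}
    (hf : IsOrthogonalBasis α ν f) (w : Equiv.Perm (Fin 3)) :
    IsOrthogonalBasis α (fun i => ν (w.symm i)) (fun i => weyl α w (f i)) := by
  obtain ⟨h1, h2, h3⟩ := hf
  have hl : Function.LeftInverse (weyl α w⁻¹) (weyl α w) := fun g => by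
    rw [weyl_weyl, inv_mul_cancel, weyl_one]
  have hr : Function.RightInverse (weyl α w⁻¹) (weyl α w) := fun g => by
    rw [weyl_weyl, mul_inv_cancel, weyl_one]
  refine ⟨?_, ?_, fun i j hij => ?_⟩
  · exact h1.map' (weyl α w).toLinearMap (LinearMap.ker_eq_bot.mpr hl.injective)
  · have : Set.range (fun i => weyl α w (f i)) = (weyl α w).toLinearMap '' Set.range f := by
      rw [← Set.range_comp]; rfl
    rw [this, Submodule.span_image, h2, Submodule.map_top, LinearMap.range_eq_top]
    exact hr.surjective
  · rw [formR_weyl α hν, h3 i j hij]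

/-! ### The weights of highest vectors -/

theorem ev_weyl_swap (α x y : ℂ) (f : R α) :
    ev α x y (weyl α (Equiv.swap 0 1) f) = ev α (α - x - y) y f := by
  have : (ev α x y).comp (weyl α (Equiv.swap 0 1)) = ev α (α - x - y) y := by
    apply R_algHom_ext
    · rw [AlgHom.comp_apply, weyl_h, Equiv.swap_apply_right, ev_h0, ev_h1]
    · rw [AlgHom.comp_apply, weyl_h, Equiv.swap_apply_of_ne_of_ne (by decide) (by decide), ev_h2,
        ev_h2]
  exact AlgHom.congr_fun this f

/-- At `E₁₁ = n` the relation reads `n f(n - 1) = (n - a) f(n)`, with `n - a ≠ 0` for natural `n`.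
So `f` vanishes at `E₁₁ = 0`, then inductively at all natural `E₁₁`, and is zero by density. -/
theorem eq_zero_of_shift_relation {α : ℂ} {f : R α} {a : ℤ} (ha : a < 0)
    (hf : shift α 1 0 f * h α 0 = f * (h α 0 - a)) : f = 0 := by
  have key : ∀ (n : ℕ) (y : ℂ), ev α (α - n - y) y f = 0 := by
    intro n y
    have hne : ∀ m : ℕ, (m : ℂ) - a ≠ 0 := fun m h0 => by
      have : ((m - a : ℤ) : ℂ) = 0 := by push_cast; exact h0
      have : (m : ℤ) - a = 0 := by exact_mod_cast this
      omega
    have h1 : ∀ n : ℂ, ev α (α - n - y + 1) y f * n = ev α (α - n - y) y f * (n - a) := by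
      intro n
      have h2 := congrArg (ev α (α - n - y) y) hf
      rw [shift_10, map_mul, map_mul, ev_sh, map_sub, ev_h0, map_intCast] at h2
      have e1 : α - (α - n - y) - y = n := by ring
      rw [e1] at h2
      simpa using h2
    induction n with
    | zero =>
      have h2 := h1 (0 : ℕ)
      rw [Nat.cast_zero, mul_zero] at h2
      have h3 := hne 0
      rw [Nat.cast_zero] at h3 ⊢
      exact (mul_eq_zero.mp h2.symm).resolve_right h3
    | succ n ih =>
      have h2 := h1 (n + 1 : ℕ)
      have e1 : α - ((n + 1 : ℕ) : ℂ) - y + 1 = α - n - y := by push_cast; ring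
      rw [e1, ih, zero_mul] at h2
      exact (mul_eq_zero.mp h2.symm).resolve_right (hne _)
  -- The swap makes `E₁₁` one of the two coordinates that `R_ext` evaluates at natural numbers.
  have h1 : weyl α (Equiv.swap 0 1) f = 0 := R_ext fun b c => by rw [ev_weyl_swap, key, map_zero]
  have h2 := congrArg (weyl α (Equiv.swap 0 1)) h1
  rwa [weyl_weyl, Equiv.swap_mul_self, weyl_one, map_zero] at h2

/-- The coefficient by which `f u_ν` takes `x^k` to `x^{k + ν}`. -/
def actCoeff {α : ℂ} (ν : Fin 3 → ℤ) (f : R α) (k : Fin 3 → ℂ) : ℂ :=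
  ev α (k 1 + ν 1) (k 2 + ν 2) f * rhoProd ν k

theorem actU_cartan_mul_u {α : ℂ} {ν : Fin 3 → ℤ} (hν : ν ∈ Q) (f : R α) :
    ∃ x : U, toA α x = cartan α f * u α ν ∧ ∀ k : Fin 3 → ℂ, k 0 + k 1 + k 2 = α →
      actU x (mono k) = actCoeff ν f k • mono (k + fun i => (ν i : ℂ)) := by
  obtain ⟨p, rfl⟩ := Ideal.Quotient.mk_surjective f
  refine ⟨polyU p * uU ν, by rw [map_mul, cartan_mk, u], fun k hk => ?_⟩
  rw [map_mul, Module.End.mul_apply, actU_uU_mono hν, map_smul, actU_polyU, smul_smul, actCoeff,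
    mul_comm]
  congr 2
  exact (ev_mk p (sum_add_weight hν hk)).symm

theorem move_add (i j : Fin 3) (k v : Fin 3 → ℂ) :
    k - Pi.single j 1 + Pi.single i 1 + v = k + v - Pi.single j 1 + Pi.single i 1 := by
  abel

theorem sum_move {α : ℂ} {k : Fin 3 → ℂ} (hk : k 0 + k 1 + k 2 = α) :
    (k - Pi.single 1 1 + Pi.single 0 1 : Fin 3 → ℂ) 0 + (k - Pi.single 1 1 + Pi.single 0 1 : Fin 3 → ℂ) 1
      + (k - Pi.single 1 1 + Pi.single 0 1 : Fin 3 → ℂ) 2 = α := by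
  simp
  rw [← hk]

theorem actCoeff_relation {α : ℂ} {ν : Fin 3 → ℤ} (hν : ν ∈ Q) {f : R α}
    (hf : toA α (E 0 1) * (cartan α f * u α ν) - cartan α f * u α ν * toA α (E 0 1) = 0)
    {k : Fin 3 → ℂ} (hk : k ∈ expo α) :
    k 1 * actCoeff ν f (k - Pi.single 1 1 + Pi.single 0 1) = (k 1 + ν 1) * actCoeff ν f k := by
  obtain ⟨x, hx, hact⟩ := actU_cartan_mul_u hν f
  rw [← hx, ← map_mul, ← map_mul, sub_eq_zero] at hf
  have h1 := actU_eq_of_toA hf hk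
  rw [map_mul, map_mul, Module.End.mul_apply, Module.End.mul_apply, hact k hk.1, map_smul,
    actU_E_mono, actU_E_mono, map_smul, hact _ (sum_move hk.1), smul_smul, smul_smul, move_add] at h1
  have h2 := congrArg (mono.coord ((k + fun i => (ν i : ℂ)) - Pi.single 1 1 + Pi.single 0 1)) h1
  simp only [map_smul, Module.Basis.coord_apply, Module.Basis.repr_self, Finsupp.single_eq_same,
    smul_eq_mul, mul_one] at h2
  rw [← h2, mul_comm]
  rfl

/-- Let `φ(k)` be the coefficient by which the highest vector acts on `x^k`; then `k₂ φ(k + ε₁ - ε₂)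
= (k₂ + b) φ(k)`. If `b > 0`, this kills `φ` at `k₂ = 0` and then at every `k₂`. If `a < 0` and `α`
is natural, `φ` vanishes at `k₁ = 0` because `u_ν` differentiates in `x₁`, and the relation
propagates this to larger `k₁`. For other `α` the polynomial form of the relation,
`eq_zero_of_shift_relation`, is used. -/
theorem Qplus_nonneg_nonpos {α : ℂ} {ν : Fin 3 → ℤ} (hν : ν ∈ Qplus α) : 0 ≤ ν 0 ∧ ν 1 ≤ 0 := by
  obtain ⟨hQ, a, ha, ha0, hcomm⟩ := hν
  rw [weightSpace_eq hQ] at ha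
  obtain ⟨f, rfl⟩ := ha
  have hvanish : ¬ ∀ k ∈ expo α, actCoeff ν f k = 0 := by
    intro H
    obtain ⟨x, hx, hact⟩ := actU_cartan_mul_u hQ f
    apply ha0
    rw [← hx, ← map_zero (toA α)]
    refine toA_eq_of_expo fun k hk => ?_
    rw [hact k hk.1, H k hk, zero_smul, map_zero, LinearMap.zero_apply]
  have hb : ν 1 ≤ 0 := by
    by_contra hb
    apply hvanish
    have key : ∀ (n : ℕ) (k : Fin 3 → ℂ), k ∈ expo α → k 1 = n → actCoeff ν f k = 0 := by
      intro n
      have hne : (n : ℂ) + ν 1 ≠ 0 := fun h0 => by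
        have : ((n + ν 1 : ℤ) : ℂ) = 0 := by push_cast; exact h0
        have : (n : ℤ) + ν 1 = 0 := by exact_mod_cast this
        omega
      induction n with
      | zero =>
        intro k hk h1
        have h2 := actCoeff_relation hQ hcomm hk
        rw [h1, Nat.cast_zero, zero_mul] at h2
        rw [Nat.cast_zero] at hne
        exact (mul_eq_zero.mp h2.symm).resolve_left hne
      | succ n ih =>
        intro k hk h1
        have h2 := actCoeff_relation hQ hcomm hk
        have hk1 : k 1 ≠ 0 := by rw [h1]; exact_mod_cast n.succ_ne_zero
        have hne' : (n : ℂ) + ν 1 ≠ 0 := fun h0 => by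
          have : ((n + ν 1 : ℤ) : ℂ) = 0 := by push_cast; exact h0
          have : (n : ℤ) + ν 1 = 0 := by exact_mod_cast this
          omega
        rw [ih hne' _ (expo_move α 0 1 k hk hk1) (by simp [h1]), mul_zero, h1] at h2
        exact (mul_eq_zero.mp h2.symm).resolve_left hne
    intro k hk
    obtain ⟨n, hn⟩ := hk.2.1
    exact key n k hk hn
  refine ⟨?_, hb⟩
  by_contra ha
  by_cases hα : ∃ n : ℕ, α = n
  · apply hvanish
    have key : ∀ (n : ℕ) (k : Fin 3 → ℂ), k ∈ expo α → k 0 = n → actCoeff ν f k = 0 := by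
      intro n
      induction n with
      | zero =>
        intro k hk h0
        have : rhoProd ν k = 0 := by
          refine Finset.prod_eq_zero (Finset.mem_univ 0) ?_
          rw [rho, if_neg ha, h0]
          exact Finset.prod_eq_zero (Finset.mem_range.mpr (by omega : 0 < (-ν 0).toNat)) (by simp)
        rw [actCoeff, this, mul_zero]
      | succ n ih =>
        intro k hk h0
        have hk0 : k 0 ≠ 0 := by rw [h0]; exact_mod_cast n.succ_ne_zero
        have hk' := expo_move α 1 0 k hk hk0
        have h2 := actCoeff_relation hQ hcomm hk'
        have e : (k - Pi.single 0 1 + Pi.single 1 1 - Pi.single 1 1 + Pi.single 0 1 : Fin 3 → ℂ) = k := by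
          abel
        obtain ⟨m, hm⟩ := hk.2.1
        have hm' : (k - Pi.single 0 1 + Pi.single 1 1 : Fin 3 → ℂ) 1 = (m + 1 : ℕ) := by simp [hm]
        rw [ih _ hk' (by simp [h0]), mul_zero, e, hm'] at h2
        exact (mul_eq_zero.mp h2).resolve_left (by exact_mod_cast m.succ_ne_zero)
    intro k hk
    obtain ⟨n, hn⟩ := hk.2.2.2 hα
    exact key n k hk hn
  · rw [← ad_E, ad_E_cartan_u α hQ (by decide)] at hcomm
    have h1 := cartan_mul_u_injective hα (root_mem_Q hQ 0 1) (g := 0)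
      (by rw [hcomm, map_zero, zero_mul])
    rw [lmulX, rmulX, lder, rder, if_neg ha, if_neg ha, if_neg (not_lt.mpr hb),
      if_neg (not_lt.mpr hb), mul_one, mul_one, sub_eq_zero] at h1
    apply ha0
    rw [eq_zero_of_shift_relation (not_le.mp ha) h1, map_zero, zero_mul]

/-! ### The vectors `vec31` and `vec23` -/

theorem intCast_eq_cst (α : ℂ) (n : ℤ) : (n : R α) = cst α n := by
  rw [cst, map_intCast]

theorem ad_z21 {α : ℂ} {ν : Fin 3 → ℤ} (hν : ν ∈ Q) (h0 : 0 < ν 0) (h1 : ν 1 < 0) (f : R α) :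
    ad α z21 (cartan α f * u α ν)
      = cartan α (raise21 (ν 0) (ν 1) f) * u α (ν + eps 1 - eps 0) := by
  rw [z21, ad_E_cartan_u α hν (by decide), shift_01, lmulX, lder, rmulX, rder,
    if_neg (not_le.mpr h1), if_pos h0, if_neg (not_le.mpr h1), if_pos h0, intCast_eq_cst,
    intCast_eq_cst, raise21]
  congr 2
  ring

theorem ad_z31 {α : ℂ} {ν : Fin 3 → ℤ} (hν : ν ∈ Q) (h0 : 0 < ν 0) (h1 : ν 1 ≤ 0) (h2 : ν 2 < 0)
    (f : R α) : ad α z31 (cartan α f * u α ν)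
      = cartan α (lower31 (ν 0) (ν 1) (ν 2) f) * u α (ν + eps 2 - eps 0) := by
  have hs := root_mem_Q hν 2 0
  have hs' := root_mem_Q hν 2 1
  have e1 : ad α (E 2 0) (cartan α f * u α ν)
      = cartan α (raise31 (ν 0) (ν 2) f) * u α (ν + eps 2 - eps 0) := by
    rw [ad_E_cartan_u α hν (by decide), shift_02, lmulX, lder, rmulX, rder,
      if_neg (not_le.mpr h2), if_pos h0, if_neg (not_le.mpr h2), if_pos h0, intCast_eq_cst,
      intCast_eq_cst, raise31]
    congr 2
    ring
  have e2 : ad α (E 2 1) (cartan α f * u α ν)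
      = cartan α (raise32 (ν 2) f) * u α (ν + eps 2 - eps 1) := by
    rw [ad_E_cartan_u α hν (by decide), shift_12, lmulX, lder, rmulX, rder,
      if_neg (not_le.mpr h2), if_neg (not_lt.mpr h1), if_neg (not_le.mpr h2),
      if_neg (not_lt.mpr h1), intCast_eq_cst, raise32, mul_one, mul_one]
  have e3 : ad α (E 1 0) (cartan α (raise32 (ν 2) f) * u α (ν + eps 2 - eps 1))
      = cartan α (raise21 (ν 0) (ν 1 - 1) (raise32 (ν 2) f)) * u α (ν + eps 2 - eps 0) := by
    have w0 : (ν + eps 2 - eps 1) 0 = ν 0 := by simp [eps]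
    have w1 : (ν + eps 2 - eps 1) 1 = ν 1 - 1 := by simp [eps]
    have := ad_z21 hs' (by rw [w0]; exact h0) (by rw [w1]; omega) (raise32 (ν 2) f)
    rw [z21, w0, w1] at this
    rw [this, show ν + eps 2 - eps 1 + eps 1 - eps 0 = ν + eps 2 - eps 0 by abel]
    push_cast
    rfl
  rw [z31, map_add, map_mul (ad α), map_mul (ad α), LinearMap.add_apply, Module.End.mul_apply,
    Module.End.mul_apply, e1, e2, e3, map_add, map_sub, LinearMap.add_apply, LinearMap.sub_apply,
    ad_diag α hs, ad_diag α hs, map_ofNat, Module.End.ofNat_apply, lower31, map_add, add_mul]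
  congr 1
  -- After `E₃₁` the weight has `E₁₁ - E₂₂` equal to `ν₁ - 1 - ν₂`; adding the `2` of `z₃₁` gives
  -- the factor `a - b + 1` of `lower31`.
  rw [map_mul (cartan α), cst, AlgHom.commutes, mul_assoc, ← Algebra.smul_def, ← Nat.cast_smul_eq_nsmul ℂ,
    ← sub_smul, ← add_smul]
  congr 1
  simp [eps]
  ring

theorem ad_z23 {α : ℂ} {ν : Fin 3 → ℤ} (hν : ν ∈ Q) (h0 : 0 ≤ ν 0) (h1 : ν 1 < 0) (h2 : 0 < ν 2)
    (f : R α) : ad α z23 (cartan α f * u α ν)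
      = cartan α (lower23 (ν 0) (ν 1) (ν 2) f) * u α (ν + eps 1 - eps 2) := by
  have hs := root_mem_Q hν 1 2
  have hs' := root_mem_Q hν 0 2
  have e1 : ad α (E 1 2) (cartan α f * u α ν)
      = cartan α (raise23' (ν 1) (ν 2) f) * u α (ν + eps 1 - eps 2) := by
    rw [ad_E_cartan_u α hν (by decide), shift_21, lmulX, lder, rmulX, rder,
      if_neg (not_le.mpr h1), if_pos h2, if_neg (not_le.mpr h1), if_pos h2, intCast_eq_cst,
      intCast_eq_cst, raise23']
  have e2 : ad α (E 0 2) (cartan α f * u α ν)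
      = cartan α (raise13' (ν 2) f) * u α (ν + eps 0 - eps 2) := by
    rw [ad_E_cartan_u α hν (by decide), shift_20, lmulX, lder, rmulX, rder,
      if_pos h0, if_pos h2, if_pos h0, if_pos h2, intCast_eq_cst, raise13', one_mul, one_mul]
  have e3 : ad α (E 1 0) (cartan α (raise13' (ν 2) f) * u α (ν + eps 0 - eps 2))
      = cartan α (raise21 (ν 0 + 1) (ν 1) (raise13' (ν 2) f)) * u α (ν + eps 1 - eps 2) := by
    have w0 : (ν + eps 0 - eps 2) 0 = ν 0 + 1 := by simp [eps]
    have w1 : (ν + eps 0 - eps 2) 1 = ν 1 := by simp [eps]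
    have := ad_z21 hs' (by rw [w0]; omega) (by rw [w1]; exact h1) (raise13' (ν 2) f)
    rw [z21, w0, w1] at this
    rw [this, show ν + eps 0 - eps 2 + eps 1 - eps 0 = ν + eps 1 - eps 2 by abel]
    push_cast
    rfl
  rw [z23, map_sub, map_mul (ad α), map_mul (ad α), LinearMap.sub_apply, Module.End.mul_apply,
    Module.End.mul_apply, e1, e2, e3, map_add, map_sub, LinearMap.add_apply, LinearMap.sub_apply,
    ad_diag α hs, ad_diag α hs, map_ofNat, Module.End.ofNat_apply, lower23, map_sub, sub_mul]
  congr 1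
  rw [map_mul (cartan α), cst, AlgHom.commutes, mul_assoc, ← Algebra.smul_def, ← Nat.cast_smul_eq_nsmul ℂ,
    ← sub_smul, ← add_smul]
  congr 1
  simp [eps]
  ring

/-- Each induction step starts from `ν + ε₁ - ε₃` or `ν + ε₁ - ε₂`, which stays in the region and
satisfies the strict sign conditions that `ad_z31` or `ad_z21` requires. -/
theorem hahn_vec31 (α : ℂ) (l k : ℕ) {ν : Fin 3 → ℤ} (hν : ν ∈ Q) (h0 : 0 ≤ ν 0) (h1 : ν 1 ≤ 0)
    (h2 : ν 2 ≤ 0) : cartan α (hahn α l k (ν 0) (ν 1) (ν 2)) * u α ν = vec31 α ν l k := by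
  induction l generalizing ν with
  | zero =>
    induction k generalizing ν with
    | zero => simp [hahn, vec31]
    | succ k ih =>
      have hs := root_mem_Q hν 0 2
      have w0 : (ν + eps 0 - eps 2) 0 = ν 0 + 1 := by simp [eps]
      have w1 : (ν + eps 0 - eps 2) 1 = ν 1 := by simp [eps]
      have w2 : (ν + eps 0 - eps 2) 2 = ν 2 - 1 := by simp [eps]
      have e1 : vec31 α ν 0 (k + 1) = ad α z31 (vec31 α (ν + eps 0 - eps 2) 0 k) := by
        rw [vec31, vec31, pow_succ', pow_zero, Module.End.one_apply, Module.End.one_apply,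
          Module.End.mul_apply]
        congr 4
        push_cast
        module
      rw [e1, ← ih hs (by omega) (by omega) (by omega),
        ad_z31 hs (by omega) (by omega) (by omega), w0, w1, w2,
        show ν + eps 0 - eps 2 + eps 2 - eps 0 = ν by abel, hahn]
      push_cast
      rfl
  | succ l ih =>
    have hs := root_mem_Q hν 0 1
    have w0 : (ν + eps 0 - eps 1) 0 = ν 0 + 1 := by simp [eps]
    have w1 : (ν + eps 0 - eps 1) 1 = ν 1 - 1 := by simp [eps]
    have w2 : (ν + eps 0 - eps 1) 2 = ν 2 := by simp [eps]
    have e1 : vec31 α ν (l + 1) k = ad α z21 (vec31 α (ν + eps 0 - eps 1) l k) := by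
      rw [vec31, vec31, pow_succ', Module.End.mul_apply]
      congr 4
      push_cast
      module
    rw [e1, ← ih hs (by omega) (by omega) (by omega),
      ad_z21 hs (by omega) (by omega), w0, w1, w2,
      show ν + eps 0 - eps 1 + eps 1 - eps 0 = ν by abel, hahn]
    push_cast
    rfl

theorem hahn'_vec23 (α : ℂ) (l k : ℕ) {ν : Fin 3 → ℤ} (hν : ν ∈ Q) (h0 : 0 ≤ ν 0) (h1 : ν 1 ≤ 0)
    (h2 : 0 ≤ ν 2) : cartan α (hahn' α l k (ν 0) (ν 1) (ν 2)) * u α ν = vec23 α ν l k := by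
  induction l generalizing ν with
  | zero =>
    induction k generalizing ν with
    | zero => simp [hahn'_zero, vec23]
    | succ k ih =>
      have hs := root_mem_Q hν 2 1
      have w0 : (ν + eps 2 - eps 1) 0 = ν 0 := by simp [eps]
      have w1 : (ν + eps 2 - eps 1) 1 = ν 1 - 1 := by simp [eps]
      have w2 : (ν + eps 2 - eps 1) 2 = ν 2 + 1 := by simp [eps]
      have e1 : vec23 α ν 0 (k + 1) = ad α z23 (vec23 α (ν + eps 2 - eps 1) 0 k) := by
        rw [vec23, vec23, pow_succ', pow_zero, Module.End.one_apply, Module.End.one_apply,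
          Module.End.mul_apply]
        congr 4
        push_cast
        module
      rw [e1, ← ih hs (by omega) (by omega) (by omega),
        ad_z23 hs (by omega) (by omega) (by omega), w0, w1, w2,
        show ν + eps 2 - eps 1 + eps 1 - eps 2 = ν by abel, hahn'_zero_succ]
      push_cast
      rfl
  | succ l ih =>
    have hs := root_mem_Q hν 0 1
    have w0 : (ν + eps 0 - eps 1) 0 = ν 0 + 1 := by simp [eps]
    have w1 : (ν + eps 0 - eps 1) 1 = ν 1 - 1 := by simp [eps]
    have w2 : (ν + eps 0 - eps 1) 2 = ν 2 := by simp [eps]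
    have e1 : vec23 α ν (l + 1) k = ad α z21 (vec23 α (ν + eps 0 - eps 1) l k) := by
      rw [vec23, vec23, pow_succ', Module.End.mul_apply]
      congr 4
      push_cast
      module
    rw [e1, ← ih hs (by omega) (by omega) (by omega),
      ad_z21 hs (by omega) (by omega), w0, w1, w2,
      show ν + eps 0 - eps 1 + eps 1 - eps 0 = ν by abel, hahn'_succ]
    push_cast
    rfl

/-! ### Orthogonal bases -/

theorem exists_nat_of_signs {ν : Fin 3 → ℤ} (h0 : 0 ≤ ν 0) (h1 : ν 1 ≤ 0) :
    ∃ a m : ℕ, ν 0 = a ∧ ν 1 = -(m : ℤ) :=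
  ⟨(ν 0).toNat, (-ν 1).toNat, by omega, by omega⟩

theorem isOrthogonalBasis_hahn {α : ℂ} {ν : Fin 3 → ℤ} (hν : ν ∈ Q) (h0 : 0 ≤ ν 0) (h1 : ν 1 ≤ 0)
    (h2 : ν 2 ≤ 0) :
    IsOrthogonalBasis α ν fun p : ℕ × ℕ => hahn α p.1 p.2 (ν 0) (ν 1) (ν 2) := by
  have hs : ν 0 + ν 1 + ν 2 = 0 := hν
  obtain ⟨a, m, ha, hm⟩ := exists_nat_of_signs h0 h1
  obtain ⟨q, hq⟩ : ∃ q : ℕ, ν 2 = -(q : ℤ) := ⟨(-ν 2).toNat, by omega⟩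
  have hamq : a = m + q := by omega
  have hs' : (a : ℂ) + -m + -q = 0 := by rw [hamq]; push_cast; ring
  have e : ∀ p : ℕ × ℕ, hahn α p.1 p.2 (ν 0) (ν 1) (ν 2) = hahn α p.1 p.2 a (-m) (-q) := by
    intro p; rw [ha, hm, hq]; push_cast; rfl
  simp only [e]
  refine ⟨hahn_linearIndependent α a m (-q) hs', hahn_span α a m (-q) hs', fun i j hij => ?_⟩
  rw [formR_eq α hν]
  have hw : weightProd α ν = regionWeight α a m q := by
    rw [weightProd, Fin.prod_univ_three, ha, hm, hq, weight_natCast, weight_neg_natCast,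
      weight_neg_natCast, regionWeight]
  rw [hw]
  exact hahn_orthogonal (shiftInvariant_traceFunctional α) a m q hamq hij

theorem isOrthogonalBasis_hahn' {α : ℂ} {ν : Fin 3 → ℤ} (hν : ν ∈ Q) (h0 : 0 ≤ ν 0) (h1 : ν 1 ≤ 0)
    (h2 : 0 ≤ ν 2) :
    IsOrthogonalBasis α ν fun p : ℕ × ℕ => hahn' α p.1 p.2 (ν 0) (ν 1) (ν 2) := by
  have hs : ν 0 + ν 1 + ν 2 = 0 := hν
  obtain ⟨a, m, ha, hm⟩ := exists_nat_of_signs h0 h1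
  obtain ⟨q, hq⟩ : ∃ q : ℕ, ν 2 = q := ⟨(ν 2).toNat, by omega⟩
  have hamq : a + q = m := by omega
  have e : ∀ p : ℕ × ℕ, hahn' α p.1 p.2 (ν 0) (ν 1) (ν 2) = hahn' α p.1 p.2 a (-m) q := by
    intro p; rw [ha, hm, hq]; push_cast; rfl
  simp only [e]
  refine ⟨hahn'_linearIndependent α a m q hamq, hahn'_span α a m q hamq, fun i j hij => ?_⟩
  rw [formR_eq α hν]
  have hw : weightProd α ν = fall α 0 a * rise α 1 m * fall α 2 q := by
    rw [weightProd, Fin.prod_univ_three, ha, hm, hq, weight_natCast, weight_neg_natCast,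
      weight_natCast]
  rw [hw]
  exact hahn'_orthogonal (shiftInvariant_traceFunctional α) a m q hamq hij

end GL3

end

open GL3 in
theorem theorem2p5 (α : ℂ) :
    -- the trace functional defining the form exists and is unique
    (∃! L : A α →ₗ[ℂ] ℂ, IsTraceFunctional α L) ∧
    -- weight spaces
    (∀ ν ∈ Q, weightSpace α ν = {a | ∃ f : R α, a = cartan α f * u α ν}) ∧
    -- for `α` not a nonnegative integer, the weight spaces are free of rank one over `R` and the
    -- generator is unique up to a constant factor
    ((¬ ∃ n : ℕ, α = n) → ∀ ν ∈ Q,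
      (∀ f g : R α, cartan α f * u α ν = cartan α g * u α ν → f = g) ∧
      ∀ a : A α, weightSpace α ν = {x | ∃ f : R α, x = cartan α f * a} →
        ∃ c : ℂ, c ≠ 0 ∧ a = c • u α ν) ∧
    -- orthogonality of weight spaces
    (∀ μ ∈ Q, ∀ ν ∈ Q, μ ≠ ν → ∀ a ∈ weightSpace α μ, ∀ b ∈ weightSpace α ν, form α a b = 0) ∧
    -- orthogonal bases and difference equations, `ν(E₃₃) ≤ 0`
    (∀ ν ∈ Qplus α, ν 2 ≤ 0 → ∃ f : ℕ × ℕ → R α,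
      (∀ l k, cartan α (f (l, k)) * u α ν = vec31 α ν l k) ∧
      IsOrthogonalBasis α ν f ∧
      ∀ l k, DiffEq₁ α ν l (f (l, k)) ∧ DiffEq₂ α ν l k (f (l, k))) ∧
    -- orthogonal bases, `ν(E₃₃) ≥ 0`
    (∀ ν ∈ Qplus α, 0 ≤ ν 2 → ∃ f : ℕ × ℕ → R α,
      (∀ l k, cartan α (f (l, k)) * u α ν = vec23 α ν l k) ∧
      IsOrthogonalBasis α ν f) ∧
    -- the Weyl group carries orthogonal bases to orthogonal bases
    (∀ ν ∈ Q, ∀ (ι : Type) (f : ι → R α), IsOrthogonalBasis α ν f →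
      ∀ w : Equiv.Perm (Fin 3),
        IsOrthogonalBasis α (fun i => ν (w.symm i)) (fun i => weyl α w (f i))) := by
  refine ⟨existsUnique_traceFunctional α, fun ν hν => weightSpace_eq hν, fun hα ν hν =>
    ⟨fun f g hfg => cartan_mul_u_injective hα hν hfg, fun a ha => generator_unique hα hν ha⟩,
    fun μ _ ν hν hμν a ha b hb => form_weight hν hμν ha hb, fun ν hν h2 => ?_, fun ν hν h2 => ?_,
    fun ν hν ι f hf w => isOrthogonalBasis_weyl hν hf w⟩
  · obtain ⟨h0, h1⟩ := Qplus_nonneg_nonpos hν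
    have hs : (ν 0 : ℂ) + ν 1 + ν 2 = 0 := by
      have : ν 0 + ν 1 + ν 2 = 0 := hν.1
      exact_mod_cast this
    exact ⟨fun p => hahn α p.1 p.2 (ν 0) (ν 1) (ν 2), fun l k => hahn_vec31 α l k hν.1 h0 h1 h2,
      isOrthogonalBasis_hahn hν.1 h0 h1 h2, fun l k =>
        ⟨diffEq₁_of_casimir₁ (casimir₁_hahn l k _ _ _ hs),
          diffEq₂_of_casimir₂ hν.1 (casimir₂_hahn l k _ _ _ hs)⟩⟩
  · obtain ⟨h0, h1⟩ := Qplus_nonneg_nonpos hν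
    exact ⟨fun p => hahn' α p.1 p.2 (ν 0) (ν 1) (ν 2), fun l k => hahn'_vec23 α l k hν.1 h0 h1 h2,
      isOrthogonalBasis_hahn' hν.1 h0 h1 h2⟩
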